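/- Let $U=V=\mathbb{C}^3$, let $\mathbf{Noc}=\mathrm{Hom}(S^2U,V)$ be the space of nets of conics, viewed as the space of quadratic maps $M:U\to V$ (equivalently, triples of ternary quadratic forms in the coordinates $x,y,z$ of $U$), and let $G=\mathrm{GL}(U)\times\mathrm{GL}(V)$ act on it by $((g,h)M)(u)=h(M(g^{-1}u))$. A net is *unstable* if it lies in the nullcone, i.e. every polynomial function on $\mathbf{Noc}$ which is invariant under $\mathrm{SL}(U)\times\mathrm{SL}(V)$ and has no constant term vanishes on it. The orbit $GM$ is *positive* if, for a maximal torus $T_M$ of the stabilizer $G_M$, there is a linear functional $\varphi$ on the real vector space spanned by the characters of $T_M$ such that $\varphi(w)>0$ for every weight $w$ of the action of $T_M$ on the normal space (the quotient of $\mathbf{Noc}$ by the tangent space of the orbit $GM$ at $M$). **Proposition.** All unstable orbits of $\mathbf{Noc}$ are positive. More precisely, the unstable nets are exactly the nets in the orbits of the representatives of the following table. For each row, the stabilizer of the representative has as a maximal torus the set of pairs of diagonal matrices with the listed weights on $U$ and on $V$ (so that, for instance, $(2\alpha,\alpha+\beta,2\beta)$ stands for $\mathrm{diag}(a^2,ab,b^2)$,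 $a,b\in\mathbb{C}^\times$), and the functional $\varphi$ with the listed values $\varphi(\alpha),\varphi(\beta),\dots$ is positive on all weights of this torus on the normal space to the orbit at the representative. | orbit | representative | weights on $U$; weights on $V$ | $\varphi(\alpha),\varphi(\beta),\dots$ | |---|---|---|---| | $C$ | $y^2+2xz,\ 2yz,\ -x^2$ | $(2\alpha,\alpha+\beta,2\beta);\ (2\alpha+2\beta,\alpha+3\beta,4\alpha)$ | $1,0$ | | $F$ | $x^2+y^2,\ 2xy,\ 2yz$ | $(\alpha,\alpha,\beta);\ (2\alpha,2\alpha,\alpha+\beta)$ | $1,0$ | | $F^*$ | $x^2+y^2,\ xz,\ z^2$ | $(\alpha,\alpha,\beta);\ (2\alpha,\alpha+\beta,2\beta)$ | $-1,0$ | | $G$ | $x^2,\ y^2,\ yz$ | $(\alpha,\beta,\gamma);\ (2\alpha,2\beta,\beta+\gamma)$ | $1,2,0$ | | $G^*$ | $xy,\ xz,\ z^2$ | $(\alpha,\beta,\gamma);\ (\alpha+\beta,\alpha+\gamma,2\gamma)$ | $-1,-2,0$ | | $H$ | $x^2,\ 2xy,\ y^2+2xz$ | $(2\alpha,\alpha+\beta,2\beta);\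 (4\alpha,3\alpha+\beta,2\alpha+2\beta)$ | $1,0$ | | $I$ | $x^2,\ xy,\ y^2$ | $(\alpha,\beta,\gamma);\ (2\alpha,\alpha+\beta,2\beta)$ | $0,0,-1$ | | $I^*$ | $xz,\ yz,\ z^2$ | $(\alpha,\beta,\gamma);\ (\alpha+\gamma,\beta+\gamma,2\gamma)$ | $0,0,1$ | | $(1^4)$ | $x^2-xz,\ y^2-yz,\ 0$ | $(\alpha,\alpha,\alpha);\ (2\alpha,2\alpha,\beta)$ | $0,1$ | | $(21^2)$ | $xy,\ xz+yz,\ 0$ | $(\alpha,\alpha,\beta);\ (2\alpha,\alpha+\beta,\gamma)$ | $1,0,3$ | | $(31)$ | $xz,\ x^2-yz,\ 0$ | $(\alpha+\beta,2\alpha,2\beta);\ (\alpha+3\beta,2\alpha+2\beta,\gamma)$ | $0,1,5$ | | $(22)$ | $x^2,\ yz,\ 0$ | $(\alpha,\beta,\gamma);\ (2\alpha,\beta+\gamma,\delta)$ | $1,0,0,2$ | | $(4)$ | $xz+y^2,\ x^2,\ 0$ | $(2\alpha,\alpha+\beta,2\beta);\ (2\alpha+2\beta,4\alpha,\gamma)$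 | $1,0,5$ | | $K$ | $y^2,\ z^2,\ 0$ | $(\beta,\alpha,\gamma);\ (2\alpha,2\gamma,\delta)$ | $0,-1,0,1$ | | $L$ | $xy,\ xz,\ 0$ | $(\alpha,\beta,\gamma);\ (\alpha+\beta,\alpha+\gamma,\delta)$ | $1,0,0,3$ | | $M$ | $yz,\ y^2,\ 0$ | $(\alpha,\beta,\gamma);\ (\beta+\gamma,2\beta,\delta)$ | $0,1,0,2$ | | $S$ | $xy-z^2,\ 0,\ 0$ | $(2\alpha,2\beta,\alpha+\beta);\ (2\alpha+2\beta,\gamma,\delta)$ | $0,0,1,1$ | | $PL$ | $xy,\ 0,\ 0$ | $(\alpha,\beta,\gamma);\ (\alpha+\beta,\delta,\epsilon)$ | $1,0,0,3,3$ | | $DL$ | $x^2,\ 0,\ 0$ | $(\alpha,\beta,\gamma);\ (2\alpha,\delta,\epsilon)$ | $1,0,0,3,3$ | | $0$ | $0,\ 0,\ 0$ | $(\alpha,\beta,\gamma);\ (\delta,\epsilon,\kappa)$ | $0,0,0,1,1,1$ | -/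

import Mathlib

noncomputable section

namespace NetsOfConics

/-! ### The representation -/

/-- The vector space `ℂ³`, used both for the plane variables `U` and for the target `V`. -/
abbrev C3 : Type := Fin 3 → ℂ

/-- Nets of conics: `Hom(S²U, V)`, that is, quadratic maps from `U = ℂ³` to `V = ℂ³`. -/
abbrev Noc : Type := QuadraticMap ℂ C3 C3

/-- The group `GL(U) × GL(V)`. -/
abbrev NetGroup : Type := GL (Fin 3) ℂ × GL (Fin 3) ℂ

/-- The action of `GL(U) × GL(V)` on nets: `((g, h) • M) u = h (M (g⁻¹ u))`. -/
def action : Representation ℂ NetGroup Noc where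
  toFun p :=
    { toFun := fun M => (Matrix.toLin' (p.2 : Matrix (Fin 3) (Fin 3) ℂ)).compQuadraticMap
        (M.comp (Matrix.toLin' ((p.1⁻¹ : GL (Fin 3) ℂ) : Matrix (Fin 3) (Fin 3) ℂ)))
      map_add' := fun M N => by ext u : 1; simp [Matrix.mulVec_add]
      map_smul' := fun c M => by ext u : 1; simp }
  map_one' := by
    ext M u : 2
    simp
  map_mul' p q := by
    ext M u : 2
    simp [mul_inv_rev, Matrix.toLin'_mul]

lemma action_apply (p : NetGroup) (M : Noc) (u : C3) :
    action p M u = (p.2 : Matrix (Fin 3) (Fin 3) ℂ).mulVec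
      (M (((p.1⁻¹ : GL (Fin 3) ℂ) : Matrix (Fin 3) (Fin 3) ℂ).mulVec u)) := by
  simp [action]

/-- The orbit of a net. -/
def orbit (M : Noc) : Set Noc := {N | ∃ p : NetGroup, N = action p M}

/-- The stabilizer of a net. -/
def stabilizer (M : Noc) : Subgroup NetGroup where
  carrier := {p | action p M = M}
  mul_mem' := by
    intro p q hp hq
    simp only [Set.mem_ofPred_eq] at *
    rw [map_mul, Module.End.mul_apply, hq, hp]
  one_mem' := by simp
  inv_mem' := by
    intro p hp
    simp only [Set.mem_ofPred_eq] at *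
    conv_lhs => rw [← hp]
    rw [← Module.End.mul_apply, ← map_mul]
    simp

/-! ### Unstable nets -/

/-- Polynomial functions on `Noc`: the algebra of functions generated by the linear forms. -/
def polynomialFunctions : Subalgebra ℂ (Noc → ℂ) :=
  Algebra.adjoin ℂ (Set.range fun l : Noc →ₗ[ℂ] ℂ => (l : Noc → ℂ))

/-- Invariance under `SL(U) × SL(V)`. -/
def IsInvariant (f : Noc → ℂ) : Prop :=
  ∀ p : NetGroup, (p.1 : Matrix (Fin 3) (Fin 3) ℂ).det = 1 →
    (p.2 : Matrix (Fin 3) (Fin 3) ℂ).det = 1 → ∀ N : Noc, f (action p N) = f N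

/-- A net is unstable if it lies in the nullcone: every polynomial invariant of `SL(U) × SL(V)`
without constant term vanishes on it. -/
def IsUnstable (M : Noc) : Prop :=
  ∀ f ∈ polynomialFunctions, IsInvariant f → f 0 = 0 → f M = 0

/-! ### Tori in the group -/

/-- The character `t ↦ ∏ tᵢ ^ mᵢ` of `(ℂˣ)^r`. -/
def character {r : ℕ} (m : Fin r → ℤ) (t : Fin r → ℂˣ) : ℂˣ := ∏ i, t i ^ m i

/-- Laurent polynomial functions on `(ℂˣ)^r`. -/
def IsLaurent {r : ℕ} (f : (Fin r → ℂˣ) → ℂ) : Prop :=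
  ∃ c : (Fin r → ℤ) →₀ ℂ, ∀ t, f t = c.sum fun m a => a * (character m t : ℂ)

/-- A parametrization of an `r`-dimensional torus of `GL(U) × GL(V)`: a homomorphism of algebraic
groups from `(ℂˣ)^r` with finite kernel. Through it, the real vector space spanned by the
characters of the image torus is identified with `ℝ^r`. -/
def IsTorusParametrization {r : ℕ} (ρ : (Fin r → ℂˣ) →* NetGroup) : Prop :=
  (∀ i j, IsLaurent fun t => ((ρ t).1 : Matrix (Fin 3) (Fin 3) ℂ) i j) ∧
  (∀ i j, IsLaurent fun t => ((ρ t).2 : Matrix (Fin 3) (Fin 3) ℂ) i j) ∧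
  Finite ρ.ker

/-- Algebraic tori in `GL(U) × GL(V)`. -/
def IsTorus (T : Subgroup NetGroup) : Prop :=
  ∃ (r : ℕ) (ρ : (Fin r → ℂˣ) →* NetGroup), IsTorusParametrization ρ ∧ ρ.range = T

/-- `T` is a maximal torus of the subgroup `S`. -/
def IsMaximalTorus (T S : Subgroup NetGroup) : Prop :=
  Maximal (fun T' => IsTorus T' ∧ T' ≤ S) T

/-! ### The normal space and its weights -/

/-- The infinitesimal action of `(X, Y) ∈ 𝔤𝔩(U) × 𝔤𝔩(V)` at a net `M`, that is, the derivative at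
`s = 0` of `(exp (sX), exp (sY)) • M`. It is the net `u ↦ Y (M u) - M'(u)(X u)`, where the
derivative `M'(u)` of `M` at `u` is `w ↦ M (u + w) - M u - M w`. -/
def infinitesimalAction (M : Noc) :
    (Matrix (Fin 3) (Fin 3) ℂ × Matrix (Fin 3) (Fin 3) ℂ) →ₗ[ℂ] Noc where
  toFun Z := (Matrix.toLin' Z.2).compQuadraticMap M -
    LinearMap.BilinMap.toQuadraticMap (M.polarBilin.compl₂ (Matrix.toLin' Z.1))
  map_add' Z W := by
    ext u : 1
    simp [QuadraticMap.polar_add_right]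
    abel
  map_smul' c Z := by
    ext u : 1
    simp [smul_sub]

lemma infinitesimalAction_apply (M : Noc) (X Y : Matrix (Fin 3) (Fin 3) ℂ) (u : C3) :
    infinitesimalAction M (X, Y) u = Y.mulVec (M u) - QuadraticMap.polar M u (X.mulVec u) := by
  simp [infinitesimalAction]

/-- The tangent space at `M` of the orbit of `M`. -/
def tangentSpace (M : Noc) : Submodule ℂ Noc := LinearMap.range (infinitesimalAction M)

/-- The normal space at `M` to the orbit of `M`. -/
abbrev NormalSpace (M : Noc) : Type := Noc ⧸ tangentSpace M

/-- `m ∈ ℤ^r` is a weight of the action on the normal space at `M` of the torus parametrized by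
`ρ`: some nonzero normal vector (the class of a net `N`) is multiplied by the character `m`. -/
def IsNormalWeight (M : Noc) {r : ℕ} (ρ : (Fin r → ℂˣ) →* NetGroup) (m : Fin r → ℤ) : Prop :=
  ∃ N : Noc, (Submodule.Quotient.mk N : NormalSpace M) ≠ 0 ∧
    ∀ t, (Submodule.Quotient.mk (action (ρ t) N) : NormalSpace M) =
      (character m t : ℂ) • (Submodule.Quotient.mk N : NormalSpace M)

/-! ### Positivity -/

/-- `ρ` parametrizes a maximal torus of the stabilizer of `M`, and the linear functional `φ` on its
weight space is positive on all weights of the normal space at `M`. -/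
def IsPositivityWitness (M : Noc) {r : ℕ} (ρ : (Fin r → ℂˣ) →* NetGroup)
    (φ : (Fin r → ℝ) →ₗ[ℝ] ℝ) : Prop :=
  IsTorusParametrization ρ ∧ IsMaximalTorus ρ.range (stabilizer M) ∧
    ∀ m : Fin r → ℤ, IsNormalWeight M ρ m → 0 < φ fun i => (m i : ℝ)

/-- The orbit of `M` is positive. -/
def IsPositive (M : Noc) : Prop :=
  ∃ (r : ℕ) (ρ : (Fin r → ℂˣ) →* NetGroup) (φ : (Fin r → ℝ) →ₗ[ℝ] ℝ), IsPositivityWitness M ρ φ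

/-! ### The table of unstable orbits -/

/-- The diagonal matrix with given invertible entries. -/
def diagonalGL : (Fin 3 → ℂˣ) →* GL (Fin 3) ℂ :=
  (Units.map (Matrix.diagonalRingHom (Fin 3) ℂ).toMonoidHom).comp
    (MulEquiv.piUnits (M := fun _ : Fin 3 => ℂ)).symm.toMonoidHom

lemma diagonalGL_coe (d : Fin 3 → ℂˣ) :
    (diagonalGL d : Matrix (Fin 3) (Fin 3) ℂ) = Matrix.diagonal fun i => (d i : ℂ) := rfl

/-- The homomorphism `t ↦ (diag(t^{a₁}, t^{a₂}, t^{a₃}), diag(t^{b₁}, t^{b₂}, t^{b₃}))`. -/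
def diagonalHom {r : ℕ} (a b : Fin 3 → Fin r → ℤ) : (Fin r → ℂˣ) →* NetGroup where
  toFun t := (diagonalGL fun i => character (a i) t, diagonalGL fun i => character (b i) t)
  map_one' := by
    have h : ∀ m : Fin r → ℤ, character m 1 = 1 := fun m => by simp [character]
    simp only [h]
    exact Prod.ext (map_one diagonalGL) (map_one diagonalGL)
  map_mul' s t := by
    have h : ∀ m : Fin r → ℤ, character m (s * t) = character m s * character m t := fun m => by
      simp [character, mul_zpow, Finset.prod_mul_distrib]
    simp only [h]
    exact Prod.ext (map_mul diagonalGL _ _) (map_mul diagonalGL _ _)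

/-- The net with components the three given quadratic forms. -/
def net (q₁ q₂ q₃ : QuadraticForm ℂ C3) : Noc :=
  (LinearMap.single ℂ (fun _ : Fin 3 => ℂ) 0).compQuadraticMap q₁ +
  (LinearMap.single ℂ (fun _ : Fin 3 => ℂ) 1).compQuadraticMap q₂ +
  (LinearMap.single ℂ (fun _ : Fin 3 => ℂ) 2).compQuadraticMap q₃

lemma net_apply (q₁ q₂ q₃ : QuadraticForm ℂ C3) (u : C3) :
    net q₁ q₂ q₃ u = ![q₁ u, q₂ u, q₃ u] := by
  ext i
  fin_cases i <;> simp [net]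

/-- The six monomials of degree two in the coordinates `x, y, z` of `ℂ³`. -/
def xx : QuadraticForm ℂ C3 := QuadraticMap.proj 0 0
def yy : QuadraticForm ℂ C3 := QuadraticMap.proj 1 1
def zz : QuadraticForm ℂ C3 := QuadraticMap.proj 2 2
def xy : QuadraticForm ℂ C3 := QuadraticMap.proj 0 1
def xz : QuadraticForm ℂ C3 := QuadraticMap.proj 0 2
def yz : QuadraticForm ℂ C3 := QuadraticMap.proj 1 2

/-- Names of the unstable orbits: proper nets, pencils, single conics, and zero. -/
inductive OrbitName
  | C | F | Fdual | G | Gdual | H | I | Idual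
  | pencil1111 | pencil211 | pencil31 | pencil22 | pencil4 | K | L | M
  | S | PL | DL
  | zero

/-- A row of the table: a representative, the weights on `U` and on `V` of a torus (in terms of
`α, β, …`, the standard basis of `ℤ^rank`), and the values `φ(α), φ(β), …` of a functional. -/
structure Row where
  rank : ℕ
  representative : Noc
  weightsU : Fin 3 → Fin rank → ℤ
  weightsV : Fin 3 → Fin rank → ℤ
  values : Fin rank → ℝ

/-- The torus of a row. -/
def Row.torus (R : Row) : (Fin R.rank → ℂˣ) →* NetGroup := diagonalHom R.weightsU R.weightsV

/-- The functional of a row: `m ↦ ∑ i, m i * values i`. -/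
def Row.functional (R : Row) : (Fin R.rank → ℝ) →ₗ[ℝ] ℝ := Fintype.linearCombination ℝ R.values

/-- The table. -/
def table : OrbitName → Row
  | .C => ⟨2, net (yy + 2 • xz) (2 • yz) (-xx),
      ![![2, 0], ![1, 1], ![0, 2]], ![![2, 2], ![1, 3], ![4, 0]], ![1, 0]⟩
  | .F => ⟨2, net (xx + yy) (2 • xy) (2 • yz),
      ![![1, 0], ![1, 0], ![0, 1]], ![![2, 0], ![2, 0], ![1, 1]], ![1, 0]⟩
  | .Fdual => ⟨2, net (xx + yy) xz zz,
      ![![1, 0], ![1, 0], ![0, 1]], ![![2, 0], ![1, 1], ![0, 2]], ![-1, 0]⟩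
  | .G => ⟨3, net xx yy yz,
      ![![1, 0, 0], ![0, 1, 0], ![0, 0, 1]], ![![2, 0, 0], ![0, 2, 0], ![0, 1, 1]], ![1, 2, 0]⟩
  | .Gdual => ⟨3, net xy xz zz,
      ![![1, 0, 0], ![0, 1, 0], ![0, 0, 1]], ![![1, 1, 0], ![1, 0, 1], ![0, 0, 2]], ![-1, -2, 0]⟩
  | .H => ⟨2, net xx (2 • xy) (yy + 2 • xz),
      ![![2, 0], ![1, 1], ![0, 2]], ![![4, 0], ![3, 1], ![2, 2]], ![1, 0]⟩
  | .I => ⟨3, net xx xy yy,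
      ![![1, 0, 0], ![0, 1, 0], ![0, 0, 1]], ![![2, 0, 0], ![1, 1, 0], ![0, 2, 0]], ![0, 0, -1]⟩
  | .Idual => ⟨3, net xz yz zz,
      ![![1, 0, 0], ![0, 1, 0], ![0, 0, 1]], ![![1, 0, 1], ![0, 1, 1], ![0, 0, 2]], ![0, 0, 1]⟩
  | .pencil1111 => ⟨2, net (xx - xz) (yy - yz) 0,
      ![![1, 0], ![1, 0], ![1, 0]], ![![2, 0], ![2, 0], ![0, 1]], ![0, 1]⟩
  | .pencil211 => ⟨3, net xy (xz + yz) 0,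
      ![![1, 0, 0], ![1, 0, 0], ![0, 1, 0]], ![![2, 0, 0], ![1, 1, 0], ![0, 0, 1]], ![1, 0, 3]⟩
  | .pencil31 => ⟨3, net xz (xx - yz) 0,
      ![![1, 1, 0], ![2, 0, 0], ![0, 2, 0]], ![![1, 3, 0], ![2, 2, 0], ![0, 0, 1]], ![0, 1, 5]⟩
  | .pencil22 => ⟨4, net xx yz 0,
      ![![1, 0, 0, 0], ![0, 1, 0, 0], ![0, 0, 1, 0]],
      ![![2, 0, 0, 0], ![0, 1, 1, 0], ![0, 0, 0, 1]], ![1, 0, 0, 2]⟩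
  | .pencil4 => ⟨3, net (xz + yy) xx 0,
      ![![2, 0, 0], ![1, 1, 0], ![0, 2, 0]], ![![2, 2, 0], ![4, 0, 0], ![0, 0, 1]], ![1, 0, 5]⟩
  | .K => ⟨4, net yy zz 0,
      ![![0, 1, 0, 0], ![1, 0, 0, 0], ![0, 0, 1, 0]],
      ![![2, 0, 0, 0], ![0, 0, 2, 0], ![0, 0, 0, 1]], ![0, -1, 0, 1]⟩
  | .L => ⟨4, net xy xz 0,
      ![![1, 0, 0, 0], ![0, 1, 0, 0], ![0, 0, 1, 0]],
      ![![1, 1, 0, 0], ![1, 0, 1, 0], ![0, 0, 0, 1]], ![1, 0, 0, 3]⟩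
  | .M => ⟨4, net yz yy 0,
      ![![1, 0, 0, 0], ![0, 1, 0, 0], ![0, 0, 1, 0]],
      ![![0, 1, 1, 0], ![0, 2, 0, 0], ![0, 0, 0, 1]], ![0, 1, 0, 2]⟩
  | .S => ⟨4, net (xy - zz) 0 0,
      ![![2, 0, 0, 0], ![0, 2, 0, 0], ![1, 1, 0, 0]],
      ![![2, 2, 0, 0], ![0, 0, 1, 0], ![0, 0, 0, 1]], ![0, 0, 1, 1]⟩
  | .PL => ⟨5, net xy 0 0,
      ![![1, 0, 0, 0, 0], ![0, 1, 0, 0, 0], ![0, 0, 1, 0, 0]],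
      ![![1, 1, 0, 0, 0], ![0, 0, 0, 1, 0], ![0, 0, 0, 0, 1]], ![1, 0, 0, 3, 3]⟩
  | .DL => ⟨5, net xx 0 0,
      ![![1, 0, 0, 0, 0], ![0, 1, 0, 0, 0], ![0, 0, 1, 0, 0]],
      ![![2, 0, 0, 0, 0], ![0, 0, 0, 1, 0], ![0, 0, 0, 0, 1]], ![1, 0, 0, 3, 3]⟩
  | .zero => ⟨6, net 0 0 0,
      ![![1, 0, 0, 0, 0, 0], ![0, 1, 0, 0, 0, 0], ![0, 0, 1, 0, 0, 0]],
      ![![0, 0, 0, 1, 0, 0], ![0, 0, 0, 0, 1, 0], ![0, 0, 0, 0, 0, 1]], ![0, 0, 0, 1, 1, 1]⟩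

end NetsOfConics

end

noncomputable section

namespace NetsOfConics

/-! ### Coordinates on nets, and equivalence of nets -/

/-! Instability is detected by the discriminant cubic det(xG₀ + yG₁ + zG₂), where the Gᵢ are the
Gram matrices of the three conics. A change of coordinates on U multiplies this cubic by a squared
determinant and one on V substitutes linearly in it (`netCubic_change`), so Aronhold's invariants of
the cubic are invariants of nets. The quartic invariant S is written out; the sextic one enters
through S(F + tH(F)), with H the Hessian and t arbitrary. A cubic on which all these values vanish
can be moved into the span of x³, x²y, x²z, xy², y³; the generic such cubic is cuspidal
(`Cubic.InvariantsVanish.hasNullform`).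

For an unstable net the same move is made on V. The third conic then has zero determinant, so it
becomes 0, x² or xy, and the other vanishing coefficients restrict the first two conics so much that
elementary normal forms end in the table (`inTable_of_isNullform`). Conversely, a one-parameter
subgroup of SL(U) × SL(V) scales each representative M by s, so an invariant f satisfies f(sM) =
f(M), and s → 0 gives f(M) = f(0) (`isUnstable_of_oneParameterSubgroup`). No numerical criterion for
the nullcone is needed.

Positivity of a row is reduced to linear algebra (`isPositivityWitness_diagonalHom`). A torus of the
stabilizer containing the listed torus is commutative, so its Lie algebra commutes with the listed
torus and annihilates M; if all such matrices are tangent to the listed torus, that torus is maximal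
(`isMaximalTorus_diagonalHom`). For the weights, the integral functional φ is read as a
one-parameter subgroup: once every monomial net of nonpositive weight is tangent to the orbit, the
normal space is spanned by classes of positive weight (`pos_of_isNormalWeight`). Conjugation carries
the witness from a representative to its whole orbit. -/

@[simp] lemma xx_apply (u : C3) : xx u = u 0 * u 0 := rfl
@[simp] lemma yy_apply (u : C3) : yy u = u 1 * u 1 := rfl
@[simp] lemma zz_apply (u : C3) : zz u = u 2 * u 2 := rfl
@[simp] lemma xy_apply (u : C3) : xy u = u 0 * u 1 := rfl
@[simp] lemma xz_apply (u : C3) : xz u = u 0 * u 2 := rfl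
@[simp] lemma yz_apply (u : C3) : yz u = u 1 * u 2 := rfl

/-- The quadratic form `a x² + b y² + c z² + d xy + e xz + f yz`. -/
def conic (a b c d e f : ℂ) : QuadraticForm ℂ C3 :=
  a • xx + b • yy + c • zz + d • xy + e • xz + f • yz

@[simp] lemma conic_apply (a b c d e f : ℂ) (u : C3) :
    conic a b c d e f u = a * (u 0 * u 0) + b * (u 1 * u 1) + c * (u 2 * u 2) +
      d * (u 0 * u 1) + e * (u 0 * u 2) + f * (u 1 * u 2) := by
  simp [conic]

lemma eq_sum_single (u : C3) :
    u = u 0 • Pi.single 0 1 + u 1 • Pi.single 1 1 + u 2 • Pi.single 2 1 := by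
  ext i
  fin_cases i <;> simp

/-- The expansion of a quadratic map in coordinates. -/
lemma quadraticMap_expand {E : Type*} [AddCommGroup E] [Module ℂ E] (Q : QuadraticMap ℂ C3 E)
    (u : C3) :
    Q u = (u 0 * u 0) • Q (Pi.single 0 1) + (u 1 * u 1) • Q (Pi.single 1 1) +
      (u 2 * u 2) • Q (Pi.single 2 1) +
      (u 0 * u 1) • QuadraticMap.polar Q (Pi.single 0 1) (Pi.single 1 1) +
      (u 0 * u 2) • QuadraticMap.polar Q (Pi.single 0 1) (Pi.single 2 1) +
      (u 1 * u 2) • QuadraticMap.polar Q (Pi.single 1 1) (Pi.single 2 1) := by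
  conv_lhs => rw [eq_sum_single u]
  rw [QuadraticMap.map_add (⇑Q), QuadraticMap.map_add (⇑Q)]
  simp only [QuadraticMap.map_smul, QuadraticMap.polar_add_left, QuadraticMap.polar_smul_left,
    QuadraticMap.polar_smul_right, smul_smul]
  module

lemma exists_conic (Q : QuadraticForm ℂ C3) : ∃ a b c d e f, Q = conic a b c d e f := by
  refine ⟨Q (Pi.single 0 1), Q (Pi.single 1 1), Q (Pi.single 2 1),
    QuadraticMap.polar Q (Pi.single 0 1) (Pi.single 1 1),
    QuadraticMap.polar Q (Pi.single 0 1) (Pi.single 2 1),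
    QuadraticMap.polar Q (Pi.single 1 1) (Pi.single 2 1), QuadraticMap.ext fun u => ?_⟩
  rw [quadraticMap_expand Q u, conic_apply]
  simp only [smul_eq_mul]
  ring

lemma exists_net (M : Noc) : ∃ q₁ q₂ q₃ : QuadraticForm ℂ C3, M = net q₁ q₂ q₃ := by
  refine ⟨(LinearMap.proj (R := ℂ) (φ := fun _ : Fin 3 => ℂ) 0).compQuadraticMap M,
    (LinearMap.proj (R := ℂ) (φ := fun _ : Fin 3 => ℂ) 1).compQuadraticMap M,
    (LinearMap.proj (R := ℂ) (φ := fun _ : Fin 3 => ℂ) 2).compQuadraticMap M, ?_⟩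
  ext u i
  rw [net_apply]
  fin_cases i <;> simp

/-- Two nets are equivalent if they differ by invertible linear changes of coordinates. -/
def Equivalent (M N : Noc) : Prop :=
  ∃ g h : Matrix (Fin 3) (Fin 3) ℂ, g.det ≠ 0 ∧ h.det ≠ 0 ∧
    ∀ u, N u = h.mulVec (M (g.mulVec u))

lemma mem_orbit_iff {M N : Noc} : N ∈ orbit M ↔ Equivalent M N := by
  constructor
  · rintro ⟨p, rfl⟩
    refine ⟨((p.1⁻¹ : GL (Fin 3) ℂ) : Matrix (Fin 3) (Fin 3) ℂ), p.2, ?_, ?_, fun u => ?_⟩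
    · exact ((Matrix.isUnit_iff_isUnit_det _).1 (p.1⁻¹).isUnit).ne_zero
    · exact ((Matrix.isUnit_iff_isUnit_det _).1 p.2.isUnit).ne_zero
    · rw [action_apply]
  · rintro ⟨g, h, hg, hh, H⟩
    refine ⟨((Matrix.GeneralLinearGroup.mkOfDetNeZero g hg)⁻¹,
      Matrix.GeneralLinearGroup.mkOfDetNeZero h hh), QuadraticMap.ext fun u => ?_⟩
    rw [action_apply, H, inv_inv]
    rfl

lemma Equivalent.trans {M N P : Noc} : Equivalent M N → Equivalent N P → Equivalent M P := by
  rintro ⟨g, h, hg, hh, H⟩ ⟨g', h', hg', hh', H'⟩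
  refine ⟨g * g', h' * h, by simp [hg, hg'], by simp [hh, hh'], fun u => ?_⟩
  rw [H', H]
  simp [Matrix.mulVec_mulVec]

lemma Equivalent.symm {M N : Noc} : Equivalent M N → Equivalent N M := by
  rintro ⟨g, h, hg, hh, H⟩
  refine ⟨g⁻¹, h⁻¹, ?_, ?_, fun u => ?_⟩
  · simpa [Matrix.det_nonsing_inv] using hg
  · simpa [Matrix.det_nonsing_inv] using hh
  · rw [H]
    simp [Matrix.mulVec_mulVec, Matrix.nonsing_inv_mul _ (isUnit_iff_ne_zero.2 hh),
      Matrix.mul_nonsing_inv _ (isUnit_iff_ne_zero.2 hg)]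

lemma Equivalent.of_forall {M N : Noc} (g h : Matrix (Fin 3) (Fin 3) ℂ) (hg : g.det ≠ 0)
    (hh : h.det ≠ 0)
    (H : ∀ x y z, N ![x, y, z] = h.mulVec (M (g.mulVec ![x, y, z]))) : Equivalent M N := by
  refine ⟨g, h, hg, hh, fun u => ?_⟩
  have hu : u = ![u 0, u 1, u 2] := by ext i; fin_cases i <;> rfl
  rw [hu]
  exact H _ _ _

/-- Orbits of the table. -/
def InTable (M : Noc) : Prop := ∃ o, M ∈ orbit (table o).representative

lemma InTable.of_equivalent {M N : Noc} (hN : InTable N) (h : Equivalent M N) : InTable M := by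
  obtain ⟨o, ho⟩ := hN
  exact ⟨o, mem_orbit_iff.2 ((mem_orbit_iff.1 ho).trans h.symm)⟩

lemma InTable.of_representative {M : Noc} (o : OrbitName)
    (h : Equivalent M (table o).representative) : InTable M :=
  ⟨o, mem_orbit_iff.2 h.symm⟩

/-! ### Ternary cubics -/

/-- The ternary cubic
`a x³ + b y³ + c z³ + 3 (a₂ x²y + a₃ x²z + b₁ y²x + b₃ y²z + c₁ z²x + c₂ z²y) + 6 m xyz`. -/
@[ext] structure Cubic (A : Type*) where
  (a b c a₂ a₃ b₁ b₃ c₁ c₂ m : A)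

namespace Cubic

variable {A : Type*} [CommRing A]

/-- The value of a cubic at a point. -/
def eval (F : Cubic A) (v : Fin 3 → A) : A :=
  F.a * v 0 ^ 3 + F.b * v 1 ^ 3 + F.c * v 2 ^ 3 +
    3 * (F.a₂ * v 0 ^ 2 * v 1 + F.a₃ * v 0 ^ 2 * v 2 + F.b₁ * v 1 ^ 2 * v 0 +
      F.b₃ * v 1 ^ 2 * v 2 + F.c₁ * v 2 ^ 2 * v 0 + F.c₂ * v 2 ^ 2 * v 1) +
    6 * F.m * (v 0 * v 1 * v 2)

/-- Aronhold's invariant of degree four. -/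
def aronhold (F : Cubic A) : A :=
  F.a * F.b * F.c * F.m -
    (F.b * F.c * F.a₂ * F.a₃ + F.c * F.a * F.b₁ * F.b₃ + F.a * F.b * F.c₁ * F.c₂) -
    F.m * (F.a * F.b₃ * F.c₂ + F.b * F.c₁ * F.a₃ + F.c * F.a₂ * F.b₁) +
    (F.a * F.b₁ * F.c₂ ^ 2 + F.a * F.c₁ * F.b₃ ^ 2 + F.b * F.a₂ * F.c₁ ^ 2 +
      F.b * F.c₂ * F.a₃ ^ 2 + F.c * F.b₃ * F.a₂ ^ 2 + F.c * F.a₃ * F.b₁ ^ 2) -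
    F.m ^ 4 + 2 * F.m ^ 2 * (F.b₁ * F.c₁ + F.c₂ * F.a₂ + F.a₃ * F.b₃) -
    3 * F.m * (F.a₂ * F.b₃ * F.c₁ + F.a₃ * F.b₁ * F.c₂) -
    (F.b₁ ^ 2 * F.c₁ ^ 2 + F.c₂ ^ 2 * F.a₂ ^ 2 + F.a₃ ^ 2 * F.b₃ ^ 2) +
    (F.c₂ * F.a₂ * F.a₃ * F.b₃ + F.a₃ * F.b₃ * F.b₁ * F.c₁ + F.b₁ * F.c₁ * F.c₂ * F.a₂)

/-- The symmetric matrices of second derivatives of the cubic `6 F`. -/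
def slice (F : Cubic A) : Fin 3 → Matrix (Fin 3) (Fin 3) A :=
  ![!![F.a, F.a₂, F.a₃; F.a₂, F.b₁, F.m; F.a₃, F.m, F.c₁],
    !![F.a₂, F.b₁, F.m; F.b₁, F.b, F.b₃; F.m, F.b₃, F.c₂],
    !![F.a₃, F.m, F.c₁; F.m, F.b₃, F.c₂; F.c₁, F.c₂, F.c]]

/-- The complete polarization of a cubic. -/
def polar (F : Cubic A) (u v w : Fin 3 → A) : A :=
  u 0 * (v 0 * (F.a * w 0 + F.a₂ * w 1 + F.a₃ * w 2) +
      v 1 * (F.a₂ * w 0 + F.b₁ * w 1 + F.m * w 2) +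
      v 2 * (F.a₃ * w 0 + F.m * w 1 + F.c₁ * w 2)) +
    u 1 * (v 0 * (F.a₂ * w 0 + F.b₁ * w 1 + F.m * w 2) +
      v 1 * (F.b₁ * w 0 + F.b * w 1 + F.b₃ * w 2) +
      v 2 * (F.m * w 0 + F.b₃ * w 1 + F.c₂ * w 2)) +
    u 2 * (v 0 * (F.a₃ * w 0 + F.m * w 1 + F.c₁ * w 2) +
      v 1 * (F.m * w 0 + F.b₃ * w 1 + F.c₂ * w 2) +
      v 2 * (F.c₁ * w 0 + F.c₂ * w 1 + F.c * w 2))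

/-- The cubic with prescribed polarization at the basis vectors. -/
def ofTensor (t : Fin 3 → Fin 3 → Fin 3 → A) : Cubic A :=
  ⟨t 0 0 0, t 1 1 1, t 2 2 2, t 0 0 1, t 0 0 2, t 1 1 0, t 1 1 2, t 2 2 0, t 2 2 1, t 0 1 2⟩

/-- The linear substitution `v ↦ F (h v)`. -/
def subst (h : Matrix (Fin 3) (Fin 3) A) (F : Cubic A) : Cubic A :=
  ofTensor fun i j k => F.polar (fun l => h l i) (fun l => h l j) (fun l => h l k)

lemma eval_subst (h : Matrix (Fin 3) (Fin 3) A) (F : Cubic A) (v : Fin 3 → A) :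
    (F.subst h).eval v = F.eval (h.mulVec v) := by
  simp only [eval, subst, ofTensor, polar, Matrix.mulVec, dotProduct, Fin.sum_univ_three]
  ring

/-- Ten well-chosen points determine a cubic: the basis vectors give the cubes, the sums and
differences of two of them separate the two mixed coefficients of each pair, and (1, 1, 1) gives the
last one. -/
lemma ext_eval {F G : Cubic ℂ} (H : ∀ v, F.eval v = G.eval v) : F = G := by
  have h1 := H ![1, 0, 0]
  have h2 := H ![0, 1, 0]
  have h3 := H ![0, 0, 1]
  have h4 := H ![1, 1, 0]
  have h5 := H ![1, -1, 0]
  have h6 := H ![1, 0, 1]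
  have h7 := H ![1, 0, -1]
  have h8 := H ![0, 1, 1]
  have h9 := H ![0, 1, -1]
  have h0 := H ![1, 1, 1]
  simp [eval] at h1 h2 h3 h4 h5 h6 h7 h8 h9 h0
  ext <;> grind

lemma subst_mul (g h : Matrix (Fin 3) (Fin 3) ℂ) (F : Cubic ℂ) :
    F.subst (g * h) = (F.subst g).subst h := by
  refine ext_eval fun v => ?_
  rw [eval_subst, eval_subst, eval_subst, Matrix.mulVec_mulVec]

/-- The invertible matrices are generated by diagonal matrices and transvections, and the formula is
multiplicative in `h`. On generators it is a short polynomial identity, unlike for a general matrix.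
-/
lemma aronhold_subst (h : Matrix (Fin 3) (Fin 3) ℂ) (hh : h.det ≠ 0) (F : Cubic ℂ) :
    (F.subst h).aronhold = h.det ^ 4 * F.aronhold := by
  revert F
  refine Matrix.diagonal_transvection_induction_of_det_ne_zero
    (fun h => ∀ F : Cubic ℂ, (F.subst h).aronhold = h.det ^ 4 * F.aronhold) h hh
    (fun D _ F => ?_) (fun t F => ?_) (fun A B _ _ hA hB F => ?_)
  · simp [aronhold, subst, ofTensor, polar, Matrix.diagonal, Matrix.det_fin_three]
    ring
  · obtain ⟨i, j, hij, c⟩ := t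
    rw [Matrix.TransvectionStruct.det]
    fin_cases i <;> fin_cases j <;> first | exact absurd rfl hij |
      (simp [aronhold, subst, ofTensor, polar, Matrix.TransvectionStruct.toMatrix,
        Matrix.transvection, Matrix.single]
       ring)
  · rw [subst_mul, hB, hA, Matrix.det_mul]
    ring

instance : Add (Cubic A) :=
  ⟨fun F G => ⟨F.a + G.a, F.b + G.b, F.c + G.c, F.a₂ + G.a₂, F.a₃ + G.a₃, F.b₁ + G.b₁,
    F.b₃ + G.b₃, F.c₁ + G.c₁, F.c₂ + G.c₂, F.m + G.m⟩⟩

instance : SMul A (Cubic A) :=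
  ⟨fun t F => ⟨t * F.a, t * F.b, t * F.c, t * F.a₂, t * F.a₃, t * F.b₁, t * F.b₃, t * F.c₁,
    t * F.c₂, t * F.m⟩⟩

lemma add_def (F G : Cubic A) : F + G = ⟨F.a + G.a, F.b + G.b, F.c + G.c, F.a₂ + G.a₂,
    F.a₃ + G.a₃, F.b₁ + G.b₁, F.b₃ + G.b₃, F.c₁ + G.c₁, F.c₂ + G.c₂, F.m + G.m⟩ := rfl

lemma smul_def (t : A) (F : Cubic A) : t • F = ⟨t * F.a, t * F.b, t * F.c, t * F.a₂, t * F.a₃,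
    t * F.b₁, t * F.b₃, t * F.c₁, t * F.c₂, t * F.m⟩ := rfl

lemma eval_add (F G : Cubic A) (v : Fin 3 → A) : (F + G).eval v = F.eval v + G.eval v := by
  simp only [add_def, eval]
  ring

lemma eval_smul (t : A) (F : Cubic A) (v : Fin 3 → A) : (t • F).eval v = t * F.eval v := by
  simp only [smul_def, eval]
  ring

end Cubic

/-! ### Discriminant and Hessian cubics -/

/-- The polarization of the determinant, normalized so that `polarDet X X X = 6 det X`. -/
def polarDet {A : Type*} [CommRing A] (X Y Z : Matrix (Fin 3) (Fin 3) A) : A :=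
  (X + Y + Z).det - (X + Y).det - (X + Z).det - (Y + Z).det + X.det + Y.det + Z.det

/-- The discriminant cubic `6 det (x G₀ + y G₁ + z G₂)`. -/
def discriminant {A : Type*} [CommRing A] (G : Fin 3 → Matrix (Fin 3) (Fin 3) A) : Cubic A :=
  .ofTensor fun i j k => polarDet (G i) (G j) (G k)

lemma eval_discriminant {A : Type*} [CommRing A] (G : Fin 3 → Matrix (Fin 3) (Fin 3) A)
    (v : Fin 3 → A) :
    (discriminant G).eval v = 6 * (v 0 • G 0 + v 1 • G 1 + v 2 • G 2).det := by
  simp only [Cubic.eval, discriminant, Cubic.ofTensor, polarDet, Matrix.det_fin_three,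
    Matrix.add_apply, Matrix.smul_apply, smul_eq_mul]
  ring

/-- Congruence by `B` multiplies every determinant in the family by `B.det ^ 2`, and recombining the
family is a substitution in its parameters. This one formula yields both the covariance of the
Hessian and that of the discriminant of a net. -/
lemma discriminant_change (G : Fin 3 → Matrix (Fin 3) (Fin 3) ℂ) (B h : Matrix (Fin 3) (Fin 3) ℂ) :
    discriminant (fun k => B.transpose * (h 0 k • G 0 + h 1 k • G 1 + h 2 k • G 2) * B) =
      B.det ^ 2 • (discriminant G).subst h := by
  refine Cubic.ext_eval fun v => ?_
  rw [Cubic.eval_smul, Cubic.eval_subst, eval_discriminant, eval_discriminant]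
  have key : ∀ X Y Z : Matrix (Fin 3) (Fin 3) ℂ,
      v 0 • (B.transpose * X * B) + v 1 • (B.transpose * Y * B) + v 2 • (B.transpose * Z * B) =
        B.transpose * (v 0 • X + v 1 • Y + v 2 • Z) * B := fun X Y Z => by
    simp [mul_add, add_mul]
  rw [key, Matrix.det_mul, Matrix.det_mul, Matrix.det_transpose]
  have hsum : v 0 • (h 0 0 • G 0 + h 1 0 • G 1 + h 2 0 • G 2) +
      v 1 • (h 0 1 • G 0 + h 1 1 • G 1 + h 2 1 • G 2) +
      v 2 • (h 0 2 • G 0 + h 1 2 • G 1 + h 2 2 • G 2) =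
      h.mulVec v 0 • G 0 + h.mulVec v 1 • G 1 + h.mulVec v 2 • G 2 := by
    simp only [Matrix.mulVec, dotProduct, Fin.sum_univ_three]
    module
  rw [hsum]
  ring

namespace Cubic

/-- The Hessian covariant. -/
def hessian {A : Type*} [CommRing A] (F : Cubic A) : Cubic A := discriminant F.slice

lemma slice_subst_aux (F : Cubic ℂ) (h : Matrix (Fin 3) (Fin 3) ℂ) (k : Fin 3) :
    (F.subst h).slice k =
      .of fun i j => F.polar (fun l => h l i) (fun l => h l j) (fun l => h l k) := by
  ext i j
  fin_cases k <;> fin_cases i <;> fin_cases j <;>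
    simp only [slice, subst, ofTensor, polar, Matrix.of_apply, Matrix.cons_val, Fin.isValue, Fin.zero_eta, Fin.mk_one, Fin.reduceFinMk] <;> ring

/-- By the chain rule the matrices of second derivatives are both recombined by `h` and transformed
by congruence with `h`, so `discriminant_change` applies with `B = h`. -/
lemma hessian_subst (F : Cubic ℂ) (h : Matrix (Fin 3) (Fin 3) ℂ) :
    (F.subst h).hessian = h.det ^ 2 • F.hessian.subst h := by
  rw [hessian, hessian, ← discriminant_change]
  have key (k : Fin 3) : (F.subst h).slice k =
      h.transpose * (h 0 k • F.slice 0 + h 1 k • F.slice 1 + h 2 k • F.slice 2) * h := by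
    rw [slice_subst_aux]
    simp only [slice, Matrix.cons_val]
    ext i j
    simp only [Matrix.mul_apply, Fin.sum_univ_three, Matrix.transpose_apply, Matrix.add_apply,
      Matrix.smul_apply, smul_eq_mul, Matrix.of_apply, Matrix.cons_val, polar]
    ring
  exact congrArg discriminant (funext key)

/-- A family of combinations of Aronhold's two invariants. -/
def aronholdHessian {A : Type*} [CommRing A] (t : A) (F : Cubic A) : A :=
  (F + t • F.hessian).aronhold

/-- The Hessian picks up two more determinants than the cubic itself, which only rescales `t`. Hence
vanishing for all `t` is stable under all invertible substitutions, and for determinant one each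
member of the family is an invariant. -/
lemma aronholdHessian_subst (t : ℂ) (F : Cubic ℂ) (h : Matrix (Fin 3) (Fin 3) ℂ)
    (hh : h.det ≠ 0) :
    (F.subst h).aronholdHessian t = h.det ^ 4 * F.aronholdHessian (t * h.det ^ 2) := by
  rw [aronholdHessian, aronholdHessian, ← aronhold_subst h hh, hessian_subst]
  congr 1
  refine ext_eval fun v => ?_
  simp only [eval_add, eval_smul, eval_subst]
  ring

end Cubic

/-! ### Cubics with vanishing invariants are nullforms -/

lemma exists_cubic_root {a : ℂ} (ha : a ≠ 0) (b c d : ℂ) :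
    ∃ x : ℂ, a * x ^ 3 + b * x ^ 2 + c * x + d = 0 := by
  obtain ⟨x, hx⟩ := IsAlgClosed.exists_root (_root_.Cubic.toPoly ⟨a, b, c, d⟩)
    (by rw [_root_.Cubic.degree_of_a_ne_zero ha]; decide)
  exact ⟨x, by simpa [_root_.Cubic.toPoly] using hx⟩

lemma exists_sq_eq (a : ℂ) : ∃ x : ℂ, x ^ 2 = a := IsAlgClosed.exists_pow_nat_eq a two_pos

namespace Cubic

/-- The cubic lies in the span of `x³, x²y, x²z, xy², y³`. -/
def IsNullform (F : Cubic ℂ) : Prop := F.c = 0 ∧ F.c₁ = 0 ∧ F.c₂ = 0 ∧ F.m = 0 ∧ F.b₃ = 0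

/-- Some linear substitution turns the cubic into a nullform. -/
def HasNullform (F : Cubic ℂ) : Prop :=
  ∃ h : Matrix (Fin 3) (Fin 3) ℂ, h.det ≠ 0 ∧ (F.subst h).IsNullform

/-- Aronhold's invariants vanish. -/
def InvariantsVanish (F : Cubic ℂ) : Prop := ∀ t, F.aronholdHessian t = 0

lemma InvariantsVanish.subst {F : Cubic ℂ} (hF : F.InvariantsVanish)
    (h : Matrix (Fin 3) (Fin 3) ℂ) (hh : h.det ≠ 0) : (F.subst h).InvariantsVanish := fun t => by
  rw [aronholdHessian_subst t F h hh, hF, mul_zero]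

lemma HasNullform.of_subst {F : Cubic ℂ} (g : Matrix (Fin 3) (Fin 3) ℂ) (hg : g.det ≠ 0)
    (h : (F.subst g).HasNullform) : F.HasNullform := by
  obtain ⟨k, hk, H⟩ := h
  exact ⟨g * k, by simp [hg, hk], by rwa [subst_mul]⟩

lemma IsNullform.hasNullform {F : Cubic ℂ} (h : F.IsNullform) : F.HasNullform := by
  refine ⟨1, by simp, ?_⟩
  have : F.subst 1 = F := ext_eval fun v => by simp [eval_subst]
  rwa [this]

lemma aronholdHessian_zero (F : Cubic ℂ) : F.aronholdHessian 0 = F.aronhold := by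
  simp [aronholdHessian, smul_def, add_def]

/-- The point [0:0:1] is singular with tangent cone a₃x² + 2mxy + b₃y². The hypothesis says that
this cone is a double line, and the substitution makes it x² up to a factor. -/
lemma hasNullform_of_singular (a b a₂ a₃ b₁ b₃ m : ℂ) (h : m ^ 2 = a₃ * b₃) :
    HasNullform ⟨a, b, 0, a₂, a₃, b₁, b₃, 0, 0, m⟩ := by
  by_cases hb : b₃ = 0
  · subst hb
    have hm : m = 0 := by simpa using h
    exact IsNullform.hasNullform ⟨rfl, rfl, rfl, hm, rfl⟩
  · refine ⟨!![0, 1, 0; 1, -(m / b₃), 0; 0, 0, 1], by simp [Matrix.det_fin_three], ?_⟩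
    refine ⟨?_, ?_, ?_, ?_, ?_⟩ <;> simp [subst, ofTensor, polar] <;> field_simp <;> grind

/-- This is a Weierstrass form, 3xz² plus a binary cubic in x and y. If `b ≠ 0`, vanishing of the
invariants makes the binary cubic the perfect cube b(y + b₁x/b)³, so the curve is cuspidal. If `b =
0`, then `b₁ = 0` and x splits off; exchanging y and z suffices. -/
lemma hasNullform_of_flex (a b a₂ b₁ : ℂ)
    (h : InvariantsVanish ⟨a, b, 0, a₂, 0, b₁, 0, 1, 0, 0⟩) :
    HasNullform ⟨a, b, 0, a₂, 0, b₁, 0, 1, 0, 0⟩ := by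
  have h0 := h 0
  rw [aronholdHessian_zero] at h0
  simp [aronhold] at h0
  by_cases hb : b = 0
  · subst hb
    have hb₁ : b₁ = 0 := by simpa using h0
    subst hb₁
    refine ⟨!![1, 0, 0; 0, 0, 1; 0, 1, 0], by simp [Matrix.det_fin_three], ?_⟩
    refine ⟨?_, ?_, ?_, ?_, ?_⟩ <;> simp [Cubic.subst, ofTensor, polar]
  · have ha₂ : a₂ = b₁ ^ 2 / b := by field_simp; grind
    subst ha₂
    have ha : a = b₁ ^ 3 / b ^ 2 := by
      -- The value at `t = 0` only determined `a₂`; the values at `t = ±1` bring in the sextic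
      -- invariant, which determines `a`.
      have h1 := h 1
      have h2 := h (-1)
      simp [aronholdHessian, hessian, aronhold, discriminant, slice, ofTensor, polarDet,
        Matrix.det_fin_three, add_def, smul_def] at h1 h2
      field_simp at h1 h2 ⊢
      grind
    subst ha
    refine ⟨!![0, 0, 1; 0, 1, -b₁ / b; 1, 0, 0], by simp [Matrix.det_fin_three], ?_⟩
    refine ⟨?_, ?_, ?_, ?_, ?_⟩ <;> simp [Cubic.subst, ofTensor, polar] <;> field_simp <;> ring

/-- Here the tangent x = 0 at [0:0:1] meets the curve again at [0:1:0]. The two invariants leave a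
family parametrized by `u`, with a cusp at (1, u, -b₃u²/2); the substitution moves the cusp to
[0:0:1]. -/
lemma hasNullform_of_not_flex (a a₂ b₁ b₃ : ℂ) (hb : b₃ ≠ 0)
    (h : InvariantsVanish ⟨a, 0, 0, a₂, 0, b₁, b₃, 1, 0, 0⟩) :
    HasNullform ⟨a, 0, 0, a₂, 0, b₁, b₃, 1, 0, 0⟩ := by
  have h0 := h 0
  rw [aronholdHessian_zero] at h0
  simp [aronhold] at h0
  obtain ⟨B, rfl⟩ : ∃ B, b₁ = B * b₃ := ⟨b₁ / b₃, by field_simp⟩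
  have ha : a = B ^ 2 := mul_right_cancel₀ (pow_ne_zero 2 hb) (by linear_combination h0)
  subst ha
  have h1 := h 1
  have h2 := h (-1)
  simp [aronholdHessian, hessian, aronhold, discriminant, slice, ofTensor, polarDet,
    Matrix.det_fin_three, add_def, smul_def] at h1 h2
  have hT : 32 * B ^ 3 * b₃ = 27 * a₂ ^ 2 :=
    mul_right_cancel₀ (pow_ne_zero 2 hb) (by linear_combination (h1 - h2) / 2)
  -- The relation `hT` is itself a cuspidal curve in `(B, a₂)`, and `u` is its rational parameter.
  obtain ⟨u, rfl, rfl⟩ : ∃ u, B = 3 / 2 * b₃ * u ^ 2 ∧ a₂ = -2 * b₃ ^ 2 * u ^ 3 := by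
    by_cases hB : B = 0
    · subst hB
      exact ⟨0, by simp, by simpa using hT.symm⟩
    · refine ⟨-(3 * a₂ / (4 * B * b₃)), ?_, ?_⟩ <;> field_simp <;> grind
  refine ⟨!![0, 0, 1; 0, 1, u; 1, -(b₃ * u), -(b₃ * u ^ 2 / 2)],
    by simp [Matrix.det_fin_three], ?_⟩
  refine ⟨?_, ?_, ?_, ?_, ?_⟩ <;> simp [Cubic.subst, ofTensor, polar] <;> ring

/-- On the tangent x = 0 the cubic is y²(by + 3b₃z). If `b₃ = 0` the point is a flex or the tangent
is a component; otherwise a shift of z by a multiple of y removes y³. The shift of y by x and the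
remaining entry of the matrix keep xyz and x²z absent. -/
lemma hasNullform_of_tangent (a b a₂ b₁ b₃ : ℂ)
    (h : InvariantsVanish ⟨a, b, 0, a₂, 0, b₁, b₃, 1, 0, 0⟩) :
    HasNullform ⟨a, b, 0, a₂, 0, b₁, b₃, 1, 0, 0⟩ := by
  by_cases hb : b₃ = 0
  · subst hb
    exact hasNullform_of_flex _ _ _ _ h
  · have hg : (!![1, 0, 0; b / (3 * b₃ ^ 2), 1, 0;
        -(b₃ * (b / (3 * b₃ ^ 2)) ^ 2 / 2), -(b₃ * (b / (3 * b₃ ^ 2))), 1] :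
          Matrix (Fin 3) (Fin 3) ℂ).det ≠ 0 := by simp [Matrix.det_fin_three]
    refine HasNullform.of_subst _ hg ?_
    have h' := h.subst _ hg
    obtain ⟨a', a₂', b₁', H⟩ : ∃ a' a₂' b₁', (Cubic.mk a b 0 a₂ 0 b₁ b₃ 1 0 0).subst
        !![1, 0, 0; b / (3 * b₃ ^ 2), 1, 0;
        -(b₃ * (b / (3 * b₃ ^ 2)) ^ 2 / 2), -(b₃ * (b / (3 * b₃ ^ 2))), 1] =
          ⟨a', 0, 0, a₂', 0, b₁', b₃, 1, 0, 0⟩ := by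
      refine ⟨_, _, _, Cubic.ext rfl ?_ ?_ rfl ?_ rfl ?_ ?_ ?_ ?_⟩ <;>
        simp [Cubic.subst, ofTensor, polar] <;> field_simp <;> ring
    rw [H] at h' ⊢
    exact hasNullform_of_not_flex _ _ _ _ hb h'

/-- The gradient at the point [0:0:1] of the curve is given by `c₁`, `c₂`. If it vanishes, S equals
-(m² - a₃b₃)², so the tangent cone is a double line. Otherwise the tangent is moved to x = 0, and
`monic` completes the square in z. -/
lemma hasNullform_of_point (a b a₂ a₃ b₁ b₃ c₁ c₂ m : ℂ)
    (h : InvariantsVanish ⟨a, b, 0, a₂, a₃, b₁, b₃, c₁, c₂, m⟩) :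
    HasNullform ⟨a, b, 0, a₂, a₃, b₁, b₃, c₁, c₂, m⟩ := by
  have monic (a b a₂ a₃ b₁ b₃ m : ℂ)
      (h : InvariantsVanish ⟨a, b, 0, a₂, a₃, b₁, b₃, 1, 0, m⟩) :
      HasNullform ⟨a, b, 0, a₂, a₃, b₁, b₃, 1, 0, m⟩ := by
    have hg : (!![1, 0, 0; 0, 1, 0; -a₃ / 2, -m, 1] : Matrix (Fin 3) (Fin 3) ℂ).det ≠ 0 := by
      simp [Matrix.det_fin_three]
    refine HasNullform.of_subst _ hg ?_
    have h' := h.subst _ hg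
    obtain ⟨a', b', a₂', b₁', H⟩ : ∃ a' b' a₂' b₁', (Cubic.mk a b 0 a₂ a₃ b₁ b₃ 1 0 m).subst
        !![1, 0, 0; 0, 1, 0; -a₃ / 2, -m, 1] = ⟨a', b', 0, a₂', 0, b₁', b₃, 1, 0, 0⟩ := by
      refine ⟨_, _, _, _, Cubic.ext rfl rfl ?_ rfl ?_ rfl ?_ ?_ ?_ ?_⟩ <;>
        simp [Cubic.subst, ofTensor, polar] <;> ring
    rw [H] at h' ⊢
    exact hasNullform_of_tangent _ _ _ _ _ h'
  by_cases hc₂ : c₂ = 0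
  · subst hc₂
    by_cases hc₁ : c₁ = 0
    · subst hc₁
      refine hasNullform_of_singular _ _ _ _ _ _ _ ?_
      have h0 := h 0
      rw [aronholdHessian_zero] at h0
      simp [aronhold] at h0
      have : (m ^ 2 - a₃ * b₃) ^ 2 = 0 := by linear_combination -h0
      exact sub_eq_zero.1 (by simpa using this)
    · have hg : (!![c₁⁻¹, 0, 0; 0, 1, 0; 0, 0, 1] : Matrix (Fin 3) (Fin 3) ℂ).det ≠ 0 := by
        simp [Matrix.det_fin_three, hc₁]
      refine HasNullform.of_subst _ hg ?_
      have h' := h.subst _ hg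
      obtain ⟨a', b', a₂', a₃', b₁', b₃', m', H⟩ : ∃ a' b' a₂' a₃' b₁' b₃' m',
          (Cubic.mk a b 0 a₂ a₃ b₁ b₃ c₁ 0 m).subst !![c₁⁻¹, 0, 0; 0, 1, 0; 0, 0, 1] =
            ⟨a', b', 0, a₂', a₃', b₁', b₃', 1, 0, m'⟩ := by
        refine ⟨_, _, _, _, _, _, _, Cubic.ext rfl rfl ?_ rfl rfl rfl rfl ?_ ?_ rfl⟩ <;>
          simp [Cubic.subst, ofTensor, polar, hc₁]
      rw [H] at h' ⊢
      exact monic _ _ _ _ _ _ _ h'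
  · have hg : (!![0, 1, 0; c₂⁻¹, -c₁ / c₂, 0; 0, 0, 1] : Matrix (Fin 3) (Fin 3) ℂ).det ≠ 0 := by
      simp [Matrix.det_fin_three, hc₂]
    refine HasNullform.of_subst _ hg ?_
    have h' := h.subst _ hg
    obtain ⟨a', b', a₂', a₃', b₁', b₃', m', H⟩ : ∃ a' b' a₂' a₃' b₁' b₃' m',
        (Cubic.mk a b 0 a₂ a₃ b₁ b₃ c₁ c₂ m).subst !![0, 1, 0; c₂⁻¹, -c₁ / c₂, 0; 0, 0, 1] =
          ⟨a', b', 0, a₂', a₃', b₁', b₃', 1, 0, m'⟩ := by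
      refine ⟨_, _, _, _, _, _, _, Cubic.ext rfl rfl ?_ rfl rfl rfl rfl ?_ ?_ rfl⟩ <;>
        simp [Cubic.subst, ofTensor, polar, hc₂] <;> field_simp <;> ring
    rw [H] at h' ⊢
    exact monic _ _ _ _ _ _ _ h'

/-- A cubic on which Aronhold's invariants vanish is unstable. -/
theorem InvariantsVanish.hasNullform {F : Cubic ℂ} (h : F.InvariantsVanish) : F.HasNullform := by
  obtain ⟨a, b, c, a₂, a₃, b₁, b₃, c₁, c₂, m⟩ := F
  by_cases hc : c = 0
  · subst hc
    exact hasNullform_of_point _ _ _ _ _ _ _ _ _ h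
  -- The point (1, 0, w) is an intersection of the curve with the line y = 0; it is moved to
  -- [0:0:1].
  · obtain ⟨w, hw⟩ := exists_cubic_root hc (3 * c₁) (3 * a₃) a
    have hg : (!![0, 0, 1; 0, 1, 0; 1, 0, w] : Matrix (Fin 3) (Fin 3) ℂ).det ≠ 0 := by
      simp [Matrix.det_fin_three]
    refine HasNullform.of_subst _ hg ?_
    have h' := h.subst _ hg
    obtain ⟨a', b', a₂', a₃', b₁', b₃', c₁', c₂', m', H⟩ : ∃ a' b' a₂' a₃' b₁' b₃' c₁' c₂' m',
        (Cubic.mk a b c a₂ a₃ b₁ b₃ c₁ c₂ m).subst !![0, 0, 1; 0, 1, 0; 1, 0, w] =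
          ⟨a', b', 0, a₂', a₃', b₁', b₃', c₁', c₂', m'⟩ := by
      refine ⟨_, _, _, _, _, _, _, _, _, Cubic.ext rfl rfl ?_ rfl rfl rfl rfl rfl rfl rfl⟩
      simp [Cubic.subst, ofTensor, polar]
      linear_combination hw
    rw [H] at h' ⊢
    exact hasNullform_of_point _ _ _ _ _ _ _ _ _ h'

end Cubic

/-! ### Normal forms of conics -/

/-- Binary quadratic forms are equivalent to `yz`, `y²` or `0`. -/
lemma exists_binary_normal_form (b c f : ℂ) : ∃ p q r s : ℂ, p * s - q * r ≠ 0 ∧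
    ((∀ y z, b * (p * y + q * z) ^ 2 + c * (r * y + s * z) ^ 2 +
        f * ((p * y + q * z) * (r * y + s * z)) = y * z) ∨
      (∀ y z, b * (p * y + q * z) ^ 2 + c * (r * y + s * z) ^ 2 +
        f * ((p * y + q * z) * (r * y + s * z)) = y * y) ∨
      ∀ y z, b * (p * y + q * z) ^ 2 + c * (r * y + s * z) ^ 2 +
        f * ((p * y + q * z) * (r * y + s * z)) = 0) := by
  by_cases hb : b = 0
  · subst hb
    by_cases hf : f = 0
    · subst hf
      by_cases hc : c = 0
      · exact ⟨1, 0, 0, 1, by simp, .inr <| .inr fun y z => by simp [hc]⟩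
      · obtain ⟨t, ht⟩ := exists_sq_eq c
        have ht0 : t ≠ 0 := by rintro rfl; simp at ht; exact hc ht.symm
        exact ⟨0, 1, t⁻¹, 0, by simpa, .inr <| .inl fun y z => by subst ht; field_simp; ring⟩
    · exact ⟨1 / f, -c / f, 0, 1, by simpa, .inl fun y z => by field_simp; ring⟩
  -- The square root of the discriminant: the form is a square if it is zero, and a product of two
  -- independent linear factors otherwise.
  · obtain ⟨t, ht⟩ := exists_sq_eq (f ^ 2 - 4 * b * c)
    by_cases ht0 : t = 0
    · obtain ⟨k, hk⟩ := exists_sq_eq b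
      have hk0 : k ≠ 0 := by rintro rfl; simp at hk; exact hb hk.symm
      have hc : c = f ^ 2 / (4 * b) := by field_simp; rw [ht0] at ht; linear_combination ht
      refine ⟨1 / k, -f / (2 * b), 0, 1, by simpa, .inr <| .inl fun y z => ?_⟩
      subst hk hc
      field_simp
      ring
    · have hc : c = (f ^ 2 - t ^ 2) / (4 * b) := by field_simp; linear_combination ht
      refine ⟨(t - f) / (2 * t), (t + f) / (2 * b * t), b / t, -1 / t, ?_, .inl fun y z => ?_⟩
      · have : (t - f) / (2 * t) * (-1 / t) - (t + f) / (2 * b * t) * (b / t) = -1 / t := by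
          field_simp; ring
        rw [this]
        simpa using ht0
      · subst hc
        field_simp
        ring

/-- Linear substitution in a quadratic form. -/
def substForm (g : Matrix (Fin 3) (Fin 3) ℂ) (q : QuadraticForm ℂ C3) : QuadraticForm ℂ C3 :=
  q.comp (Matrix.toLin' g)

@[simp] lemma substForm_apply (g : Matrix (Fin 3) (Fin 3) ℂ) (q : QuadraticForm ℂ C3) (u : C3) :
    substForm g q u = q (g.mulVec u) := by simp [substForm]

lemma net_substForm (q₁ q₂ q₃ : QuadraticForm ℂ C3) (g : Matrix (Fin 3) (Fin 3) ℂ)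
    (hg : g.det ≠ 0) :
    Equivalent (net q₁ q₂ q₃) (net (substForm g q₁) (substForm g q₂) (substForm g q₃)) :=
  ⟨g, 1, hg, by simp, fun u => by simp [net_apply]⟩

/-- The symmetric matrix of the polar form. -/
def gramForm (q : QuadraticForm ℂ C3) : Matrix (Fin 3) (Fin 3) ℂ :=
  .of fun i j => QuadraticMap.polar q (Pi.single i 1) (Pi.single j 1)

lemma gramForm_conic (a b c d e f : ℂ) :
    gramForm (conic a b c d e f) = !![2 * a, d, e; d, 2 * b, f; e, f, 2 * c] := by
  ext i j
  fin_cases i <;> fin_cases j <;> simp [gramForm, QuadraticMap.polar] <;> ring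

lemma gramForm_substForm (g : Matrix (Fin 3) (Fin 3) ℂ) (q : QuadraticForm ℂ C3) :
    gramForm (substForm g q) = g.transpose * gramForm q * g := by
  obtain ⟨a, b, c, d, e, f, rfl⟩ := exists_conic q
  rw [gramForm_conic]
  ext i j
  simp only [gramForm, QuadraticMap.polar, substForm_apply, conic_apply, Matrix.mulVec_add,
    Matrix.mulVec_single_one, Matrix.col_apply, Pi.add_apply, Matrix.mul_apply,
    Fin.sum_univ_three, Matrix.transpose_apply, Matrix.of_apply, Matrix.cons_val]
  ring

/-- The normal forms of a single conic. -/
def HasConicNormalForm (q : QuadraticForm ℂ C3) : Prop :=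
  ∃ g : Matrix (Fin 3) (Fin 3) ℂ, g.det ≠ 0 ∧
    (substForm g q = 0 ∨ substForm g q = xx ∨ substForm g q = xy ∨ substForm g q = xy - zz)

lemma HasConicNormalForm.of_subst {q : QuadraticForm ℂ C3} (g : Matrix (Fin 3) (Fin 3) ℂ)
    (hg : g.det ≠ 0) (h : HasConicNormalForm (substForm g q)) : HasConicNormalForm q := by
  obtain ⟨k, hk, H⟩ := h
  have hcomp (k) : substForm k (substForm g q) = substForm (g * k) q :=
    QuadraticMap.ext fun u => by simp
  rw [hcomp] at H
  exact ⟨g * k, by simp [hg, hk], H⟩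

/-- The conic passes through [0:0:1] with tangent ex + fy = 0, and `k ^ 2` is its value at any (1,
-e/f, z) on this tangent. If `k = 0` the tangent is a component and the conic is a pair of lines;
otherwise the conic is smooth. If `e = f = 0` the form is binary. -/
lemma hasConicNormalForm_of_isotropic (a b d e f : ℂ) :
    HasConicNormalForm (conic a b 0 d e f) := by
  have main (a b d e f : ℂ) (hf : f ≠ 0) : HasConicNormalForm (conic a b 0 d e f) := by
    obtain ⟨k, hk⟩ := exists_sq_eq (a + b * e ^ 2 / f ^ 2 - d * e / f)
    by_cases hk0 : k = 0
    · refine ⟨!![0, 0, 1; 0, 1 / f, -e / f; 1, -b / f ^ 2, 2 * b * e / f ^ 2 - d / f],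
        by simpa [Matrix.det_fin_three], .inr <| .inr <| .inl <| QuadraticMap.ext fun u => ?_⟩
      have ha : a = -(b * e ^ 2 / f ^ 2 - d * e / f) := by
        rw [hk0] at hk; linear_combination -hk
      subst ha
      simp [dotProduct, Fin.sum_univ_three]
      field_simp
      ring
    · refine ⟨!![0, 0, Complex.I / k; 0, 1 / f, -e / f * (Complex.I / k);
        1, -b / f ^ 2, (2 * b * e / f ^ 2 - d / f) * (Complex.I / k)],
        by simp [Matrix.det_fin_three, hf, hk0],
        .inr <| .inr <| .inr <| QuadraticMap.ext fun u => ?_⟩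
      have ha : a = k ^ 2 - (b * e ^ 2 / f ^ 2 - d * e / f) := by linear_combination -hk
      subst ha
      simp [dotProduct, Fin.sum_univ_three]
      field_simp
      linear_combination (u 2 ^ 2 * k ^ 2 * f ^ 2) * Complex.I_sq
  by_cases hf : f = 0
  · by_cases he : e = 0
    · subst he hf
      obtain ⟨p, q, r, s, h, H⟩ := exists_binary_normal_form a b d
      refine ⟨!![p, q, 0; r, s, 0; 0, 0, 1], by simpa [Matrix.det_fin_three], ?_⟩
      have key (u : C3) : substForm !![p, q, 0; r, s, 0; 0, 0, 1] (conic a b 0 d 0 0) u =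
          a * (p * u 0 + q * u 1) ^ 2 + b * (r * u 0 + s * u 1) ^ 2 +
            d * ((p * u 0 + q * u 1) * (r * u 0 + s * u 1)) := by
        simp [dotProduct, Fin.sum_univ_three]
        ring
      rcases H with H | H | H
      · exact .inr <| .inr <| .inl <| QuadraticMap.ext fun u => by rw [key, H]; simp
      · exact .inr <| .inl <| QuadraticMap.ext fun u => by rw [key, H]; simp
      · exact .inl <| QuadraticMap.ext fun u => by rw [key, H]; simp
    · refine .of_subst !![0, 1, 0; 1, 0, 0; 0, 0, 1] (by simp [Matrix.det_fin_three]) ?_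
      convert main b a d f e he using 1
      ext u
      simp [dotProduct, Fin.sum_univ_three]
      ring
  · exact main a b d e f hf

lemma hasConicNormalForm (q : QuadraticForm ℂ C3) : HasConicNormalForm q := by
  obtain ⟨a, b, c, d, e, f, rfl⟩ := exists_conic q
  by_cases hc : c = 0
  · subst hc
    exact hasConicNormalForm_of_isotropic a b d e f
  -- An intersection of the conic with the line y = 0 is moved to [0:0:1].
  · obtain ⟨t, ht⟩ := exists_sq_eq (e ^ 2 - 4 * a * c)
    refine .of_subst !![0, 0, 1; 0, 1, 0; 1, 0, (t - e) / (2 * c)]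
      (by simp [Matrix.det_fin_three]) ?_
    convert hasConicNormalForm_of_isotropic c b f t (d + f * (t - e) / (2 * c)) using 1
    ext u
    have ha : a = (e ^ 2 - t ^ 2) / (4 * c) := by field_simp; linear_combination ht
    subst ha
    simp [dotProduct, Fin.sum_univ_three]
    field_simp
    ring

lemma exists_singular_normal_form (q : QuadraticForm ℂ C3) (hq : (gramForm q).det = 0) :
    ∃ g : Matrix (Fin 3) (Fin 3) ℂ, g.det ≠ 0 ∧
      (substForm g q = 0 ∨ substForm g q = xx ∨ substForm g q = xy) := by
  obtain ⟨g, hg, h | h | h | h⟩ := hasConicNormalForm q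
  · exact ⟨g, hg, .inl h⟩
  · exact ⟨g, hg, .inr (.inl h)⟩
  · exact ⟨g, hg, .inr (.inr h)⟩
  · exfalso
    have h1 := gramForm_substForm g q
    have h2 : substForm g q = conic 0 0 (-1) 1 0 0 := by
      rw [h]
      ext u
      simp
      ring
    have h3 := congrArg Matrix.det h1
    rw [h2, gramForm_conic, Matrix.det_mul, Matrix.det_mul, hq] at h3
    simp [Matrix.det_fin_three] at h3

lemma InTable.of_forall {M : Noc} (o : OrbitName) (g h : Matrix (Fin 3) (Fin 3) ℂ)
    (hg : g.det ≠ 0) (hh : h.det ≠ 0)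
    (H : ∀ x y z, (table o).representative ![x, y, z] =
      h.mulVec (M (g.mulVec ![x, y, z]))) : InTable M :=
  .of_representative o (.of_forall g h hg hh H)

lemma net_row_operations (h : Matrix (Fin 3) (Fin 3) ℂ) (hh : h.det ≠ 0)
    (q₁ q₂ q₃ : QuadraticForm ℂ C3) :
    Equivalent (net q₁ q₂ q₃) (net (h 0 0 • q₁ + h 0 1 • q₂ + h 0 2 • q₃)
      (h 1 0 • q₁ + h 1 1 • q₂ + h 1 2 • q₃) (h 2 0 • q₁ + h 2 1 • q₂ + h 2 2 • q₃)) := by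
  refine ⟨1, h, by simp, hh, fun u => ?_⟩
  ext k
  fin_cases k <;> simp [net_apply, Matrix.mulVec, dotProduct, Fin.sum_univ_three]

/-! ### Pencils of conics -/

lemma inTable_conic (q : QuadraticForm ℂ C3) : InTable (net q 0 0) := by
  obtain ⟨g, hg, H⟩ := hasConicNormalForm q
  have h0 : substForm g 0 = 0 := QuadraticMap.ext fun u => by simp
  have he := net_substForm q 0 0 g hg
  rw [h0] at he
  rcases H with H | H | H | H <;> rw [H] at he
  · exact .of_representative .zero he
  · exact .of_representative .DL he
  · exact .of_representative .PL he
  · exact .of_representative .S he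

lemma exists_ne_zero_sq_eq {a : ℂ} (ha : a ≠ 0) : ∃ x : ℂ, x ≠ 0 ∧ x ^ 2 = a := by
  obtain ⟨x, rfl⟩ := exists_sq_eq a
  exact ⟨x, by rintro rfl; simp at ha, rfl⟩

/-- A substitution fixing `x` puts the restriction of a form to the line `x = 0` into normal
form. -/
lemma exists_restriction_normal_form (a b c d e f : ℂ) : ∃ p q r s : ℂ, p * s - q * r ≠ 0 ∧
    ∃ d' e', substForm !![1, 0, 0; 0, p, q; 0, r, s] (conic a b c d e f) = conic a 0 0 d' e' 1 ∨
      substForm !![1, 0, 0; 0, p, q; 0, r, s] (conic a b c d e f) = conic a 1 0 d' e' 0 ∨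
      substForm !![1, 0, 0; 0, p, q; 0, r, s] (conic a b c d e f) = conic a 0 0 d' e' 0 := by
  obtain ⟨p, q, r, s, h, H⟩ := exists_binary_normal_form b c f
  refine ⟨p, q, r, s, h, d * p + e * r, d * q + e * s, ?_⟩
  rcases H with H | H | H
  · refine .inl (QuadraticMap.ext fun u => ?_)
    have := H (u 1) (u 2)
    simp [dotProduct, Fin.sum_univ_three]
    linear_combination this
  · refine .inr (.inl (QuadraticMap.ext fun u => ?_))
    have := H (u 1) (u 2)
    simp [dotProduct, Fin.sum_univ_three]
    linear_combination this
  · refine .inr (.inr (QuadraticMap.ext fun u => ?_))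
    have := H (u 1) (u 2)
    simp [dotProduct, Fin.sum_univ_three]
    linear_combination this

lemma substForm_xx (p q r s : ℂ) : substForm !![1, 0, 0; 0, p, q; 0, r, s] xx = xx :=
  QuadraticMap.ext fun u => by simp [Matrix.vecHead]

lemma substForm_zero (g : Matrix (Fin 3) (Fin 3) ℂ) : substForm g 0 = 0 :=
  QuadraticMap.ext fun u => by simp

/-- The base points lie on the double line x² and are the zeros of `q` on x = 0. Two distinct zeros
give (22), a double zero gives (4) or `K`, and a vanishing restriction means a common component,
hence `M` or `DL`. -/
lemma inTable_pencil_xx (q : QuadraticForm ℂ C3) : InTable (net q xx 0) := by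
  obtain ⟨a, b, c, d, e, f, rfl⟩ := exists_conic q
  obtain ⟨p, q, r, s, hd, d', e', H⟩ := exists_restriction_normal_form a b c d e f
  refine InTable.of_equivalent ?_
    (net_substForm _ _ _ !![1, 0, 0; 0, p, q; 0, r, s] (by simpa [Matrix.det_fin_three] using hd))
  rw [substForm_xx, substForm_zero]
  generalize d' = d, e' = e at H
  rcases H with H | H | H <;> rw [H]
  · refine .of_forall .pencil22 !![1, 0, 0; -e, 1, 0; -d, 0, 1]
      !![0, 1, 0; 1, d * e - a, 0; 0, 0, 1]
      (by simp [Matrix.det_fin_three])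
      (by simp [Matrix.det_fin_three])
      fun x y z => ?_
    ext k
    fin_cases k <;> simp [table, net_apply] <;> ring
  · by_cases he : e = 0
    · subst he
      refine .of_forall .K !![0, 0, 1; 0, 1, -d / 2; 1, 0, 0]
        !![1, d ^ 2 / 4 - a, 0; 0, 1, 0; 0, 0, 1]
        (by simp [Matrix.det_fin_three])
        (by simp [Matrix.det_fin_three])
        fun x y z => ?_
      ext k
      fin_cases k <;> simp [table, net_apply] <;> ring
    · refine .of_forall .pencil4 !![1, 0, 0; 0, 1, 0; 0, -d / e, 1 / e]
        !![1, -a, 0; 0, 1, 0; 0, 0, 1]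
        (by simp [Matrix.det_fin_three, he])
        (by simp [Matrix.det_fin_three])
        fun x y z => ?_
      ext k
      fin_cases k <;> simp [table, net_apply] <;> field_simp <;> ring
  · by_cases he : e = 0
    · subst he
      by_cases hd : d = 0
      · subst hd
        refine .of_forall .DL 1
          !![0, 1, 0; 1, -a, 0; 0, 0, 1]
          (by simp)
          (by simp [Matrix.det_fin_three])
          fun x y z => ?_
        ext k
        fin_cases k <;> simp [table, net_apply] <;> ring
      · refine .of_forall .M !![0, 1, 0; 0, 0, 1 / d; 1, 0, 0]
          !![1, -a, 0; 0, 1, 0; 0, 0, 1]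
          (by simp [Matrix.det_fin_three, hd])
          (by simp [Matrix.det_fin_three])
          fun x y z => ?_
        ext k
        fin_cases k <;> simp [table, net_apply] <;> field_simp <;> ring
    · refine .of_forall .M !![0, 1, 0; 1, 0, 0; -d / e, 0, 1 / e]
        !![1, -a, 0; 0, 1, 0; 0, 0, 1]
        (by simp [Matrix.det_fin_three, he])
        (by simp [Matrix.det_fin_three])
        fun x y z => ?_
      ext k
      fin_cases k <;> simp [table, net_apply] <;> field_simp <;> ring

lemma conic_swap (a b c d e f : ℂ) :
    substForm !![0, 1, 0; 1, 0, 0; 0, 0, 1] (conic a b c d e f) = conic b a c d f e := by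
  ext u
  simp [Matrix.vecHead, Matrix.vecTail]
  ring

lemma xy_swap : substForm !![0, 1, 0; 1, 0, 0; 0, 0, 1] xy = xy := by
  ext u
  simp [Matrix.vecHead, Matrix.vecTail]
  ring

lemma inTable_pencil_xy_swap {a b c d e f : ℂ} (h : InTable (net (conic b a c d f e) xy 0)) :
    InTable (net (conic a b c d e f) xy 0) := by
  have := net_substForm (conic a b c d e f) xy 0 !![0, 1, 0; 1, 0, 0; 0, 0, 1]
    (by simp [Matrix.det_fin_three])
  rw [conic_swap, xy_swap, substForm_zero] at this
  exact h.of_equivalent this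

/-- The coefficient `d` is irrelevant modulo xy. Since `c ≠ 0`, the first conic meets x = 0 in two
points or in a double point according to whether `b` is nonzero, and likewise y = 0 according to
`a`. This gives (1⁴), (21²) or (22). -/
lemma inTable_pencil_xy_sum_squares (a b c d : ℂ) (hc : c ≠ 0) :
    InTable (net (conic a b c d 0 0) xy 0) := by
  have one_square (a d : ℂ) (ha : a ≠ 0) : InTable (net (conic a 0 c d 0 0) xy 0) := by
    obtain ⟨p, hp, rfl⟩ := exists_ne_zero_sq_eq ha
    obtain ⟨k, hk, rfl⟩ := exists_ne_zero_sq_eq hc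
    have hI := Complex.I_sq
    refine .of_forall .pencil211 !![1 / (2 * p), 1 / (2 * p), 0; 0, 0, 1; -Complex.I / (2 * k), Complex.I / (2 * k), 0]
      !![1, -d, 0; 0, 2 * p, 0; 0, 0, 1]
      (Eq.trans_ne (b := -Complex.I / (2 * p * k)) (by simp [Matrix.det_fin_three] <;> field_simp <;> ring)
        (by simp [hp, hk]))
      (by simp [Matrix.det_fin_three, hp])
      fun x y z => ?_
    ext k
    fin_cases k <;> simp [table, net_apply] <;> field_simp <;> grind
  by_cases ha : a = 0
  · by_cases hb : b = 0
    · subst ha hb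
      obtain ⟨k, hk, rfl⟩ := exists_ne_zero_sq_eq hc
      refine .of_forall .pencil22 !![0, 1, 0; 0, 0, 1; 1 / k, 0, 0]
        !![1, -d, 0; 0, 1, 0; 0, 0, 1]
        (by simp [Matrix.det_fin_three, hk])
        (by simp [Matrix.det_fin_three])
        fun x y z => ?_
      ext k
      fin_cases k <;> simp [table, net_apply] <;> field_simp <;> ring
    · subst ha
      exact inTable_pencil_xy_swap (one_square b d hb)
  · by_cases hb : b = 0
    · subst hb
      exact one_square a d ha
    · obtain ⟨p, hp, rfl⟩ := exists_ne_zero_sq_eq ha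
      obtain ⟨r, hr, rfl⟩ := exists_ne_zero_sq_eq hb
      obtain ⟨k, hk, rfl⟩ := exists_ne_zero_sq_eq hc
      have hI := Complex.I_sq
      refine .of_forall .pencil1111 !![1 / p, -1 / p, 0; 1 / r, 1 / r, -1 / r; 0, 0, Complex.I / k]
        !![1 / 4, (2 * p * r - d) / 4, 0; 1 / 4, -(2 * p * r + d) / 4, 0; 0, 0, 1]
        (Eq.trans_ne (b := 2 * Complex.I / (p * r * k)) (by simp [Matrix.det_fin_three] <;> field_simp <;> ring)
          (by simp [hp, hr, hk]))
        (Eq.trans_ne (b := -(p * r) / 4) (by simp [Matrix.det_fin_three] <;> field_simp <;> ring)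
          (by simp [hp, hr]))
        fun x y z => ?_
      ext k
      fin_cases k <;> simp [table, net_apply] <;> field_simp <;> grind

/-- The vertex [0:0:1] of the line pair lies on the other conic exactly when `c = 0`. If not,
completing the square in z removes `e` and `f`. If it does, `e` and `f` give the tangent there:
transversal to both lines is (21²), tangent to one is (31), or `L` when that line is a component,
and a conic singular there is a binary form in x and y. -/
lemma inTable_pencil_xy (q : QuadraticForm ℂ C3) : InTable (net q xy 0) := by
  obtain ⟨a, b, c, d, e, f, rfl⟩ := exists_conic q
  by_cases hc : c = 0
  · subst hc
    have tangent (a b d e : ℂ) (he : e ≠ 0) : InTable (net (conic a b 0 d e 0) xy 0) := by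
      by_cases hb : b = 0
      · subst hb
        refine .of_forall .L !![1, 0, 0; 0, 1, 0; -a / e, 0, 1 / e]
          !![0, 1, 0; 1, -d, 0; 0, 0, 1]
          (by simp [Matrix.det_fin_three, he])
          (by simp [Matrix.det_fin_three])
          fun x y z => ?_
        ext k
        fin_cases k <;> simp [table, net_apply] <;> field_simp <;> ring
      · obtain ⟨k, hk, rfl⟩ := exists_ne_zero_sq_eq hb
        refine .of_forall .pencil31 !![0, 0, 1; 1 / k, 0, 0; 0, -1 / e, -a / e]
          !![0, k, 0; 1, -d, 0; 0, 0, 1]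
          (by simp [Matrix.det_fin_three, hk, he])
          (by simp [Matrix.det_fin_three, hk])
          fun x y z => ?_
        ext k
        fin_cases k <;> simp [table, net_apply] <;> field_simp <;> ring
    have square (a d : ℂ) (ha : a ≠ 0) : InTable (net (conic a 0 0 d 0 0) xy 0) := by
      refine .of_forall .M !![0, 1, 0; 0, 0, 1; 1, 0, 0]
        !![0, 1, 0; 1 / a, -d / a, 0; 0, 0, 1]
        (by simp [Matrix.det_fin_three])
        (by simp [Matrix.det_fin_three, ha])
        fun x y z => ?_
      ext k
      fin_cases k <;> simp [table, net_apply] <;> field_simp <;> ring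
    by_cases he : e = 0
    · subst he
      by_cases hf : f = 0
      · subst hf
        by_cases ha : a = 0
        · subst ha
          by_cases hb : b = 0
          · subst hb
            refine .of_forall .PL 1
              !![0, 1, 0; 1, -d, 0; 0, 0, 1]
              (by simp)
              (by simp [Matrix.det_fin_three])
              fun x y z => ?_
            ext k
            fin_cases k <;> simp [table, net_apply] <;> ring
          · exact inTable_pencil_xy_swap (square b d hb)
        · by_cases hb : b = 0
          · subst hb
            exact square a d ha
          · obtain ⟨p, hp, rfl⟩ := exists_ne_zero_sq_eq ha
            obtain ⟨r, hr, rfl⟩ := exists_ne_zero_sq_eq hb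
            refine .of_forall .K !![0, 1 / (2 * p), 1 / (2 * p); 0, 1 / (2 * r), -1 / (2 * r); 1, 0, 0]
              !![1, 2 * p * r - d, 0; 1, -(2 * p * r) - d, 0; 0, 0, 1]
              (Eq.trans_ne (b := -1 / (2 * p * r)) (by simp [Matrix.det_fin_three] <;> field_simp <;> ring)
                (by simp [hp, hr]))
              (Eq.trans_ne (b := -(4 * p * r)) (by simp [Matrix.det_fin_three] <;> field_simp <;> ring)
                (by simp [hp, hr]))
              fun x y z => ?_
            ext k
            fin_cases k <;> simp [table, net_apply] <;> field_simp <;> ring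
      · exact inTable_pencil_xy_swap (tangent b a d f hf)
    · by_cases hf : f = 0
      · subst hf
        exact tangent a b d e he
      · refine .of_forall .pencil211 !![1 / e, 0, 0; 0, 1 / f, 0; -a / e ^ 2, -b / f ^ 2, 1]
          !![0, e * f, 0; 1, -d + e * b / f + f * a / e, 0; 0, 0, 1]
          (by simp [Matrix.det_fin_three, he, hf])
          (by simp [Matrix.det_fin_three, he, hf])
          fun x y z => ?_
        ext k
        fin_cases k <;> simp [table, net_apply] <;> field_simp <;> ring
  · refine (inTable_pencil_xy_sum_squares (a - e ^ 2 / (4 * c)) (b - f ^ 2 / (4 * c)) c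
      (d - e * f / (2 * c)) hc).of_equivalent (.of_forall
        !![1, 0, 0; 0, 1, 0; -e / (2 * c), -f / (2 * c), 1] 1
        (by simp [Matrix.det_fin_three]) (by simp) fun x y z => ?_)
    ext k
    fin_cases k <;> simp [net_apply] <;> field_simp <;> ring

lemma exists_singular_combination (A B : Matrix (Fin 3) (Fin 3) ℂ) (hB : B.det ≠ 0) :
    ∃ m : ℂ, (A + m • B).det = 0 := by
  -- The coefficients of det(A + mB). The halves come from the normalization `polarDet X X X = 6 det
  -- X`.
  obtain ⟨m, hm⟩ := exists_cubic_root hB (polarDet B B A / 2) (polarDet A A B / 2) A.det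
  refine ⟨m, ?_⟩
  rw [← hm]
  simp only [polarDet, Matrix.det_fin_three, Matrix.add_apply, Matrix.smul_apply, smul_eq_mul]
  ring

lemma gramForm_add_smul (q₁ q₂ : QuadraticForm ℂ C3) (m : ℂ) :
    gramForm (q₁ + m • q₂) = gramForm q₁ + m • gramForm q₂ := by
  ext i j
  simp [gramForm, QuadraticMap.polar]
  ring

/-- Every pencil has a singular member, because the determinant along it is a cubic polynomial over
ℂ. That member is made the second generator and becomes 0, x² or xy. -/
theorem inTable_pencil (q₁ q₂ : QuadraticForm ℂ C3) : InTable (net q₁ q₂ 0) := by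
  have main (q₁ q₂ : QuadraticForm ℂ C3) (h : (gramForm q₂).det = 0) :
      InTable (net q₁ q₂ 0) := by
    obtain ⟨g, hg, H⟩ := exists_singular_normal_form q₂ h
    refine InTable.of_equivalent ?_ (net_substForm _ _ _ g hg)
    rw [substForm_zero]
    rcases H with H | H | H <;> rw [H]
    · exact inTable_conic _
    · exact inTable_pencil_xx _
    · exact inTable_pencil_xy _
  by_cases h : (gramForm q₂).det = 0
  · exact main _ _ h
  · obtain ⟨m, hm⟩ := exists_singular_combination (gramForm q₁) _ h
    rw [← gramForm_add_smul] at hm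
    refine (main q₂ _ hm).of_equivalent ?_
    convert net_row_operations !![0, 1, 0; 1, m, 0; 0, 0, 1] (by simp [Matrix.det_fin_three])
      q₁ q₂ 0 using 1
    simp

/-- Linearly dependent triples of conics. -/
lemma inTable_of_relation (q₁ q₂ q₃ : QuadraticForm ℂ C3) (r₁ r₂ r₃ : ℂ)
    (hr : r₁ ≠ 0 ∨ r₂ ≠ 0 ∨ r₃ ≠ 0) (h : r₁ • q₁ + r₂ • q₂ + r₃ • q₃ = 0) :
    InTable (net q₁ q₂ q₃) := by
  rcases hr with hr | hr | hr
  · refine (inTable_pencil q₂ q₃).of_equivalent ?_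
    convert net_row_operations !![0, 1, 0; 0, 0, 1; r₁, r₂, r₃]
      (by simpa [Matrix.det_fin_three] using hr) q₁ q₂ q₃ using 2 <;> simp [h]
  · refine (inTable_pencil q₁ q₃).of_equivalent ?_
    convert net_row_operations !![1, 0, 0; 0, 0, 1; r₁, r₂, r₃]
      (by simpa [Matrix.det_fin_three] using hr) q₁ q₂ q₃ using 2 <;> simp [h]
  · refine (inTable_pencil q₁ q₂).of_equivalent ?_
    convert net_row_operations !![1, 0, 0; 0, 1, 0; r₁, r₂, r₃]
      (by simpa [Matrix.det_fin_three] using hr) q₁ q₂ q₃ using 2 <;> simp [h]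

/-! ### Nets of conics with unstable discriminant -/

/-- The discriminant cubic of a net. -/
def netDiscriminant (q₁ q₂ q₃ : QuadraticForm ℂ C3) : Cubic ℂ :=
  discriminant ![gramForm q₁, gramForm q₂, gramForm q₃]

lemma netDiscriminant_substForm (g : Matrix (Fin 3) (Fin 3) ℂ) (q₁ q₂ q₃ : QuadraticForm ℂ C3) :
    netDiscriminant (substForm g q₁) (substForm g q₂) (substForm g q₃) =
      g.det ^ 2 • netDiscriminant q₁ q₂ q₃ := by
  refine Cubic.ext_eval fun v => ?_
  rw [Cubic.eval_smul, netDiscriminant, netDiscriminant, eval_discriminant, eval_discriminant]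
  simp only [Matrix.cons_val, gramForm_substForm]
  have : v 0 • (g.transpose * gramForm q₁ * g) + v 1 • (g.transpose * gramForm q₂ * g) +
      v 2 • (g.transpose * gramForm q₃ * g) =
        g.transpose * (v 0 • gramForm q₁ + v 1 • gramForm q₂ + v 2 • gramForm q₃) * g := by
    simp [mul_add, add_mul]
  rw [this, Matrix.det_mul, Matrix.det_mul, Matrix.det_transpose]
  ring

lemma Cubic.IsNullform.smul {F : Cubic ℂ} (h : F.IsNullform) (t : ℂ) : (t • F).IsNullform := by
  obtain ⟨h1, h2, h3, h4, h5⟩ := h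
  simp [Cubic.IsNullform, Cubic.smul_def, *]

/-! ### Nets containing a double line -/

/-- The nets `yz, y² + γxy + δxz, x²`. -/
lemma inTable_yz_yy_xx (γ δ : ℂ) :
    InTable (net (conic 0 0 0 0 0 1) (conic 0 1 0 γ δ 0) xx) := by
  by_cases hδ : δ = 0
  · subst hδ
    by_cases hγ : γ = 0
    · subst hγ
      refine .of_forall .G 1
        !![0, 0, 1; 0, 1, 0; 1, 0, 0]
        (by simp)
        (by simp [Matrix.det_fin_three])
        fun x y z => ?_
      ext k
      fin_cases k <;> simp [table, net_apply]
    · refine .of_forall .F !![1 / γ, -1 / γ, 0; 0, 1, 0; 0, 0, 1]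
        !![0, 2, γ ^ 2; 0, 2, 0; 2, 0, 0]
        (by simp [Matrix.det_fin_three, hγ])
        (by simp [Matrix.det_fin_three, hγ])
        fun x y z => ?_
      ext k
      fin_cases k <;> simp [table, net_apply] <;> field_simp <;> ring
  -- With this `t`, the shift of y by tx together with a compensating change of z removes the xy
  -- terms from both conics.
  · obtain ⟨t, rfl⟩ : ∃ t, γ = -3 * t := ⟨-γ / 3, by ring⟩
    refine .of_forall .C !![1, 0, 0; t, 1, 0; -t ^ 2 / δ, t / δ, 2 / δ]
      !![0, 1, 3 * t ^ 2; δ, -t, -2 * t ^ 3; 0, 0, -1]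
      (by simp [Matrix.det_fin_three, hδ])
      (by simp [Matrix.det_fin_three, hδ])
      fun x y z => ?_
    ext k
    fin_cases k <;> simp [table, net_apply] <;> field_simp <;> ring

/-- The nets `x (dy + ez), y² + γxy + δxz, x²`. -/
lemma inTable_xl_yy_xx (d e γ δ : ℂ) :
    InTable (net (conic 0 0 0 d e 0) (conic 0 1 0 γ δ 0) xx) := by
  by_cases he : e = 0
  · subst he
    by_cases hd : d = 0
    · subst hd
      exact inTable_of_relation _ _ _ 1 0 0 (by simp) (by ext u; simp)
    · by_cases hδ : δ = 0
      · subst hδ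
        refine .of_forall .I 1
          !![0, 0, 1; 1 / d, 0, 0; -γ / d, 1, 0]
          (by simp)
          (by simp [Matrix.det_fin_three, hd])
          fun x y z => ?_
        ext k
        fin_cases k <;> simp [table, net_apply] <;> field_simp <;> ring
      · refine .of_forall .H !![1, 0, 0; 0, 1, 0; 0, 0, 2 / δ]
          !![0, 0, 1; 2 / d, 0, 0; -γ / d, 1, 0]
          (by simp [Matrix.det_fin_three, hδ])
          (by simp [Matrix.det_fin_three, hd])
          fun x y z => ?_
        ext k
        fin_cases k <;> simp [table, net_apply] <;> field_simp <;> ring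
  -- Subtracting δ/e times the first conic from the second leaves y² + 2kxy, which is (y + kx)²
  -- modulo x².
  · obtain ⟨k, rfl⟩ : ∃ k, γ = δ * d / e + 2 * k := ⟨(γ - δ * d / e) / 2, by ring⟩
    refine .of_forall .G !![0, 1, 0; 1, -k, 0; -d / e, d * k / e, 1 / e]
      !![-δ / e, 1, k ^ 2; 0, 0, 1; 1, 0, 0]
      (by simp [Matrix.det_fin_three, he])
      (by simp [Matrix.det_fin_three])
      fun x y z => ?_
    ext k
    fin_cases k <;> simp [table, net_apply] <;> field_simp <;> ring

/-- The nets `yz, x (dy + ez), x²`. -/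
lemma inTable_yz_xl_xx (d e : ℂ) :
    InTable (net (conic 0 0 0 0 0 1) (conic 0 0 0 d e 0) xx) := by
  by_cases hd : d = 0
  · subst hd
    by_cases he : e = 0
    · subst he
      exact inTable_of_relation _ _ _ 0 1 0 (by simp) (by ext u; simp)
    · refine .of_forall .Gdual !![0, 0, 1; 0, 1, 0; 1, 0, 0]
        !![1, 0, 0; 0, 1 / e, 0; 0, 0, 1]
        (by simp [Matrix.det_fin_three])
        (by simp [Matrix.det_fin_three, he])
        fun x y z => ?_
      ext k
      fin_cases k <;> simp [table, net_apply] <;> field_simp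
  · by_cases he : e = 0
    · subst he
      refine .of_forall .Gdual !![0, 0, 1; 1, 0, 0; 0, 1, 0]
        !![1, 0, 0; 0, 1 / d, 0; 0, 0, 1]
        (by simp [Matrix.det_fin_three])
        (by simp [Matrix.det_fin_three, hd])
        fun x y z => ?_
      ext k
      fin_cases k <;> simp [table, net_apply] <;> field_simp
    · have hI := Complex.I_sq
      refine .of_forall .Fdual !![0, 0, 1; 1 / (2 * d), -Complex.I / (2 * d), 0; 1 / (2 * e), Complex.I / (2 * e), 0]
        !![4 * d * e, 0, 0; 0, 1, 0; 0, 0, 1]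
        (Eq.trans_ne (b := Complex.I / (2 * d * e)) (by simp [Matrix.det_fin_three] <;> field_simp <;> ring)
          (by simp [hd, he]))
        (by simp [Matrix.det_fin_three, hd, he])
        fun x y z => ?_
      ext k
      fin_cases k <;> simp [table, net_apply] <;> field_simp <;> grind

/-- Changing the first two members of a net containing `x²`. -/
lemma net_reduce_xx (q₁ q₂ : QuadraticForm ℂ C3) (s t s' t' k l : ℂ) (h : s * t' - t * s' ≠ 0) :
    Equivalent (net q₁ q₂ xx) (net (s • q₁ + t • q₂ + k • xx) (s' • q₁ + t' • q₂ + l • xx) xx) := by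
  convert net_row_operations !![s, t, k; s', t', l; 0, 0, 1]
      (by simpa [Matrix.det_fin_three] using h) q₁ q₂ xx using 2 <;> simp

/-- The last two conics are divisible by x, so what matters is the restriction of `q` to the line x
= 0. If that vanishes as well, the net is x times three linear forms: these are either independent,
which gives `Idual`, or linearly related. -/
lemma inTable_net_xx_restriction_zero (a d e : ℂ) (q : QuadraticForm ℂ C3) :
    InTable (net q (conic a 0 0 d e 0) xx) := by
  obtain ⟨a₁, b₁, c₁, d₁, e₁, f₁, rfl⟩ := exists_conic q
  obtain ⟨p, q, r, s, hd, d', e', H⟩ := exists_restriction_normal_form a₁ b₁ c₁ d₁ e₁ f₁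
  refine InTable.of_equivalent ?_
    (net_substForm _ _ _ !![1, 0, 0; 0, p, q; 0, r, s] (by simpa [Matrix.det_fin_three] using hd))
  have H' : substForm !![1, 0, 0; 0, p, q; 0, r, s] (conic a 0 0 d e 0) =
      conic a 0 0 (d * p + e * r) (d * q + e * s) 0 := by
    ext u
    simp [Matrix.vecHead, Matrix.vecTail]
    ring
  rw [substForm_xx, H']
  generalize d * p + e * r = d, d * q + e * s = e at *
  rcases H with H | H | H <;> rw [H]
  · refine (inTable_yz_xl_xx d e).of_equivalent (.of_forall
        !![1, 0, 0; -e', 1, 0; -d', 0, 1]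
        !![1, 0, d' * e' - a₁; 0, 1, d * e' + e * d' - a; 0, 0, 1]
        (by simp [Matrix.det_fin_three]) (by simp [Matrix.det_fin_three]) fun x y z => ?_)
    ext k
    fin_cases k <;> simp [net_apply] <;> ring
  · refine (inTable_xl_yy_xx d e d' e').of_equivalent ?_
    convert net_reduce_xx _ _ 0 1 1 0 (-a) (-a₁) (by simp) using 2 <;> ext u <;> simp <;> ring
  · by_cases h : d' * e - d * e' = 0
    · by_cases he : e = 0
      · by_cases hd : d = 0
        · refine inTable_of_relation _ _ _ 0 1 (-a) (by simp) ?_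
          ext u
          simp [he, hd]
        · refine inTable_of_relation _ _ _ d (-d') (a * d' - a₁ * d) (by simp [hd]) ?_
          ext u
          simp
          linear_combination (u 0 * u 2) * h * (-1)
      · refine inTable_of_relation _ _ _ e (-e') (a * e' - a₁ * e) (by simp [he]) ?_
        ext u
        simp
        linear_combination (u 0 * u 1) * h
    · obtain ⟨D, hD⟩ : ∃ D, D = d' * e - d * e' := ⟨_, rfl⟩
      rw [← hD] at h
      refine .of_forall .Idual !![0, 0, 1; e / D, -e' / D, 0; -d / D, d' / D, 0]
        !![1, 0, -a₁; 0, 1, -a; 0, 0, 1]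
        (Eq.trans_ne (b := 1 / D) (by simp [Matrix.det_fin_three] <;> field_simp <;> grind)
          (by simp [h]))
        (by simp [Matrix.det_fin_three])
        fun x y z => ?_
      ext k
      fin_cases k <;> simp [table, net_apply] <;> field_simp <;> grind

lemma inTable_net_xx_restriction_square (a b d e a' d' e' f : ℂ) :
    InTable (net (conic a b 0 d e f) (conic a' 1 0 d' e' 0) xx) := by
  by_cases hf : f = 0
  · subst hf
    refine (inTable_xl_yy_xx (d - b * d') (e - b * e') d' e').of_equivalent ?_
    convert net_reduce_xx _ _ 1 (-b) 0 1 (b * a' - a) (-a') (by simp) using 2 <;>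
      ext u <;> simp <;> ring
  · have normalized (d e d' e' : ℂ) :
        InTable (net (conic 0 0 0 d e 1) (conic 0 1 0 d' e' 0) xx) := by
      refine (inTable_yz_yy_xx (d' - 2 * e) e').of_equivalent (.of_forall
        !![1, 0, 0; -e, 1, 0; -d, 0, 1] !![1, 0, d * e; 0, 1, d' * e + e' * d - e ^ 2; 0, 0, 1]
        (by simp [Matrix.det_fin_three]) (by simp [Matrix.det_fin_three]) fun x y z => ?_)
      ext k
      fin_cases k <;> simp [net_apply] <;> ring
    refine (normalized ((d - b * d') / f) ((e - b * e') / f) d' e').of_equivalent ?_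
    convert net_reduce_xx _ _ (1 / f) (-b / f) 0 1 ((b * a' - a) / f) (-a') (by simp [hf]) using 2 <;>
      ext u <;> simp <;> field_simp <;> ring

lemma xx_eq_conic : xx = conic 1 0 0 0 0 0 := by ext u; simp

lemma xy_eq_conic : xy = conic 0 0 0 1 0 0 := by ext u; simp

/-- Since x² has rank one, the coefficients `b₃` and `m` only see restrictions to the line x = 0: up
to factors, `b₃` is the discriminant of the second conic there and `m` is the polarized discriminant
of the first two. Thus `b₃ = 0` excludes the restriction yz, and for the restriction y² the
condition `m = 0` removes z² from the first conic. -/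
lemma inTable_net_xx (q₁ q₂ : QuadraticForm ℂ C3) (h : (netDiscriminant q₁ q₂ xx).IsNullform) :
    InTable (net q₁ q₂ xx) := by
  obtain ⟨a₂, b₂, c₂, d₂, e₂, f₂, rfl⟩ := exists_conic q₂
  obtain ⟨p, q, r, s, hd, d', e', H⟩ := exists_restriction_normal_form a₂ b₂ c₂ d₂ e₂ f₂
  refine InTable.of_equivalent ?_
    (net_substForm _ _ _ !![1, 0, 0; 0, p, q; 0, r, s] (by simpa [Matrix.det_fin_three] using hd))
  replace h := h.smul ((!![1, 0, 0; 0, p, q; 0, r, s] : Matrix (Fin 3) (Fin 3) ℂ).det ^ 2)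
  rw [← netDiscriminant_substForm] at h
  rw [substForm_xx] at h ⊢
  obtain ⟨a, b, c, d, e, f, h₁⟩ := exists_conic (substForm !![1, 0, 0; 0, p, q; 0, r, s] q₁)
  rw [h₁] at h ⊢
  obtain ⟨-, -, -, hm, hb⟩ := h
  rcases H with H | H | H <;> rw [H] at hm hb ⊢ <;>
    rw [xx_eq_conic, netDiscriminant, gramForm_conic, gramForm_conic, gramForm_conic] at hm hb <;>
    simp [discriminant, Cubic.ofTensor, polarDet, Matrix.det_fin_three] at hm hb
  · exact absurd (show (-4 : ℂ) = 0 by linear_combination hb) (by norm_num)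
  · obtain rfl : c = 0 := by linear_combination hm / 8
    exact inTable_net_xx_restriction_square _ _ _ _ _ _ _ _
  · exact inTable_net_xx_restriction_zero _ _ _ _

/-! ### Nets containing a pair of lines -/

/-- Nets in `⟨xy, x², y², yz⟩`. -/
lemma inTable_net_xy_flag (a b f a' b' f' : ℂ) :
    InTable (net (conic a b 0 0 0 f) (conic a' b' 0 0 0 f') xy) := by
  have main (a b f b' f' : ℂ) (ha : a ≠ 0) :
      InTable (net (conic a b 0 0 0 f) (conic 0 b' 0 0 0 f') xy) := by
    by_cases hf' : f' = 0
    · subst hf'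
      by_cases hb' : b' = 0
      · subst hb'
        exact inTable_of_relation _ _ _ 0 1 0 (by simp) (by ext u; simp)
      · by_cases hf : f = 0
        · subst hf
          refine .of_forall .I 1
            !![1 / a, -b / (a * b'), 0; 0, 0, 1; 0, 1 / b', 0]
            (by simp)
            (Eq.trans_ne (b := 1 / (a * b') * -1) (by simp [Matrix.det_fin_three] <;> field_simp)
              (by simp [ha, hb']))
            fun x y z => ?_
          ext k
          fin_cases k <;> simp [table, net_apply] <;> field_simp <;> ring
        · obtain ⟨p, hp, rfl⟩ := exists_ne_zero_sq_eq ha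
          refine .of_forall .H !![0, 1 / p, 0; 1, 0, 0; 0, 0, 2 / f]
            !![0, 1 / b', 0; 0, 0, 2 * p; 1, -b / b', 0]
            (by simp [Matrix.det_fin_three, hp, hf])
            (by simp [Matrix.det_fin_three, hp, hb'])
            fun x y z => ?_
          ext k
          fin_cases k <;> simp [table, net_apply] <;> field_simp <;> ring
    -- Here `k` is the coefficient of y² in the first conic once its yz term is cancelled by the
    -- second.
    · obtain ⟨k, rfl⟩ : ∃ k, b = k + f * b' / f' := ⟨b - f * b' / f', by ring⟩
      by_cases hk : k = 0
      · subst hk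
        refine .of_forall .Gdual !![0, 0, 1; 1, 0, 0; -b' / f', 1 / f', 0]
          !![0, 1, 0; 0, 0, 1; 1 / a, -f / (f' * a), 0]
          (by simp [Matrix.det_fin_three, hf'])
          (by simp [Matrix.det_fin_three, ha])
          fun x y z => ?_
        ext k
        fin_cases k <;> simp [table, net_apply] <;> field_simp <;> ring
      · obtain ⟨p, hp, rfl⟩ := exists_ne_zero_sq_eq ha
        obtain ⟨r, hr, rfl⟩ := exists_ne_zero_sq_eq hk
        refine .of_forall .F !![1 / p, 0, 0; 0, 1 / r, 0; 0, -b' / (f' * r), 1 / f']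
          !![1, -f / f', 0; 0, 0, 2 * p * r; 0, 2 * r, 0]
          (by simp [Matrix.det_fin_three, hp, hr, hf'])
          (by simp [Matrix.det_fin_three, hp, hr])
          fun x y z => ?_
        ext k
        fin_cases k <;> simp [table, net_apply] <;> field_simp <;> ring
  by_cases ha : a = 0
  · subst ha
    by_cases ha' : a' = 0
    · subst ha'
      by_cases h : b * f' - b' * f = 0
      · by_cases hf : f = 0
        · by_cases hb : b = 0
          · refine inTable_of_relation _ _ _ 1 0 0 (by simp) ?_
            ext u
            simp [hf, hb]
          · refine inTable_of_relation _ _ _ b' (-b) 0 (by simp [hb]) ?_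
            ext u
            simp
            linear_combination (u 1 * u 2) * h * (-1)
        · refine inTable_of_relation _ _ _ f' (-f) 0 (by simp [hf]) ?_
          ext u
          simp
          linear_combination (u 1 * u 1) * h
      · obtain ⟨D, hD⟩ : ∃ D, D = b * f' - b' * f := ⟨_, rfl⟩
        rw [← hD] at h
        refine .of_forall .Idual !![1, 0, 0; 0, 0, 1; 0, 1, 0]
          !![0, 0, 1; -b' / D, b / D, 0; f' / D, -f / D, 0]
          (by simp [Matrix.det_fin_three])
          (Eq.trans_ne (b := -1 / D) (by simp [Matrix.det_fin_three] <;> field_simp <;> grind)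
            (by simp [h]))
          fun x y z => ?_
        ext k
        fin_cases k <;> simp [table, net_apply] <;> field_simp <;> grind
    · refine (main a' b' f' b f ha').of_equivalent ?_
      convert net_row_operations !![0, 1, 0; 1, 0, 0; 0, 0, 1] (by simp [Matrix.det_fin_three])
        _ _ _ using 2 <;> simp
  · refine (main a b f (b' - a' / a * b) (f' - a' / a * f) ha).of_equivalent ?_
    convert net_row_operations !![1, 0, 0; -a' / a, 1, 0; 0, 0, 1]
      (by simp [Matrix.det_fin_three]) _ _ _ using 2 <;> ext u <;> simp <;> field_simp <;> ring

/-- The nets `(x + y)z, αx² + βy², xy`. -/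
lemma inTable_net_xy_line (α β : ℂ) :
    InTable (net (conic 0 0 0 0 1 1) (conic α β 0 0 0 0) xy) := by
  by_cases hα : α = 0
  · subst hα
    by_cases hβ : β = 0
    · subst hβ
      exact inTable_of_relation _ _ _ 0 1 0 (by simp) (by ext u; simp)
    · refine .of_forall .Gdual !![1, 0, -1; 0, 0, 1; 0, 1, 0]
        !![1, 0, 0; 0, 1 / β, 1; 0, 1 / β, 0]
        (by simp [Matrix.det_fin_three])
        (by simp [Matrix.det_fin_three, hβ])
        fun x y z => ?_
      ext k
      fin_cases k <;> simp [table, net_apply] <;> field_simp <;> ring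
  · by_cases hβ : β = 0
    · subst hβ
      refine .of_forall .Gdual !![0, 0, 1; 1, 0, -1; 0, 1, 0]
        !![1, 0, 0; 0, 1 / α, 1; 0, 1 / α, 0]
        (by simp [Matrix.det_fin_three])
        (by simp [Matrix.det_fin_three, hα])
        fun x y z => ?_
      ext k
      fin_cases k <;> simp [table, net_apply] <;> field_simp <;> ring
    -- The pencil spanned by αx² + βy² and xy contains two squares, of √α x ± √β y. One of them is
    -- proportional to (x + y)² exactly when α = β, which separates `G` from `F`.
    · by_cases h : α - β = 0
      · obtain rfl := sub_eq_zero.1 h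
        refine .of_forall .G !![1 / 2, 1 / 2, 0; -1 / 2, 1 / 2, 0; 0, 0, 1]
          !![0, 1 / α, -2; 0, 1 / α, 2; 1, 0, 0]
          (Eq.trans_ne (b := 1 / 2) (by simp [Matrix.det_fin_three] <;> field_simp <;> ring)
            (by simp []))
          (Eq.trans_ne (b := 4 / α) (by simp [Matrix.det_fin_three] <;> field_simp <;> ring)
            (by simp [hα]))
          fun x y z => ?_
        ext k
        fin_cases k <;> simp [table, net_apply] <;> field_simp <;> ring
      · obtain ⟨k, hk, hk2⟩ := exists_ne_zero_sq_eq (mul_ne_zero hα hβ)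
        refine .of_forall .F !![1 / (α - β), -β / (k * (α - β)), 0; -1 / (α - β), α / (k * (α - β)), 0; 0, 0, 1]
          !![0, α + β, 4 * α * β; 0, 2 * k, 2 * k * (α + β); 2 * k, 0, 0]
          (Eq.trans_ne (b := 1 / (k * (α - β))) (by simp [Matrix.det_fin_three] <;> field_simp)
            (by simp [hk, h]))
          (Eq.trans_ne (b := 4 * k ^ 2 * (α - β) ^ 2) (by simp [Matrix.det_fin_three] <;> field_simp <;> ring)
            (by simp [hk, h]))
          fun x y z => ?_
        ext k
        fin_cases k <;> simp [table, net_apply] <;> field_simp <;> grind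

/-- Vanishing of `c₁` and `c₂` says that the first two conics pass through the vertex [0:0:1]. The
gradients (e, f) and (e', f') there are then constrained by the quadratic form ef: the second is
isotropic and the two are orthogonal. So all gradients lie on one axis, which is the flag case up to
exchanging x and y, or the second vanishes. -/
lemma inTable_net_xy (q₁ q₂ : QuadraticForm ℂ C3) (h : (netDiscriminant q₁ q₂ xy).IsNullform) :
    InTable (net q₁ q₂ xy) := by
  obtain ⟨a, b, c, d, e, f, rfl⟩ := exists_conic q₁
  obtain ⟨a', b', c', d', e', f', rfl⟩ := exists_conic q₂
  obtain ⟨-, hc, hc', hm, hb⟩ := h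
  rw [xy_eq_conic, netDiscriminant, gramForm_conic, gramForm_conic, gramForm_conic]
    at hm hb hc hc'
  simp [discriminant, Cubic.ofTensor, polarDet, Matrix.det_fin_three] at hm hb hc hc'
  obtain rfl : c = 0 := by linear_combination -hc / 4
  obtain rfl : c' = 0 := by linear_combination -hc' / 4
  have hb : e' * f' = 0 := by linear_combination hb / 4
  have hm : e * f' + e' * f = 0 := by linear_combination hm / 2
  have hred : Equivalent (net (conic a b 0 d e f) (conic a' b' 0 d' e' f') xy)
      (net (conic a b 0 0 e f) (conic a' b' 0 0 e' f') xy) := by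
    convert net_row_operations !![1, 0, -d; 0, 1, -d'; 0, 0, 1] (by simp [Matrix.det_fin_three])
      _ _ _ using 2 <;> ext u <;> simp <;> ring
  refine InTable.of_equivalent ?_ hred
  have left (he : e = 0) (he' : e' = 0) :
      InTable (net (conic a b 0 0 e f) (conic a' b' 0 0 e' f') xy) := by
    subst he he'
    exact inTable_net_xy_flag _ _ _ _ _ _
  have right (hf : f = 0) (hf' : f' = 0) :
      InTable (net (conic a b 0 0 e f) (conic a' b' 0 0 e' f') xy) := by
    subst hf hf'
    have := net_substForm (conic a b 0 0 e 0) (conic a' b' 0 0 e' 0) xy !![0, 1, 0; 1, 0, 0; 0, 0, 1]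
      (by simp [Matrix.det_fin_three])
    rw [conic_swap, conic_swap, xy_swap] at this
    exact (inTable_net_xy_flag _ _ _ _ _ _).of_equivalent this
  by_cases he' : e' = 0
  · by_cases hf' : f' = 0
    · by_cases he : e = 0
      · exact left he he'
      · by_cases hf : f = 0
        · exact right hf hf'
        · subst he' hf'
          refine (inTable_net_xy_line (a' / e ^ 2) (b' / f ^ 2)).of_equivalent (.of_forall
            !![1 / e, 0, 0; 0, 1 / f, 0; -a / e ^ 2, -b / f ^ 2, 1]
            !![1, 0, e * b / f + f * a / e; 0, 1, 0; 0, 0, e * f]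
            (by simp [Matrix.det_fin_three, he, hf]) (by simp [Matrix.det_fin_three, he, hf])
            fun x y z => ?_)
          ext k
          fin_cases k <;> simp [net_apply] <;> field_simp <;> ring
    · refine left ?_ he'
      rw [he'] at hm
      simpa [hf'] using hm
  · have hf' : f' = 0 := by simpa [he'] using hb
    refine right ?_ hf'
    rw [hf'] at hm
    simpa [he'] using hm

/-- Nets whose discriminant is a nullform are in the table. -/
theorem inTable_of_isNullform (q₁ q₂ q₃ : QuadraticForm ℂ C3)
    (h : (netDiscriminant q₁ q₂ q₃).IsNullform) : InTable (net q₁ q₂ q₃) := by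
  have h3 : (gramForm q₃).det = 0 := by
    have := h.1
    have hd := eval_discriminant ![gramForm q₁, gramForm q₂, gramForm q₃] ![0, 0, 1]
    simp [Cubic.eval] at hd
    rw [netDiscriminant] at this
    rw [this] at hd
    simpa using hd.symm
  obtain ⟨g, hg, H⟩ := exists_singular_normal_form q₃ h3
  refine InTable.of_equivalent ?_ (net_substForm _ _ _ g hg)
  replace h := h.smul (g.det ^ 2)
  rw [← netDiscriminant_substForm] at h
  rcases H with H | H | H <;> rw [H] at h ⊢
  · exact inTable_pencil _ _
  · exact inTable_net_xx _ _ h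
  · exact inTable_net_xy _ _ h

/-! ### The invariants of nets -/

namespace Cubic

variable {A B : Type*} [CommRing A] [CommRing B]

/-- Base change of a cubic. -/
def map (φ : A →+* B) (F : Cubic A) : Cubic B :=
  ⟨φ F.a, φ F.b, φ F.c, φ F.a₂, φ F.a₃, φ F.b₁, φ F.b₃, φ F.c₁, φ F.c₂, φ F.m⟩

lemma map_aronhold (φ : A →+* B) (F : Cubic A) : (F.map φ).aronhold = φ F.aronhold := by
  simp [aronhold, map, map_ofNat φ 2, map_ofNat φ 3]

end Cubic

lemma map_discriminant {A B : Type*} [CommRing A] [CommRing B] (φ : A →+* B)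
    (G : Fin 3 → Matrix (Fin 3) (Fin 3) A) :
    (discriminant G).map φ = discriminant fun k => (G k).map φ := by
  have h (X Y Z : Matrix (Fin 3) (Fin 3) A) :
      φ (polarDet X Y Z) = polarDet (X.map φ) (Y.map φ) (Z.map φ) := by
    simp [polarDet, Matrix.det_fin_three]
  simp [discriminant, Cubic.map, Cubic.ofTensor, h]

lemma Cubic.map_aronholdHessian {A B : Type*} [CommRing A] [CommRing B] (φ : A →+* B) (t : A)
    (F : Cubic A) : (F.map φ).aronholdHessian (φ t) = φ (F.aronholdHessian t) := by
  rw [aronholdHessian, aronholdHessian, ← map_aronhold]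
  have h : (F.map φ).hessian = F.hessian.map φ := by
    rw [hessian, hessian, map_discriminant]
    congr 1
    ext k i j
    fin_cases k <;> fin_cases i <;> fin_cases j <;> rfl
  rw [h]
  simp [add_def, smul_def, map]

/-- The discriminant cubic of a net, in terms of its coordinates. -/
def netCubic (M : Noc) : Cubic ℂ :=
  discriminant fun k => .of fun i j =>
    QuadraticMap.polar M (Pi.single i (1 : ℂ)) (Pi.single j (1 : ℂ)) k

lemma netCubic_net (q₁ q₂ q₃ : QuadraticForm ℂ C3) :
    netCubic (net q₁ q₂ q₃) = netDiscriminant q₁ q₂ q₃ := by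
  rw [netCubic, netDiscriminant]
  congr 1
  ext k i j
  fin_cases k <;> simp [gramForm, QuadraticMap.polar, net_apply]

/-- The matrix `g` acts on all Gram matrices by congruence, while `h` recombines them by its rows;
in the parameters of the cubic this is substitution by the transpose. -/
lemma netCubic_change (M N : Noc) (g h : Matrix (Fin 3) (Fin 3) ℂ)
    (H : ∀ u, N u = h.mulVec (M (g.mulVec u))) :
    netCubic N = g.det ^ 2 • (netCubic M).subst h.transpose := by
  obtain ⟨q₁, q₂, q₃, rfl⟩ := exists_net M
  rw [netCubic_net, netDiscriminant, ← discriminant_change]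
  simp only [Matrix.cons_val, Matrix.transpose_apply]
  rw [netCubic]
  congr 1
  ext k : 1
  have key : h k 0 • gramForm (substForm g q₁) + h k 1 • gramForm (substForm g q₂) +
      h k 2 • gramForm (substForm g q₃) =
      g.transpose * (h k 0 • gramForm q₁ + h k 1 • gramForm q₂ + h k 2 • gramForm q₃) * g := by
    simp [gramForm_substForm, mul_add, add_mul]
  rw [← key]
  ext i j
  simp [gramForm, QuadraticMap.polar, H, net_apply, Matrix.mulVec, dotProduct,
    Fin.sum_univ_three]
  ring

/-- The coordinates of a net, as polynomial functions. -/
def gramCoordinate (k i j : Fin 3) : polynomialFunctions :=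
  ⟨fun M => QuadraticMap.polar M (Pi.single i (1 : ℂ)) (Pi.single j (1 : ℂ)) k,
    Algebra.subset_adjoin ⟨
      { toFun := fun M => QuadraticMap.polar M (Pi.single i (1 : ℂ)) (Pi.single j (1 : ℂ)) k
        map_add' := fun M N => by simp [QuadraticMap.polar_add]
        map_smul' := fun c M => by simp [QuadraticMap.polar_smul] }, rfl⟩⟩

/-- The invariant is computed for the generic net, whose coordinates lie in the ring of polynomial
functions itself. Base change along evaluation at `M` shows that the result is the given function.
-/
lemma aronholdHessian_netCubic_mem (t : ℂ) :
    (fun M => (netCubic M).aronholdHessian t) ∈ polynomialFunctions := by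
  let f : polynomialFunctions := (discriminant fun k => .of fun i j =>
    gramCoordinate k i j).aronholdHessian (algebraMap ℂ _ t)
  have hf : (fun M => (netCubic M).aronholdHessian t) = (f : Noc → ℂ) := by
    ext M
    let φ : polynomialFunctions →+* ℂ :=
      (Pi.evalRingHom (fun _ : Noc => ℂ) M).comp polynomialFunctions.val.toRingHom
    have h1 : (f : Noc → ℂ) M = φ f := rfl
    have h2 : t = φ (algebraMap ℂ _ t) := rfl
    rw [h1, ← Cubic.map_aronholdHessian, map_discriminant, ← h2]
    rfl
  rw [hf]
  exact f.2

lemma IsUnstable.invariantsVanish {M : Noc} (hM : IsUnstable M) :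
    (netCubic M).InvariantsVanish := by
  intro t
  refine hM _ (aronholdHessian_netCubic_mem t) (fun p h₁ h₂ N => ?_) ?_
  · have h := netCubic_change N (action p N) _ _ (action_apply p N)
    have hdet : ((p.1⁻¹ : GL (Fin 3) ℂ) : Matrix (Fin 3) (Fin 3) ℂ).det = 1 := by
      rw [Matrix.coe_units_inv, Matrix.det_nonsing_inv, h₁]
      simp
    have h₂' : ((p.2 : Matrix (Fin 3) (Fin 3) ℂ).transpose).det = 1 := by
      rw [Matrix.det_transpose, h₂]
    have hone (F : Cubic ℂ) : (1 : ℂ) • F = F := by simp [Cubic.smul_def]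
    rw [hdet, one_pow, hone] at h
    simp only [h]
    rw [Cubic.aronholdHessian_subst _ _ _ (by rw [h₂']; exact one_ne_zero), h₂']
    simp
  · have h0 : netCubic 0 = ⟨0, 0, 0, 0, 0, 0, 0, 0, 0, 0⟩ := by
      ext <;> simp [netCubic, discriminant, Cubic.ofTensor, polarDet, Matrix.det_fin_three,
        QuadraticMap.polar]
    simp [h0, Cubic.aronholdHessian, Cubic.hessian, Cubic.aronhold, discriminant, Cubic.slice,
      Cubic.ofTensor, polarDet, Matrix.det_fin_three, Cubic.add_def, Cubic.smul_def]

theorem IsUnstable.inTable {M : Noc} (hM : IsUnstable M) : InTable M := by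
  obtain ⟨h, hh, H⟩ := hM.invariantsVanish.hasNullform
  -- Only V has to be moved; the transpose cancels the one in `netCubic_change`.
  let p : NetGroup := (1, Matrix.GeneralLinearGroup.mkOfDetNeZero h.transpose
    (by rwa [Matrix.det_transpose]))
  have hc := netCubic_change M (action p M) _ _ (action_apply p M)
  obtain ⟨q₁, q₂, q₃, hq⟩ := exists_net (action p M)
  refine InTable.of_equivalent (N := action p M) ?_ (mem_orbit_iff.1 ⟨p, rfl⟩)
  rw [hq] at hc ⊢
  refine inTable_of_isNullform _ _ _ ?_
  rw [← netCubic_net, hc]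
  exact H.smul _

/-! ### The nets of the table are unstable -/

lemma comp_linear_mem_polynomialFunctions {f : Noc → ℂ} (hf : f ∈ polynomialFunctions)
    (L : Noc →ₗ[ℂ] Noc) : (fun M => f (L M)) ∈ polynomialFunctions := by
  induction hf using Algebra.adjoin_induction with
  | mem f hf =>
    obtain ⟨l, rfl⟩ := hf
    exact Algebra.subset_adjoin ⟨l.comp L, rfl⟩
  | algebraMap c => exact Subalgebra.algebraMap_mem _ c
  | add f g _ _ hf hg => exact add_mem hf hg
  | mul f g _ _ hf hg => exact mul_mem hf hg

lemma continuous_polynomialFunction_smul {f : Noc → ℂ} (hf : f ∈ polynomialFunctions) (M : Noc) :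
    Continuous fun s : ℂ => f (s • M) := by
  induction hf using Algebra.adjoin_induction with
  | mem f hf =>
    obtain ⟨l, rfl⟩ := hf
    simp only [map_smul, smul_eq_mul]
    fun_prop
  | algebraMap c => exact continuous_const
  | add f g _ _ hf hg => exact hf.add hg
  | mul f g _ _ hf hg => exact hf.mul hg

/-- Composing an invariant with `p` gives another invariant, because the determinant-one subgroup is
normal. -/
lemma IsUnstable.action {M : Noc} (hM : IsUnstable M) (p : NetGroup) :
    IsUnstable (action p M) := by
  intro f hf hinv h0
  refine hM _ (comp_linear_mem_polynomialFunctions hf (NetsOfConics.action p))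
    (fun q h₁ h₂ N => ?_) (by simpa using h0)
  have : NetsOfConics.action p (NetsOfConics.action q N) =
      NetsOfConics.action (p * q * p⁻¹) (NetsOfConics.action p N) := by
    simp only [← Module.End.mul_apply, ← map_mul]
    simp
  change f (NetsOfConics.action p (NetsOfConics.action q N)) = f (NetsOfConics.action p N)
  rw [this]
  refine hinv _ ?_ ?_ _
  · simp [h₁, mul_inv_cancel₀ (Matrix.isUnits_det_units p.1).ne_zero]
  · simp [h₂, mul_inv_cancel₀ (Matrix.isUnits_det_units p.2).ne_zero]

/-- The element with parameter `s` scales `M` by `s` and has determinants one. An invariant is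
therefore constant on the punctured line through `M`, hence by continuity also at 0. -/
lemma isUnstable_of_oneParameterSubgroup (M : Noc) (a b : Fin 3 → ℤ) (ha : a 0 + a 1 + a 2 = 0)
    (hb : b 0 + b 1 + b 2 = 0)
    (H : ∀ s : ℂ, s ≠ 0 → ∀ x y z k, s ^ b k * M ![s ^ (-a 0) * x, s ^ (-a 1) * y,
      s ^ (-a 2) * z] k = s * M ![x, y, z] k) : IsUnstable M := by
  intro f hf hinv h0
  have h (s : ℂˣ) : f ((s : ℂ) • M) = f M := by
    rw [← hinv (diagonalGL fun i => s ^ a i, diagonalGL fun i => s ^ b i) ?_ ?_ M]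
    · congr 1
      ext u k
      rw [action_apply, ← map_inv, diagonalGL_coe, diagonalGL_coe, Matrix.mulVec_diagonal]
      have hu : u = ![u 0, u 1, u 2] := by ext i; fin_cases i <;> rfl
      have hv : ((Matrix.diagonal fun i => (((fun i => s ^ a i)⁻¹ : Fin 3 → ℂˣ) i : ℂ)).mulVec u) =
          ![(s : ℂ) ^ (-a 0) * u 0, (s : ℂ) ^ (-a 1) * u 1, (s : ℂ) ^ (-a 2) * u 2] := by
        ext i
        rw [Matrix.mulVec_diagonal]
        fin_cases i <;> simp
      have := H s s.ne_zero (u 0) (u 1) (u 2) k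
      rw [← hu] at this
      rw [hv, _root_.smul_apply, Pi.smul_apply, smul_eq_mul, ← this]
      simp
    · simp only [diagonalGL_coe, Matrix.det_diagonal, Fin.prod_univ_three]
      rw [← Units.val_mul, ← Units.val_mul, ← zpow_add, ← zpow_add, ha]
      simp
    · simp only [diagonalGL_coe, Matrix.det_diagonal, Fin.prod_univ_three]
      rw [← Units.val_mul, ← Units.val_mul, ← zpow_add, ← zpow_add, hb]
      simp
  have hcont := continuous_polynomialFunction_smul hf M
  have hconst : (fun s : ℂ => f (s • M)) = fun _ => f M := by
    refine Continuous.ext_on (dense_compl_singleton (0 : ℂ)) hcont continuous_const ?_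
    intro s hs
    exact h (Units.mk0 s hs)
  have := congrFun hconst 0
  simp only [zero_smul, h0] at this
  exact this.symm

lemma isUnstable_pencil (q₁ q₂ : QuadraticForm ℂ C3) : IsUnstable (net q₁ q₂ 0) := by
  refine isUnstable_of_oneParameterSubgroup _ ![0, 0, 0] ![1, 1, -2] rfl rfl
    fun s hs x y z k => ?_
  fin_cases k <;> simp [net_apply]

theorem isUnstable_representative (o : OrbitName) : IsUnstable (table o).representative := by
  cases o
  case C =>
    -- The exponents, here and below, solve b_k - a_i - a_j = 1 for every monomial that occurs, with
    -- both triples of sum zero.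
    refine isUnstable_of_oneParameterSubgroup _ ![-3, 0, 3] ![1, 4, -5] rfl rfl
      fun s hs x y z k => ?_
    fin_cases k <;> simp [table, net_apply, hs] <;> field_simp
  case F =>
    refine isUnstable_of_oneParameterSubgroup _ ![-1, -1, 2] ![-1, -1, 2] rfl rfl
      fun s hs x y z k => ?_
    fin_cases k <;> simp [table, net_apply] <;> field_simp
  case Fdual =>
    refine isUnstable_of_oneParameterSubgroup _ ![1, 1, -2] ![3, 0, -3] rfl rfl
      fun s hs x y z k => ?_
    fin_cases k <;> simp [table, net_apply] <;> field_simp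
  case G =>
    refine isUnstable_of_oneParameterSubgroup _ ![-1, -1, 2] ![-1, -1, 2] rfl rfl
      fun s hs x y z k => ?_
    fin_cases k <;> simp [table, net_apply] <;> field_simp
  case Gdual =>
    refine isUnstable_of_oneParameterSubgroup _ ![1, 1, -2] ![3, 0, -3] rfl rfl
      fun s hs x y z k => ?_
    fin_cases k <;> simp [table, net_apply] <;> field_simp
  case H =>
    refine isUnstable_of_oneParameterSubgroup _ ![-1, 0, 1] ![-1, 0, 1] rfl rfl
      fun s hs x y z k => ?_
    fin_cases k <;> simp [table, net_apply, hs] <;> field_simp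
  case I =>
    refine isUnstable_of_oneParameterSubgroup _ ![-1, 0, 1] ![-1, 0, 1] rfl rfl
      fun s hs x y z k => ?_
    fin_cases k <;> simp [table, net_apply] <;> field_simp
  case Idual =>
    refine isUnstable_of_oneParameterSubgroup _ ![1, 0, -1] ![1, 0, -1] rfl rfl
      fun s hs x y z k => ?_
    fin_cases k <;> simp [table, net_apply, hs] <;> field_simp
  all_goals exact isUnstable_pencil _ _

theorem isUnstable_iff (M : Noc) :
    IsUnstable M ↔ ∃ o, M ∈ orbit (table o).representative := by
  refine ⟨IsUnstable.inTable, ?_⟩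
  rintro ⟨o, p, rfl⟩
  exact (isUnstable_representative o).action p

/-! ### Infinitesimal description of tori -/

/-- The one-parameter subgroup `s ↦ (exp (s z₁), …, exp (s zᵣ))`. -/
def expPath {r : ℕ} (z : Fin r → ℂ) (s : ℂ) : Fin r → ℂˣ :=
  fun i => Units.mk0 (Complex.exp (s * z i)) (Complex.exp_ne_zero _)

lemma expPath_zero {r : ℕ} (z : Fin r → ℂ) : expPath z 0 = 1 := by
  ext i
  simp [expPath]

lemma expPath_add {r : ℕ} (z : Fin r → ℂ) (s t : ℂ) :
    expPath z (s + t) = expPath z s * expPath z t := by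
  ext i
  simp [expPath, add_mul, Complex.exp_add]

lemma exists_expPath_one {r : ℕ} (t : Fin r → ℂˣ) : ∃ z, expPath z 1 = t := by
  refine ⟨fun i => Complex.log (t i), ?_⟩
  ext i
  simp [expPath, Complex.exp_log]

lemma character_expPath {r : ℕ} (m : Fin r → ℤ) (z : Fin r → ℂ) (s : ℂ) :
    (character m (expPath z s) : ℂ) = Complex.exp (s * ∑ i, m i * z i) := by
  rw [character, Units.coe_prod, Finset.mul_sum, Complex.exp_sum]
  refine Finset.prod_congr rfl fun i _ => ?_
  rw [Units.val_zpow_eq_zpow_val, expPath, Units.val_mk0, ← Complex.exp_int_mul]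
  congr 1
  ring

/-- Along exponential paths Laurent polynomials become sums of exponentials. This is what makes an
algebraic torus have tangent vectors. -/
lemma IsLaurent.differentiable_expPath {r : ℕ} {f : (Fin r → ℂˣ) → ℂ} (hf : IsLaurent f)
    (z : Fin r → ℂ) : Differentiable ℂ fun s => f (expPath z s) := by
  obtain ⟨c, hc⟩ := hf
  simp only [hc, Finsupp.sum, character_expPath]
  fun_prop

/-- A one-parameter group of matrices whose derivative at zero is diagonal. -/
lemma eq_diagonal_of_hasDerivAt (γ : ℂ → Matrix (Fin 3) (Fin 3) ℂ) (h0 : γ 0 = 1)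
    (hadd : ∀ s t, γ (s + t) = γ s * γ t) (d : Fin 3 → ℂ)
    (hγ : ∀ i j, HasDerivAt (fun s => γ s i j) (Matrix.diagonal d i j) 0) (s : ℂ) :
    γ s = Matrix.diagonal fun i => Complex.exp (s * d i) := by
  have hder (i j s) : HasDerivAt (fun s => γ s i j) (γ s i j * d j) s := by
    have h1 : HasDerivAt (fun t => γ (s + t) i j) (γ s i j * d j) 0 := by
      have h2 : HasDerivAt (fun t => ∑ k, γ s i k * γ t k j)
          (∑ k, γ s i k * Matrix.diagonal d k j) 0 :=
        HasDerivAt.fun_sum fun k _ => (hγ k j).const_mul _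
      rw [← Matrix.mul_apply, Matrix.mul_diagonal] at h2
      simpa only [hadd, Matrix.mul_apply] using h2
    have h3 := HasDerivAt.comp_sub_const (x := s) (a := s)
      (f := fun t => γ (s + t) i j) (f' := γ s i j * d j) (by simpa using h1)
    simpa using h3
  ext i j
  -- The entries satisfy γ' = γ·d_j in column j, so dividing by the exponential solution gives a
  -- constant.
  have hconst : ∀ s t, γ s i j * Complex.exp (-(s * d j)) = γ t i j * Complex.exp (-(t * d j)) := by
    refine is_const_of_deriv_eq_zero (𝕜 := ℂ)
      (f := fun s => γ s i j * Complex.exp (-(s * d j))) (fun s => ?_) (fun s => ?_)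
    · exact ((hder i j s).differentiableAt).mul (by fun_prop)
    · have h4 : HasDerivAt (fun s => Complex.exp (-(s * d j)))
          (Complex.exp (-(s * d j)) * (-(1 * d j))) s :=
        (((hasDerivAt_id s).mul_const (d j)).neg).cexp
      rw [((hder i j s).fun_mul h4).deriv]
      ring
  have h5 := hconst s 0
  rw [h0] at h5
  simp only [zero_mul, neg_zero, Complex.exp_zero, mul_one, Complex.exp_neg] at h5
  rw [mul_inv_eq_iff_eq_mul₀ (Complex.exp_ne_zero _)] at h5
  rw [h5, Matrix.diagonal_apply, Matrix.one_apply]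
  split_ifs with hij
  · rw [hij, one_mul]
  · rw [zero_mul]

lemma hasDerivAt_quadraticForm (q : QuadraticForm ℂ C3) (v : ℂ → C3) (v' : C3) (s : ℂ)
    (hv : ∀ i, HasDerivAt (fun t => v t i) (v' i) s) :
    HasDerivAt (fun t => q (v t)) (QuadraticMap.polar q (v s) v') s := by
  obtain ⟨a, b, c, d, e, f, rfl⟩ := exists_conic q
  simp only [conic_apply]
  have H (i j : Fin 3) (k : ℂ) := ((hv i).fun_mul (hv j)).const_mul k
  refine ((((((H 0 0 a).fun_add (H 1 1 b)).fun_add (H 2 2 c)).fun_add (H 0 1 d)).fun_add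
    (H 0 2 e)).fun_add (H 1 2 f)).congr_deriv ?_
  simp [QuadraticMap.polar]
  ring

/-- The derivative at `0` of a path in the stabilizer of a net. -/
lemma infinitesimalAction_eq_zero (M : Noc) (g h : ℂ → Matrix (Fin 3) (Fin 3) ℂ)
    (X Y : Matrix (Fin 3) (Fin 3) ℂ) (hg0 : g 0 = 1)
    (hg : ∀ i j, HasDerivAt (fun s => g s i j) (X i j) 0)
    (hh : ∀ i j, HasDerivAt (fun s => h s i j) (Y i j) 0)
    (H : ∀ s u, (h s).mulVec (M u) = M ((g s).mulVec u)) : infinitesimalAction M (X, Y) = 0 := by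
  ext u k
  rw [infinitesimalAction_apply, _root_.zero_apply, Pi.zero_apply, Pi.sub_apply, sub_eq_zero]
  have h1 : HasDerivAt (fun s => (h s).mulVec (M u) k) (Y.mulVec (M u) k) 0 := by
    simp only [Matrix.mulVec, dotProduct]
    exact HasDerivAt.fun_sum fun j _ => (hh k j).mul_const _
  have hv (i : Fin 3) : HasDerivAt (fun s => (g s).mulVec u i) (X.mulVec u i) 0 := by
    simp only [Matrix.mulVec, dotProduct]
    exact HasDerivAt.fun_sum fun j _ => (hg i j).mul_const _
  have h2 := hasDerivAt_quadraticForm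
    ((LinearMap.proj (R := ℂ) (φ := fun _ : Fin 3 => ℂ) k).compQuadraticMap M)
    (fun s => (g s).mulVec u) (X.mulVec u) 0 hv
  simp only [H] at h1
  rw [hg0, Matrix.one_mulVec] at h2
  exact h1.unique h2

lemma exists_character_ne {r : ℕ} {m n : Fin r → ℤ} (h : m ≠ n) :
    ∃ t : Fin r → ℂˣ, character m t ≠ character n t := by
  obtain ⟨i, hi⟩ := Function.ne_iff.1 h
  refine ⟨Pi.mulSingle i (Units.mk0 2 two_ne_zero), fun H => hi ?_⟩
  have key (m : Fin r → ℤ) :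
      (character m (Pi.mulSingle i (Units.mk0 2 two_ne_zero)) : ℂ) = 2 ^ m i := by
    rw [character, Finset.prod_eq_single i]
    · simp
    · intro j _ hj
      simp [Pi.mulSingle_eq_of_ne hj]
    · simp
  have H' : ((2 : ℝ) : ℂ) ^ m i = ((2 : ℝ) : ℂ) ^ n i := by
    have := congrArg (Units.val) H
    rw [key, key] at this
    simpa using this
  have H'' : (2 : ℝ) ^ m i = (2 : ℝ) ^ n i := by exact_mod_cast H'
  exact zpow_right_injective₀ (by norm_num) (by norm_num) H''

lemma isLaurent_zero {r : ℕ} : IsLaurent (fun _ : Fin r → ℂˣ => 0) := ⟨0, by simp⟩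

lemma isLaurent_character {r : ℕ} (m : Fin r → ℤ) :
    IsLaurent fun t => (character m t : ℂ) := ⟨Finsupp.single m 1, by simp⟩

/-- Criterion for a diagonal torus to be parametrized with finite kernel. -/
lemma isTorusParametrization_diagonalHom {r : ℕ} (a b : Fin 3 → Fin r → ℤ)
    (c d : Fin r → Fin 3 → ℤ)
    (h : ∀ k l, ∑ i, c k i * a i l + ∑ i, d k i * b i l = if k = l then 2 else 0) :
    IsTorusParametrization (diagonalHom a b) := by
  refine ⟨fun i j => ?_, fun i j => ?_, ?_⟩
  · by_cases hij : i = j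
    · subst hij
      simpa [diagonalHom, diagonalGL_coe] using isLaurent_character (a i)
    · simpa [diagonalHom, diagonalGL_coe, hij] using isLaurent_zero
  · by_cases hij : i = j
    · subst hij
      simpa [diagonalHom, diagonalGL_coe] using isLaurent_character (b i)
    · simpa [diagonalHom, diagonalGL_coe, hij] using isLaurent_zero
  -- The arrays `c`, `d` invert the weight matrix up to the factor 2, so the kernel consists of
  -- elements of order dividing two.
  · have hfin : {t : Fin r → ℂˣ | ∀ k, t k ∈ rootsOfUnity 2 ℂ}.Finite := by
      have h2 : Finite (rootsOfUnity 2 ℂ) := inferInstance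
      exact Set.Finite.pi' fun _ : Fin r => Set.finite_coe_iff.1 h2
    refine Set.Finite.subset hfin fun t ht k => ?_
    have ha (i : Fin 3) : character (a i) t = 1 := by
      have h1 := congrArg (fun p : NetGroup => (p.1 : Matrix (Fin 3) (Fin 3) ℂ) i i)
        (MonoidHom.mem_ker.1 ht)
      simpa [diagonalHom, diagonalGL_coe] using h1
    have hb (i : Fin 3) : character (b i) t = 1 := by
      have h1 := congrArg (fun p : NetGroup => (p.2 : Matrix (Fin 3) (Fin 3) ℂ) i i)
        (MonoidHom.mem_ker.1 ht)
      simpa [diagonalHom, diagonalGL_coe] using h1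
    rw [mem_rootsOfUnity]
    have hprod : (∏ i, character (a i) t ^ c k i) * ∏ i, character (b i) t ^ d k i = t k ^ 2 := by
      have h1 : (∏ i, character (a i) t ^ c k i) * ∏ i, character (b i) t ^ d k i =
          ∏ l, t l ^ (∑ i, c k i * a i l + ∑ i, d k i * b i l) := by
        simp only [character, Fin.prod_univ_three, Fin.sum_univ_three, ← Finset.prod_zpow,
          ← Finset.prod_mul_distrib, ← zpow_mul, ← zpow_add]
        refine Finset.prod_congr rfl fun l _ => ?_
        congr 1
        ring
      rw [h1, Finset.prod_eq_single k]
      · rw [h, if_pos rfl]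
        rfl
      · intro l _ hl
        rw [h, if_neg hl.symm, zpow_zero]
      · simp
    rw [← hprod]
    simp [ha, hb]

/-! ### Monomial coordinates -/

/-- The net with the given coefficients at `x², y², z², xy, xz, yz`. -/
def netOf (c : Fin 3 → Fin 6 → ℂ) : Noc :=
  net (conic (c 0 0) (c 0 1) (c 0 2) (c 0 3) (c 0 4) (c 0 5))
    (conic (c 1 0) (c 1 1) (c 1 2) (c 1 3) (c 1 4) (c 1 5))
    (conic (c 2 0) (c 2 1) (c 2 2) (c 2 3) (c 2 4) (c 2 5))

/-- The pairs of indices of the monomials `x², y², z², xy, xz, yz`. -/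
def mon : Fin 6 → Fin 3 × Fin 3 := ![(0, 0), (1, 1), (2, 2), (0, 1), (0, 2), (1, 2)]

lemma netOf_apply (c : Fin 3 → Fin 6 → ℂ) (u : C3) (k : Fin 3) :
    netOf c u k = ∑ m, c k m * (u (mon m).1 * u (mon m).2) := by
  simp only [Fin.sum_univ_six, mon, Matrix.cons_val, netOf, net_apply]
  fin_cases k <;> simp

lemma exists_netOf (M : Noc) : ∃ c, M = netOf c := by
  obtain ⟨q₁, q₂, q₃, rfl⟩ := exists_net M
  obtain ⟨a₁, b₁, c₁, d₁, e₁, f₁, rfl⟩ := exists_conic q₁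
  obtain ⟨a₂, b₂, c₂, d₂, e₂, f₂, rfl⟩ := exists_conic q₂
  obtain ⟨a₃, b₃, c₃, d₃, e₃, f₃, rfl⟩ := exists_conic q₃
  exact ⟨![![a₁, b₁, c₁, d₁, e₁, f₁], ![a₂, b₂, c₂, d₂, e₂, f₂], ![a₃, b₃, c₃, d₃, e₃, f₃]], rfl⟩

/-- `netOf` as a linear map. -/
def netOfLinear : (Fin 3 → Fin 6 → ℂ) →ₗ[ℂ] Noc where
  toFun := netOf
  map_add' c d := by
    ext u k
    simp [netOf_apply, add_mul, Finset.sum_add_distrib]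
  map_smul' c d := by
    ext u k
    simp [netOf_apply, Finset.mul_sum, mul_assoc]

lemma netOf_eq_zero {c : Fin 3 → Fin 6 → ℂ} (h : netOf c = 0) : c = 0 := by
  have H (u : C3) (k : Fin 3) := congrFun (congrArg (fun M : Noc => M u) h) k
  simp only [netOf_apply, Fin.sum_univ_six, mon, Matrix.cons_val, _root_.zero_apply,
    Pi.zero_apply] at H
  ext k m
  have h1 := H ![1, 0, 0] k
  have h2 := H ![0, 1, 0] k
  have h3 := H ![0, 0, 1] k
  have h4 := H ![1, 1, 0] k
  have h5 := H ![1, 0, 1] k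
  have h6 := H ![0, 1, 1] k
  simp at h1 h2 h3 h4 h5 h6
  simp only [h1, h2, h3, zero_add, add_zero] at h4 h5 h6
  fin_cases m <;> simpa

/-- The weight of a monomial for a diagonal torus. -/
def monWeight {r : ℕ} (a b : Fin 3 → Fin r → ℤ) (k : Fin 3) (m : Fin 6) : Fin r → ℤ :=
  fun l => b k l - a (mon m).1 l - a (mon m).2 l

lemma character_sub {r : ℕ} (m n p : Fin r → ℤ) (t : Fin r → ℂˣ) :
    character (fun l => m l - n l - p l) t =
      character m t * (character n t)⁻¹ * (character p t)⁻¹ := by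
  simp [character, zpow_sub, Finset.prod_mul_distrib]

lemma action_diagonalHom_netOf {r : ℕ} (a b : Fin 3 → Fin r → ℤ) (t : Fin r → ℂˣ)
    (c : Fin 3 → Fin 6 → ℂ) : action (diagonalHom a b t) (netOf c) =
      netOf fun k m => (character (monWeight a b k m) t : ℂ) * c k m := by
  ext u k
  have h1 : ((diagonalHom a b t).1⁻¹ : GL (Fin 3) ℂ) =
      diagonalGL fun i => (character (a i) t)⁻¹ := by
    rw [← Pi.inv_def, map_inv]
    rfl
  have h2 : (diagonalHom a b t).2 = diagonalGL fun i => character (b i) t := rfl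
  rw [action_apply, h1, h2, diagonalGL_coe, diagonalGL_coe, Matrix.mulVec_diagonal, netOf_apply,
    netOf_apply, Finset.mul_sum]
  refine Finset.sum_congr rfl fun m _ => ?_
  have hw : monWeight a b k m = fun l => b k l - a (mon m).1 l - a (mon m).2 l := rfl
  rw [Matrix.mulVec_diagonal, Matrix.mulVec_diagonal, hw, character_sub]
  push_cast
  ring

lemma infinitesimalAction_diagonal_netOf (x y : Fin 3 → ℂ) (c : Fin 3 → Fin 6 → ℂ) :
    infinitesimalAction (netOf c) (Matrix.diagonal x, Matrix.diagonal y) =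
      netOf fun k m => (y k - x (mon m).1 - x (mon m).2) * c k m := by
  ext u k
  rw [infinitesimalAction_apply, Pi.sub_apply, Matrix.mulVec_diagonal, netOf_apply, netOf_apply,
    QuadraticMap.polar, Pi.sub_apply, Pi.sub_apply, netOf_apply, netOf_apply, netOf_apply,
    Finset.mul_sum, ← Finset.sum_sub_distrib, ← Finset.sum_sub_distrib,
    ← Finset.sum_sub_distrib]
  refine Finset.sum_congr rfl fun m _ => ?_
  simp only [Pi.add_apply, Matrix.mulVec_diagonal]
  ring

/-! ### Maximal tori -/

/-- A diagonal torus fixing a net is maximal in the stabilizer if the matrices which commute with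
it and annihilate the net infinitesimally are tangent to it. -/
theorem isMaximalTorus_diagonalHom {r : ℕ} (a b : Fin 3 → Fin r → ℤ) (M : Noc)
    (hρ : IsTorusParametrization (diagonalHom a b))
    (hstab : ∀ t, action (diagonalHom a b t) M = M)
    (hlie : ∀ X Y : Matrix (Fin 3) (Fin 3) ℂ, infinitesimalAction M (X, Y) = 0 →
      (∀ i j, a i ≠ a j → X i j = 0) → (∀ i j, b i ≠ b j → Y i j = 0) →
      ∃ z : Fin r → ℂ, X = Matrix.diagonal (fun i => ∑ l, a i l * z l) ∧
        Y = Matrix.diagonal fun i => ∑ l, b i l * z l) :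
    IsMaximalTorus (diagonalHom a b).range (stabilizer M) := by
  refine ⟨⟨⟨r, _, hρ, rfl⟩, ?_⟩, ?_⟩
  · rintro _ ⟨t, rfl⟩
    exact hstab t
  rintro T' ⟨⟨r', ρ, ⟨hL₁, hL₂, -⟩, rfl⟩, hS⟩ hle
  rintro _ ⟨t', rfl⟩
  -- Since the exponential is onto ℂˣ, each element of the larger torus lies on a one-parameter
  -- group inside it, so it is enough to control the derivative of that group.
  obtain ⟨z, rfl⟩ := exists_expPath_one t'
  let g : ℂ → Matrix (Fin 3) (Fin 3) ℂ := fun s => (ρ (expPath z s)).1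
  let h : ℂ → Matrix (Fin 3) (Fin 3) ℂ := fun s => (ρ (expPath z s)).2
  have hg0 : g 0 = 1 := by simp [g, expPath_zero]
  have hh0 : h 0 = 1 := by simp [h, expPath_zero]
  have hgadd (s t) : g (s + t) = g s * g t := by simp [g, expPath_add]
  have hhadd (s t) : h (s + t) = h s * h t := by simp [h, expPath_add]
  let X : Matrix (Fin 3) (Fin 3) ℂ := .of fun i j => deriv (fun s => g s i j) 0
  let Y : Matrix (Fin 3) (Fin 3) ℂ := .of fun i j => deriv (fun s => h s i j) 0
  have hX (i j) : HasDerivAt (fun s => g s i j) (X i j) 0 :=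
    ((hL₁ i j).differentiable_expPath z 0).hasDerivAt
  have hY (i j) : HasDerivAt (fun s => h s i j) (Y i j) 0 :=
    ((hL₂ i j).differentiable_expPath z 0).hasDerivAt
  have hfix (s u) : (h s).mulVec (M u) = M ((g s).mulVec u) := by
    have h1 : action (ρ (expPath z s)) M = M := hS ⟨_, rfl⟩
    have h2 := action_apply (ρ (expPath z s)) M ((g s).mulVec u)
    rw [h1] at h2
    rw [h2, Matrix.mulVec_mulVec]
    have h3 : ((ρ (expPath z s)).1⁻¹ : GL (Fin 3) ℂ).1 * g s = 1 :=
      Units.inv_mul (ρ (expPath z s)).1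
    rw [h3, Matrix.one_mulVec]
  -- The larger torus is commutative and contains the diagonal one. Entries linking different
  -- weights therefore vanish along the whole path.
  have hcomm (t s) : Commute (diagonalHom a b t) (ρ (expPath z s)) := by
    obtain ⟨t'', ht''⟩ := hle ⟨t, rfl⟩
    rw [← ht'']
    exact (Commute.all t'' (expPath z s)).map ρ
  have hoffX (i j) (hij : a i ≠ a j) : X i j = 0 := by
    obtain ⟨t, ht⟩ := exists_character_ne hij
    have h1 (s : ℂ) : g s i j = 0 := by
      have h2 := congrArg (fun p : NetGroup => (p.1 : Matrix (Fin 3) (Fin 3) ℂ) i j) (hcomm t s).eq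
      have h3 : (Matrix.diagonal (fun i => (character (a i) t : ℂ)) * g s) i j =
          (g s * Matrix.diagonal (fun i => (character (a i) t : ℂ))) i j := h2
      rw [Matrix.diagonal_mul, Matrix.mul_diagonal] at h3
      have h4 : ((character (a i) t : ℂ) - character (a j) t) * g s i j = 0 := by
        linear_combination h3
      exact (mul_eq_zero.1 h4).resolve_left fun h5 => ht (Units.ext (sub_eq_zero.1 h5))
    simp [X, h1]
  have hoffY (i j) (hij : b i ≠ b j) : Y i j = 0 := by
    obtain ⟨t, ht⟩ := exists_character_ne hij
    have h1 (s : ℂ) : h s i j = 0 := by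
      have h2 := congrArg (fun p : NetGroup => (p.2 : Matrix (Fin 3) (Fin 3) ℂ) i j) (hcomm t s).eq
      have h3 : (Matrix.diagonal (fun i => (character (b i) t : ℂ)) * h s) i j =
          (h s * Matrix.diagonal (fun i => (character (b i) t : ℂ))) i j := h2
      rw [Matrix.diagonal_mul, Matrix.mul_diagonal] at h3
      have h4 : ((character (b i) t : ℂ) - character (b j) t) * h s i j = 0 := by
        linear_combination h3
      exact (mul_eq_zero.1 h4).resolve_left fun h5 => ht (Units.ext (sub_eq_zero.1 h5))
    simp [Y, h1]
  obtain ⟨w, hwX, hwY⟩ := hlie X Y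
    (infinitesimalAction_eq_zero M g h X Y hg0 hX hY hfix) hoffX hoffY
  rw [hwX] at hX
  rw [hwY] at hY
  have hg1 := eq_diagonal_of_hasDerivAt g hg0 hgadd _ hX 1
  have hh1 := eq_diagonal_of_hasDerivAt h hh0 hhadd _ hY 1
  refine ⟨expPath w 1, Prod.ext (Units.ext ?_) (Units.ext ?_)⟩
  · refine Eq.trans ?_ hg1.symm
    simp only [← character_expPath]
    rfl
  · refine Eq.trans ?_ hh1.symm
    simp only [← character_expPath]
    rfl

/-! ### Positivity on the normal space -/

/-- A functional is positive on the normal weights if all monomials of nonpositive weight are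
tangent to the orbit. -/
theorem pos_of_isNormalWeight {r : ℕ} (a b : Fin 3 → Fin r → ℤ) (M : Noc) (v : Fin r → ℤ)
    (μ : Fin 3 → Fin 6 → ℕ) (hμ : ∀ k m, μ k m = 1 ∨ 0 < ∑ l, monWeight a b k m l * v l)
    (htan : ∀ c : Fin 3 → Fin 6 → ℂ, netOf (fun k m => μ k m * c k m) ∈ tangentSpace M)
    (m : Fin r → ℤ) (hm : IsNormalWeight M (diagonalHom a b) m) : 0 < ∑ l, m l * v l := by
  by_contra hneg
  obtain ⟨N, hN, hw⟩ := hm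
  obtain ⟨c, rfl⟩ := exists_netOf N
  -- A linear form detecting the normal vector turns the weight condition into a statement about
  -- scalar functions of one variable.
  obtain ⟨f, hf⟩ : ∃ f : NormalSpace M →ₗ[ℂ] ℂ, f (Submodule.Quotient.mk (netOf c)) ≠ 0 := by
    by_contra! H
    exact hN ((Module.forall_dual_apply_eq_zero_iff ℂ _).1 H)
  let G : (Fin 3 → Fin 6 → ℂ) →ₗ[ℂ] ℂ := f ∘ₗ (tangentSpace M).mkQ ∘ₗ netOfLinear
  have hG (c) : G c = f (Submodule.Quotient.mk (netOf c)) := rfl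
  have hGcont : Continuous G := G.continuous_of_finiteDimensional
  set w : Fin 3 → Fin 6 → ℤ := fun k m => ∑ l, monWeight a b k m l * v l with hwdef
  set e : ℤ := ∑ l, m l * v l with hedef
  let n : Fin 3 → Fin 6 → ℕ := fun k m => (w k m - e).toNat
  -- The action of the one-parameter subgroup `v`, divided by the supposed weight `e ≤ 0`. Marked
  -- monomials are dropped because they are tangent; the others have `w > 0 ≥ e`, so only positive
  -- powers of `s` occur and the path extends to 0.
  let P : ℂ → Fin 3 → Fin 6 → ℂ := fun s k m => if μ k m = 1 then 0 else s ^ n k m * c k m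
  have hchar (q : Fin r → ℤ) (s : ℂˣ) :
      character q (fun l => s ^ v l) = s ^ (∑ l, q l * v l) := by
    have hsum (S : Finset (Fin r)) : ∏ l ∈ S, (s ^ v l) ^ q l = s ^ (∑ l ∈ S, q l * v l) := by
      induction S using Finset.induction_on with
      | empty => simp
      | insert i S hi ih =>
        rw [Finset.prod_insert hi, Finset.sum_insert hi, ih, zpow_add, ← zpow_mul, mul_comm (q i)]
    exact hsum _
  have hP (s : ℂ) (hs : s ≠ 0) : G (P s) = G c := by
    have h1 := congrArg f (hw fun l => (Units.mk0 s hs) ^ v l)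
    rw [action_diagonalHom_netOf, ← hG, map_smul, ← hG, smul_eq_mul] at h1
    simp only [hchar, Units.val_zpow_eq_zpow_val, Units.val_mk0] at h1
    have h2 : P s = (s ^ (-e)) • (fun k m => s ^ w k m * c k m) -
        fun k m => (μ k m : ℂ) * (if μ k m = 1 then s ^ (w k m - e) * c k m else 0) := by
      ext k m
      simp only [P, Pi.sub_apply, Pi.smul_apply, smul_eq_mul, ← mul_assoc, ← zpow_add₀ hs]
      split_ifs with hk
      · rw [hk, neg_add_eq_sub]
        simp
      · have hpos : 0 ≤ w k m - e := by
          have := (hμ k m).resolve_left hk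
          simp only [hwdef]
          omega
        rw [← zpow_natCast, Int.toNat_of_nonneg hpos, neg_add_eq_sub]
        simp
    have h3 : G (fun k m => (μ k m : ℂ) * (if μ k m = 1 then s ^ (w k m - e) * c k m else 0)) =
        0 := by
      rw [hG, (Submodule.Quotient.mk_eq_zero _).2 (htan _), map_zero]
    rw [h2, map_sub, h3, sub_zero, map_smul, h1, smul_eq_mul, ← mul_assoc, ← zpow_add₀ hs,
      neg_add_cancel, zpow_zero, one_mul]
  have hPcont : Continuous P := by
    refine continuous_pi fun k => continuous_pi fun m => ?_
    by_cases hk : μ k m = 1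
    · simp only [P, hk, if_true]
      exact continuous_const
    · simp only [P, hk, if_false]
      fun_prop
  have hconst : (fun s => G (P s)) = fun _ => G c :=
    Continuous.ext_on (dense_compl_singleton (0 : ℂ)) (hGcont.comp hPcont) continuous_const hP
  have h0 := congrFun hconst 0
  have hP0 : P 0 = 0 := by
    ext k m
    change (if μ k m = 1 then 0 else (0 : ℂ) ^ n k m * c k m) = 0
    split_ifs with hk
    · rfl
    · have : n k m ≠ 0 := by
        have := (hμ k m).resolve_left hk
        simp only [n, hwdef]
        omega
      simp [this]
  simp only [hP0, map_zero] at h0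
  exact hf h0.symm

/-- A criterion for positivity which is checked by linear algebra. -/
theorem isPositivityWitness_diagonalHom {r : ℕ} {a b : Fin 3 → Fin r → ℤ} {M : Noc}
    {values : Fin r → ℝ} (v : Fin r → ℤ) (hv : ∀ l, values l = v l)
    (C : Fin 3 → Fin 6 → ℤ) (hC : M = netOf fun k m => C k m)
    (hCw : ∀ k m, C k m = 0 ∨ monWeight a b k m = 0)
    (c d : Fin r → Fin 3 → ℤ)
    (hker : ∀ k l, ∑ i, c k i * a i l + ∑ i, d k i * b i l = if k = l then 2 else 0)
    (hdiag : ∀ X Y : Matrix (Fin 3) (Fin 3) ℂ, infinitesimalAction M (X, Y) = 0 →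
      (∀ i j, a i ≠ a j → X i j = 0) → (∀ i j, b i ≠ b j → Y i j = 0) → X.IsDiag ∧ Y.IsDiag)
    (hlie : ∀ x y : Fin 3 → ℂ, (∀ k m, C k m ≠ 0 → y k = x (mon m).1 + x (mon m).2) →
      (∀ i, 2 * x i = ∑ l, a i l * (∑ j, c l j * x j + ∑ j, d l j * y j)) ∧
      ∀ i, 2 * y i = ∑ l, b i l * (∑ j, c l j * x j + ∑ j, d l j * y j))
    (μ : Fin 3 → Fin 6 → ℕ) (hμ : ∀ k m, μ k m = 1 ∨ 0 < ∑ l, monWeight a b k m l * v l)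
    (htan : ∀ c : Fin 3 → Fin 6 → ℂ, netOf (fun k m => μ k m * c k m) ∈ tangentSpace M) :
    IsPositivityWitness M (diagonalHom a b) (Fintype.linearCombination ℝ values) := by
  have hρ := isTorusParametrization_diagonalHom a b c d hker
  refine ⟨hρ, isMaximalTorus_diagonalHom a b M hρ (fun t => ?_) fun X Y hXY hX hY => ?_,
    fun m hm => ?_⟩
  · rw [hC, action_diagonalHom_netOf]
    congr 1
    ext k m
    rcases hCw k m with h | h
    · simp [h]
    · simp [h, character]
  · obtain ⟨hXd, hYd⟩ := hdiag X Y hXY hX hY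
    rw [← hXd.diagonal_diag, ← hYd.diagonal_diag, hC, infinitesimalAction_diagonal_netOf] at hXY
    have hzero := netOf_eq_zero hXY
    obtain ⟨h1, h2⟩ := hlie X.diag Y.diag fun k m hkm => by
      have := congrFun (congrFun hzero k) m
      simp only [Pi.zero_apply, mul_eq_zero, Int.cast_eq_zero, hkm, or_false] at this
      linear_combination this
    -- The same approximate inverse of the weight matrix that bounds the kernel recovers the Lie
    -- algebra coordinates, hence the division by 2.
    refine ⟨fun l => (∑ j, c l j * X.diag j + ∑ j, d l j * Y.diag j) / 2, ?_, ?_⟩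
    · rw [← hXd.diagonal_diag, Matrix.diag_diagonal]
      congr 1
      ext i
      simp only [← mul_div_assoc]
      rw [← Finset.sum_div, ← h1]
      simp
    · rw [← hYd.diagonal_diag, Matrix.diag_diagonal]
      congr 1
      ext i
      simp only [← mul_div_assoc]
      rw [← Finset.sum_div, ← h2]
      simp
  · have := pos_of_isNormalWeight a b M v μ hμ htan m hm
    rw [Fintype.linearCombination_apply]
    simp only [smul_eq_mul, hv]
    exact_mod_cast this

lemma isDiag_of_injective {r : ℕ} {a b : Fin 3 → Fin r → ℤ} (ha : ∀ i j, a i = a j → i = j)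
    (hb : ∀ i j, b i = b j → i = j) (X Y : Matrix (Fin 3) (Fin 3) ℂ)
    (hX : ∀ i j, a i ≠ a j → X i j = 0) (hY : ∀ i j, b i ≠ b j → Y i j = 0) :
    X.IsDiag ∧ Y.IsDiag :=
  ⟨fun i j h => hX i j fun h' => h (ha i j h'), fun i j h => hY i j fun h' => h (hb i j h')⟩

/-! ### The rows of the table -/

lemma infinitesimalAction_eq_zero_iff {M : Noc} {X Y : Matrix (Fin 3) (Fin 3) ℂ} :
    infinitesimalAction M (X, Y) = 0 ↔
      ∀ u k, Y.mulVec (M u) k = QuadraticMap.polar M u (X.mulVec u) k := by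
  constructor
  · intro h u k
    have := congrFun (congrArg (fun N : Noc => N u) h) k
    simpa [infinitesimalAction_apply, sub_eq_zero] using this
  · intro h
    ext u k
    simp [infinitesimalAction_apply, h u k]

/-- The data here and in the rows below are: φ as an integral vector, the coefficients of the net,
two arrays inverting the weight matrix up to 2, and a 0-1 array marking monomials that include all
those of nonpositive weight. The final matrices solve the linear equation expressing an arbitrary
combination of the marked monomials as a tangent vector. -/
lemma isPositivityWitness_C : IsPositivityWitness (table .C).representative (table .C).torus
    (table .C).functional := by
  refine isPositivityWitness_diagonalHom (r := 2) ![1, 0] ?_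
    ![![0, 1, 0, 0, 2, 0], ![0, 0, 0, 0, 0, 2], ![-1, 0, 0, 0, 0, 0]] ?_ (by decide)
    ![![1, 0, 0], ![0, 0, 1]] ![![0, 0, 0], ![0, 0, 0]] (by decide) ?_ ?_
    ![![1, 1, 0, 1, 1, 0], ![1, 1, 0, 1, 1, 1], ![1, 0, 0, 0, 0, 0]] (by decide)
    fun c => ⟨(!![-c 0 4 / 2, 0, 0; -c 0 3 / 3 + c 1 1 / 3 - c 1 4 / 6, -c 0 1 / 2, 0;
      -c 1 3 / 2, -c 0 3 / 6 - c 1 1 / 3 + c 1 4 / 6, 0],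
      !![0, 0, -c 0 0 + c 1 3; -c 0 3 / 3 + c 1 1 / 3 + c 1 4 / 3, -c 0 1 / 2 + c 1 5 / 2,
        -c 1 0; 0, 0, -c 0 4 - c 2 0]), ?_⟩
  · intro l
    fin_cases l <;> simp [table]
  · ext u k
    fin_cases k <;> simp [table, netOf, net_apply]
  · exact fun X Y _ hX hY => isDiag_of_injective (by decide) (by decide) X Y hX hY
  · intro x y h
    simp [Fin.forall_fin_succ, mon, Fin.sum_univ_succ, table] at h ⊢
    grind
  · ext u k
    fin_cases k <;> simp [infinitesimalAction_apply, table, netOf, net_apply, QuadraticMap.polar,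
      Matrix.vecHead, Matrix.vecTail] <;> ring

/-- Repeated weights leave a 2 by 2 block for x and y. It must fix the two squares (x ± y)² of the
binary pencil and the line y, three points of ℙ¹, so the block is scalar. -/
lemma isPositivityWitness_F : IsPositivityWitness (table .F).representative (table .F).torus
    (table .F).functional := by
  refine isPositivityWitness_diagonalHom (r := 2) ![1, 0] ?_
    ![![1, 1, 0, 0, 0, 0], ![0, 0, 0, 2, 0, 0], ![0, 0, 0, 0, 0, 2]] ?_ (by decide)
    ![![2, 0, 0], ![0, 0, 2]] ![![0, 0, 0], ![0, 0, 0]] (by decide) ?_ ?_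
    ![![1, 1, 0, 1, 0, 0], ![1, 1, 0, 1, 0, 0], ![1, 1, 0, 1, 1, 1]] (by decide)
    fun c => ⟨(!![-c 0 0 / 2 + c 0 1 / 2, c 1 0 / 2 - c 1 1 / 2 - c 2 4 / 2, 0; -c 2 4 / 2, 0, 0;
      -c 2 3 / 2, c 2 0 / 2 - c 2 1 / 2, -c 2 5 / 2],
      !![c 0 1, c 0 3 / 2 + c 1 0 / 2 - c 1 1 / 2 - c 2 4, 0; c 1 0 - c 2 4,
        -c 0 0 / 2 + c 0 1 / 2 + c 1 3 / 2, 0; c 2 0, 0, 0]), ?_⟩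
  · intro l
    fin_cases l <;> simp [table]
  · ext u k
    fin_cases k <;> simp [table, netOf, net_apply]
  · intro X Y h hX hY
    dsimp only [table] at hX hY
    have z1 : X 0 2 = 0 := hX 0 2 (by decide)
    have z2 : X 1 2 = 0 := hX 1 2 (by decide)
    have z3 : X 2 0 = 0 := hX 2 0 (by decide)
    have z4 : X 2 1 = 0 := hX 2 1 (by decide)
    have z5 : Y 0 2 = 0 := hY 0 2 (by decide)
    have z6 : Y 1 2 = 0 := hY 1 2 (by decide)
    have z7 : Y 2 0 = 0 := hY 2 0 (by decide)
    have z8 : Y 2 1 = 0 := hY 2 1 (by decide)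
    have h1 := infinitesimalAction_eq_zero_iff.1 h ![1, 0, 0]
    have h2 := infinitesimalAction_eq_zero_iff.1 h ![0, 1, 0]
    have h3 := infinitesimalAction_eq_zero_iff.1 h ![0, 0, 1]
    have h4 := infinitesimalAction_eq_zero_iff.1 h ![1, 1, 0]
    have h5 := infinitesimalAction_eq_zero_iff.1 h ![1, 0, 1]
    have h6 := infinitesimalAction_eq_zero_iff.1 h ![0, 1, 1]
    simp [Fin.forall_fin_succ, table, net_apply, QuadraticMap.polar, Matrix.mulVec, dotProduct,
      Fin.sum_univ_three, Matrix.vecHead, Matrix.vecTail] at h1 h2 h3 h4 h5 h6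
    constructor <;> intro i j hij <;> fin_cases i <;> fin_cases j <;>
      first | exact absurd rfl hij | assumption | (simp; grind)
  · intro x y h
    simp [Fin.forall_fin_succ, mon, Fin.sum_univ_succ, table] at h ⊢
    grind
  · ext u k
    fin_cases k <;> simp [infinitesimalAction_apply, table, netOf, net_apply, QuadraticMap.polar,
      Matrix.vecHead, Matrix.vecTail] <;> ring

/-- The block for x and y must preserve the two factors of x² + y² and the line x, again three
points of ℙ¹; hence it is scalar. -/
lemma isPositivityWitness_Fdual : IsPositivityWitness (table .Fdual).representative (table
  .Fdual).torus
    (table .Fdual).functional := by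
  refine isPositivityWitness_diagonalHom (r := 2) ![-1, 0] ?_
    ![![1, 1, 0, 0, 0, 0], ![0, 0, 0, 0, 1, 0], ![0, 0, 1, 0, 0, 0]] ?_ (by decide)
    ![![2, 0, 0], ![0, 0, 2]] ![![0, 0, 0], ![0, 0, 0]] (by decide) ?_ ?_
    ![![1, 1, 1, 1, 1, 1], ![0, 0, 1, 0, 1, 1], ![0, 0, 1, 0, 0, 0]] (by decide)
    fun c => ⟨(!![-c 0 0 / 2, -c 1 5, 0; -c 0 3 / 2 + c 1 5, -c 0 1 / 2, -c 0 5 / 2; 0, 0, 0],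
      !![0, c 0 4, c 0 2; 0, -c 0 0 / 2 + c 1 4, c 1 2; 0, 0, c 2 2]), ?_⟩
  · intro l
    fin_cases l <;> simp [table]
  · ext u k
    fin_cases k <;> simp [table, netOf, net_apply]
  · intro X Y h hX hY
    dsimp only [table] at hX hY
    have z1 : X 0 2 = 0 := hX 0 2 (by decide)
    have z2 : X 1 2 = 0 := hX 1 2 (by decide)
    have z3 : X 2 0 = 0 := hX 2 0 (by decide)
    have z4 : X 2 1 = 0 := hX 2 1 (by decide)
    have z5 : Y 0 1 = 0 := hY 0 1 (by decide)
    have z6 : Y 0 2 = 0 := hY 0 2 (by decide)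
    have z7 : Y 1 0 = 0 := hY 1 0 (by decide)
    have z8 : Y 1 2 = 0 := hY 1 2 (by decide)
    have z9 : Y 2 0 = 0 := hY 2 0 (by decide)
    have z10 : Y 2 1 = 0 := hY 2 1 (by decide)
    have h1 := infinitesimalAction_eq_zero_iff.1 h ![1, 0, 0]
    have h2 := infinitesimalAction_eq_zero_iff.1 h ![0, 1, 0]
    have h3 := infinitesimalAction_eq_zero_iff.1 h ![0, 0, 1]
    have h4 := infinitesimalAction_eq_zero_iff.1 h ![1, 1, 0]
    have h5 := infinitesimalAction_eq_zero_iff.1 h ![1, 0, 1]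
    have h6 := infinitesimalAction_eq_zero_iff.1 h ![0, 1, 1]
    simp [Fin.forall_fin_succ, table, net_apply, QuadraticMap.polar, Matrix.mulVec, dotProduct,
      Fin.sum_univ_three, Matrix.vecHead, Matrix.vecTail] at h1 h2 h3 h4 h5 h6
    constructor <;> intro i j hij <;> fin_cases i <;> fin_cases j <;>
      first | exact absurd rfl hij | assumption | (simp; grind)
  · intro x y h
    simp [Fin.forall_fin_succ, mon, Fin.sum_univ_succ, table] at h ⊢
    grind
  · ext u k
    fin_cases k <;> simp [infinitesimalAction_apply, table, netOf, net_apply, QuadraticMap.polar,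
      Matrix.vecHead, Matrix.vecTail] <;> ring

lemma isPositivityWitness_G : IsPositivityWitness (table .G).representative (table .G).torus
    (table .G).functional := by
  refine isPositivityWitness_diagonalHom (r := 3) ![1, 2, 0] ?_
    ![![1, 0, 0, 0, 0, 0], ![0, 1, 0, 0, 0, 0], ![0, 0, 0, 0, 0, 1]] ?_ (by decide)
    ![![2, 0, 0], ![0, 2, 0], ![0, 0, 2]] ![![0, 0, 0], ![0, 0, 0], ![0, 0, 0]] (by decide) ?_ ?_
    ![![1, 1, 0, 1, 0, 1], ![0, 1, 0, 0, 0, 0], ![1, 1, 0, 1, 0, 1]] (by decide)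
    fun c => ⟨(!![-c 0 0 / 2, -c 0 3 / 2, 0; 0, 0, 0; -c 2 3, -c 2 1, -c 2 5],
      !![0, c 0 1, c 0 5; 0, c 1 1, 0; c 2 0, 0, 0]), ?_⟩
  · intro l
    fin_cases l <;> simp [table]
  · ext u k
    fin_cases k <;> simp [table, netOf, net_apply]
  · exact fun X Y _ hX hY => isDiag_of_injective (by decide) (by decide) X Y hX hY
  · intro x y h
    simp [Fin.forall_fin_succ, mon, Fin.sum_univ_succ, table] at h ⊢
    grind
  · ext u k
    fin_cases k <;> simp [infinitesimalAction_apply, table, netOf, net_apply, QuadraticMap.polar,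
      Matrix.vecHead, Matrix.vecTail] <;> ring

lemma isPositivityWitness_Gdual : IsPositivityWitness (table .Gdual).representative (table
  .Gdual).torus
    (table .Gdual).functional := by
  refine isPositivityWitness_diagonalHom (r := 3) ![-1, -2, 0] ?_
    ![![0, 0, 0, 1, 0, 0], ![0, 0, 0, 0, 1, 0], ![0, 0, 1, 0, 0, 0]] ?_ (by decide)
    ![![2, 0, 0], ![0, 2, 0], ![0, 0, 2]] ![![0, 0, 0], ![0, 0, 0], ![0, 0, 0]] (by decide) ?_ ?_
    ![![1, 0, 1, 1, 1, 1], ![0, 0, 1, 0, 1, 0], ![0, 0, 1, 0, 0, 0]] (by decide)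
    fun c => ⟨(!![0, 0, -c 0 5; -c 0 0, -c 0 3, -c 0 4; 0, 0, 0],
      !![0, 0, c 0 2; 0, c 1 4, -c 0 5 + c 1 2; 0, 0, c 2 2]), ?_⟩
  · intro l
    fin_cases l <;> simp [table]
  · ext u k
    fin_cases k <;> simp [table, netOf, net_apply]
  · exact fun X Y _ hX hY => isDiag_of_injective (by decide) (by decide) X Y hX hY
  · intro x y h
    simp [Fin.forall_fin_succ, mon, Fin.sum_univ_succ, table] at h ⊢
    grind
  · ext u k
    fin_cases k <;> simp [infinitesimalAction_apply, table, netOf, net_apply, QuadraticMap.polar,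
      Matrix.vecHead, Matrix.vecTail] <;> ring

lemma isPositivityWitness_H : IsPositivityWitness (table .H).representative (table .H).torus
    (table .H).functional := by
  refine isPositivityWitness_diagonalHom (r := 2) ![1, 0] ?_
    ![![1, 0, 0, 0, 0, 0], ![0, 0, 0, 2, 0, 0], ![0, 1, 0, 0, 2, 0]] ?_ (by decide)
    ![![1, 0, 0], ![0, 0, 1]] ![![0, 0, 0], ![0, 0, 0]] (by decide) ?_ ?_
    ![![1, 0, 0, 0, 0, 0], ![1, 0, 0, 1, 0, 0], ![1, 1, 0, 1, 1, 0]] (by decide)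
    fun c => ⟨(!![0, 0, 0; 0, -c 2 1 / 2, 0; -c 2 0 / 2, -c 2 3 / 2, -c 2 4 / 2],
      !![c 0 0, 0, 0; c 1 0, c 1 3 / 2 - c 2 1 / 2, 0; 0, 0, 0]), ?_⟩
  · intro l
    fin_cases l <;> simp [table]
  · ext u k
    fin_cases k <;> simp [table, netOf, net_apply]
  · exact fun X Y _ hX hY => isDiag_of_injective (by decide) (by decide) X Y hX hY
  · intro x y h
    simp [Fin.forall_fin_succ, mon, Fin.sum_univ_succ, table] at h ⊢
    grind
  · ext u k
    fin_cases k <;> simp [infinitesimalAction_apply, table, netOf, net_apply, QuadraticMap.polar,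
      Matrix.vecHead, Matrix.vecTail] <;> ring

lemma isPositivityWitness_I : IsPositivityWitness (table .I).representative (table .I).torus
    (table .I).functional := by
  refine isPositivityWitness_diagonalHom (r := 3) ![0, 0, -1] ?_
    ![![1, 0, 0, 0, 0, 0], ![0, 0, 0, 1, 0, 0], ![0, 1, 0, 0, 0, 0]] ?_ (by decide)
    ![![2, 0, 0], ![0, 2, 0], ![0, 0, 2]] ![![0, 0, 0], ![0, 0, 0], ![0, 0, 0]] (by decide) ?_ ?_
    ![![1, 1, 0, 1, 0, 0], ![1, 1, 0, 1, 0, 0], ![1, 1, 0, 1, 0, 0]] (by decide)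
    fun c => ⟨(!![0, 0, 0; 0, 0, 0; 0, 0, 0],
      !![c 0 0, c 0 3, c 0 1; c 1 0, c 1 3, c 1 1; c 2 0, c 2 3, c 2 1]), ?_⟩
  · intro l
    fin_cases l <;> simp [table]
  · ext u k
    fin_cases k <;> simp [table, netOf, net_apply]
  · exact fun X Y _ hX hY => isDiag_of_injective (by decide) (by decide) X Y hX hY
  · intro x y h
    simp [Fin.forall_fin_succ, mon, Fin.sum_univ_succ, table] at h ⊢
    grind
  · ext u k
    fin_cases k <;> simp [infinitesimalAction_apply, table, netOf, net_apply, QuadraticMap.polar,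
      Matrix.vecHead, Matrix.vecTail] <;> ring

lemma isPositivityWitness_Idual : IsPositivityWitness (table .Idual).representative (table
  .Idual).torus
    (table .Idual).functional := by
  refine isPositivityWitness_diagonalHom (r := 3) ![0, 0, 1] ?_
    ![![0, 0, 0, 0, 1, 0], ![0, 0, 0, 0, 0, 1], ![0, 0, 1, 0, 0, 0]] ?_ (by decide)
    ![![2, 0, 0], ![0, 2, 0], ![0, 0, 2]] ![![0, 0, 0], ![0, 0, 0], ![0, 0, 0]] (by decide) ?_ ?_
    ![![0, 0, 1, 0, 1, 1], ![0, 0, 1, 0, 1, 1], ![0, 0, 1, 0, 0, 0]] (by decide)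
    fun c => ⟨(!![-c 0 4, -c 0 5, -c 0 2; -c 1 4, -c 1 5, -c 1 2; 0, 0, 0],
      !![0, 0, 0; 0, 0, 0; 0, 0, c 2 2]), ?_⟩
  · intro l
    fin_cases l <;> simp [table]
  · ext u k
    fin_cases k <;> simp [table, netOf, net_apply]
  · exact fun X Y _ hX hY => isDiag_of_injective (by decide) (by decide) X Y hX hY
  · intro x y h
    simp [Fin.forall_fin_succ, mon, Fin.sum_univ_succ, table] at h ⊢
    grind
  · ext u k
    fin_cases k <;> simp [infinitesimalAction_apply, table, netOf, net_apply, QuadraticMap.polar,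
      Matrix.vecHead, Matrix.vecTail] <;> ring

/-- All weights on U coincide, so diagonality comes only from the net: the pencil has four base
points, no three collinear, and an infinitesimal symmetry fixing them is scalar. -/
lemma isPositivityWitness_pencil1111 : IsPositivityWitness (table .pencil1111).representative
  (table .pencil1111).torus
    (table .pencil1111).functional := by
  refine isPositivityWitness_diagonalHom (r := 2) ![0, 1] ?_
    ![![1, 0, 0, 0, -1, 0], ![0, 1, 0, 0, 0, -1], ![0, 0, 0, 0, 0, 0]] ?_ (by decide)
    ![![2, 0, 0], ![0, 0, 0]] ![![0, 0, 0], ![0, 0, 2]] (by decide) ?_ ?_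
    ![![1, 1, 1, 1, 1, 1], ![1, 1, 1, 1, 1, 1], ![0, 0, 0, 0, 0, 0]] (by decide)
    fun c => ⟨(!![-c 0 0 - c 0 1 - 2 * c 0 2 - c 0 4 + 2 * c 1 0 + c 1 3 + 2 * c 1 4,
      c 0 1 + c 0 5, c 0 2; c 1 0 + c 1 4, c 0 1 + c 0 3 + 2 * c 0 5 - c 1 1 - 2 * c 1 2 - c 1 5,
      c 1 2; 2 * c 1 0 + c 1 3 + 2 * c 1 4, 2 * c 0 1 + c 0 3 + 2 * c 0 5, -c 0 1],
      !![-c 0 0 - 2 * c 0 1 - 4 * c 0 2 - 2 * c 0 4 + 2 * c 1 0 + c 1 3 + 2 * c 1 4, c 0 1, 0;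
        c 1 0, c 0 3 + 2 * c 0 5 - c 1 1 - 4 * c 1 2 - 2 * c 1 5, 0; 0, 0, 0]), ?_⟩
  · intro l
    fin_cases l <;> simp [table]
  · ext u k
    fin_cases k <;> simp [table, netOf, net_apply] <;> ring
  · intro X Y h hX hY
    dsimp only [table] at hX hY
    have z1 : Y 0 2 = 0 := hY 0 2 (by decide)
    have z2 : Y 1 2 = 0 := hY 1 2 (by decide)
    have z3 : Y 2 0 = 0 := hY 2 0 (by decide)
    have z4 : Y 2 1 = 0 := hY 2 1 (by decide)
    have h1 := infinitesimalAction_eq_zero_iff.1 h ![1, 0, 0]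
    have h2 := infinitesimalAction_eq_zero_iff.1 h ![0, 1, 0]
    have h3 := infinitesimalAction_eq_zero_iff.1 h ![0, 0, 1]
    have h4 := infinitesimalAction_eq_zero_iff.1 h ![1, 1, 0]
    have h5 := infinitesimalAction_eq_zero_iff.1 h ![1, 0, 1]
    have h6 := infinitesimalAction_eq_zero_iff.1 h ![0, 1, 1]
    simp [Fin.forall_fin_succ, table, net_apply, QuadraticMap.polar, Matrix.mulVec, dotProduct,
      Fin.sum_univ_three, Matrix.vecHead, Matrix.vecTail] at h1 h2 h3 h4 h5 h6
    constructor <;> intro i j hij <;> fin_cases i <;> fin_cases j <;>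
      first | exact absurd rfl hij | assumption | (simp; grind)
  · intro x y h
    simp [Fin.forall_fin_succ, mon, Fin.sum_univ_succ, table] at h ⊢
    grind
  · ext u k
    fin_cases k <;> simp [infinitesimalAction_apply, table, netOf, net_apply, QuadraticMap.polar,
      Matrix.vecHead, Matrix.vecTail] <;> ring

/-- The block for x and y is scalar because the lines x, y and x + y are all preserved. -/
lemma isPositivityWitness_pencil211 : IsPositivityWitness (table .pencil211).representative
  (table .pencil211).torus
    (table .pencil211).functional := by
  refine isPositivityWitness_diagonalHom (r := 3) ![1, 0, 3] ?_
    ![![0, 0, 0, 1, 0, 0], ![0, 0, 0, 0, 1, 1], ![0, 0, 0, 0, 0, 0]] ?_ (by decide)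
    ![![2, 0, 0], ![0, 0, 2], ![0, 0, 0]] ![![0, 0, 0], ![0, 0, 0], ![0, 0, 2]] (by decide) ?_ ?_
    ![![1, 1, 0, 1, 0, 0], ![1, 1, 0, 1, 1, 1], ![0, 0, 0, 0, 0, 0]] (by decide)
    fun c => ⟨(!![c 0 0 - c 1 4, -c 0 1, 0; -c 0 0, c 0 1 - c 1 5, 0; -c 1 0, -c 1 1, 0],
      !![c 0 0 + c 0 1 + c 0 3 - c 1 4 - c 1 5, 0, 0; -c 1 0 - c 1 1 + c 1 3, 0, 0; 0, 0, 0]), ?_⟩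
  · intro l
    fin_cases l <;> simp [table]
  · ext u k
    fin_cases k <;> simp [table, netOf, net_apply]
  · intro X Y h hX hY
    dsimp only [table] at hX hY
    have z1 : X 0 2 = 0 := hX 0 2 (by decide)
    have z2 : X 1 2 = 0 := hX 1 2 (by decide)
    have z3 : X 2 0 = 0 := hX 2 0 (by decide)
    have z4 : X 2 1 = 0 := hX 2 1 (by decide)
    have z5 : Y 0 1 = 0 := hY 0 1 (by decide)
    have z6 : Y 0 2 = 0 := hY 0 2 (by decide)
    have z7 : Y 1 0 = 0 := hY 1 0 (by decide)
    have z8 : Y 1 2 = 0 := hY 1 2 (by decide)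
    have z9 : Y 2 0 = 0 := hY 2 0 (by decide)
    have z10 : Y 2 1 = 0 := hY 2 1 (by decide)
    have h1 := infinitesimalAction_eq_zero_iff.1 h ![1, 0, 0]
    have h2 := infinitesimalAction_eq_zero_iff.1 h ![0, 1, 0]
    have h3 := infinitesimalAction_eq_zero_iff.1 h ![0, 0, 1]
    have h4 := infinitesimalAction_eq_zero_iff.1 h ![1, 1, 0]
    have h5 := infinitesimalAction_eq_zero_iff.1 h ![1, 0, 1]
    have h6 := infinitesimalAction_eq_zero_iff.1 h ![0, 1, 1]
    simp [Fin.forall_fin_succ, table, net_apply, QuadraticMap.polar, Matrix.mulVec, dotProduct,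
      Fin.sum_univ_three, Matrix.vecHead, Matrix.vecTail] at h1 h2 h3 h4 h5 h6
    constructor <;> intro i j hij <;> fin_cases i <;> fin_cases j <;>
      first | exact absurd rfl hij | assumption | (simp; grind)
  · intro x y h
    simp [Fin.forall_fin_succ, mon, Fin.sum_univ_succ, table] at h ⊢
    grind
  · ext u k
    fin_cases k <;> simp [infinitesimalAction_apply, table, netOf, net_apply, QuadraticMap.polar,
      Matrix.vecHead, Matrix.vecTail] <;> ring

lemma isPositivityWitness_pencil31 : IsPositivityWitness (table .pencil31).representative (table
  .pencil31).torus
    (table .pencil31).functional := by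
  refine isPositivityWitness_diagonalHom (r := 3) ![0, 1, 5] ?_
    ![![0, 0, 0, 0, 1, 0], ![1, 0, 0, 0, 0, -1], ![0, 0, 0, 0, 0, 0]] ?_ (by decide)
    ![![0, 1, 0], ![0, 0, 1], ![0, 0, 0]] ![![0, 0, 0], ![0, 0, 0], ![0, 0, 2]] (by decide) ?_ ?_
    ![![0, 0, 1, 0, 1, 0], ![1, 0, 1, 0, 1, 1], ![0, 0, 0, 0, 0, 0]] (by decide)
    fun c => ⟨(!![-c 1 0 / 2, 0, -c 0 2; -2 * c 0 2 + c 1 4, c 1 5, c 1 2; 0, 0, 0],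
      !![c 0 4 - c 1 0 / 2, 0, 0; 0, 0, 0; 0, 0, 0]), ?_⟩
  · intro l
    fin_cases l <;> simp [table]
  · ext u k
    fin_cases k <;> simp [table, netOf, net_apply] <;> ring
  · exact fun X Y _ hX hY => isDiag_of_injective (by decide) (by decide) X Y hX hY
  · intro x y h
    simp [Fin.forall_fin_succ, mon, Fin.sum_univ_succ, table] at h ⊢
    grind
  · ext u k
    fin_cases k <;> simp [infinitesimalAction_apply, table, netOf, net_apply, QuadraticMap.polar,
      Matrix.vecHead, Matrix.vecTail] <;> ring

lemma isPositivityWitness_pencil22 : IsPositivityWitness (table .pencil22).representative (table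
  .pencil22).torus
    (table .pencil22).functional := by
  refine isPositivityWitness_diagonalHom (r := 4) ![1, 0, 0, 2] ?_
    ![![1, 0, 0, 0, 0, 0], ![0, 0, 0, 0, 0, 1], ![0, 0, 0, 0, 0, 0]] ?_ (by decide)
    ![![2, 0, 0], ![0, 2, 0], ![0, 0, 2], ![0, 0, 0]] ![![0, 0, 0], ![0, 0, 0], ![0, 0, 0], ![0,
      0, 2]] (by decide) ?_ ?_
    ![![1, 0, 0, 0, 0, 0], ![1, 1, 1, 1, 1, 1], ![1, 0, 0, 0, 0, 0]] (by decide)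
    fun c => ⟨(!![-c 0 0 / 2, 0, 0; -c 1 4, -c 1 5, -c 1 2; -c 1 3, -c 1 1, 0],
      !![0, 0, 0; c 1 0, 0, 0; c 2 0, 0, 0]), ?_⟩
  · intro l
    fin_cases l <;> simp [table]
  · ext u k
    fin_cases k <;> simp [table, netOf, net_apply]
  · exact fun X Y _ hX hY => isDiag_of_injective (by decide) (by decide) X Y hX hY
  · intro x y h
    simp [Fin.forall_fin_succ, mon, Fin.sum_univ_succ, table] at h ⊢
    grind
  · ext u k
    fin_cases k <;> simp [infinitesimalAction_apply, table, netOf, net_apply, QuadraticMap.polar,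
      Matrix.vecHead, Matrix.vecTail] <;> ring

lemma isPositivityWitness_pencil4 : IsPositivityWitness (table .pencil4).representative (table
  .pencil4).torus
    (table .pencil4).functional := by
  refine isPositivityWitness_diagonalHom (r := 3) ![1, 0, 5] ?_
    ![![0, 1, 0, 0, 1, 0], ![1, 0, 0, 0, 0, 0], ![0, 0, 0, 0, 0, 0]] ?_ (by decide)
    ![![1, 0, 0], ![0, 0, 1], ![0, 0, 0]] ![![0, 0, 0], ![0, 0, 0], ![0, 0, 2]] (by decide) ?_ ?_
    ![![1, 1, 0, 1, 1, 0], ![1, 0, 0, 0, 0, 0], ![0, 0, 0, 0, 0, 0]] (by decide)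
    fun c => ⟨(!![0, 0, 0; -c 0 3 / 2, -c 0 1 / 2, 0; -c 0 0, 0, -c 0 4],
      !![0, 0, 0; 0, c 1 0, 0; 0, 0, 0]), ?_⟩
  · intro l
    fin_cases l <;> simp [table]
  · ext u k
    fin_cases k <;> simp [table, netOf, net_apply] <;> ring
  · exact fun X Y _ hX hY => isDiag_of_injective (by decide) (by decide) X Y hX hY
  · intro x y h
    simp [Fin.forall_fin_succ, mon, Fin.sum_univ_succ, table] at h ⊢
    grind
  · ext u k
    fin_cases k <;> simp [infinitesimalAction_apply, table, netOf, net_apply, QuadraticMap.polar,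
      Matrix.vecHead, Matrix.vecTail] <;> ring

lemma isPositivityWitness_K : IsPositivityWitness (table .K).representative (table .K).torus
    (table .K).functional := by
  refine isPositivityWitness_diagonalHom (r := 4) ![0, -1, 0, 1] ?_
    ![![0, 1, 0, 0, 0, 0], ![0, 0, 1, 0, 0, 0], ![0, 0, 0, 0, 0, 0]] ?_ (by decide)
    ![![0, 2, 0], ![2, 0, 0], ![0, 0, 2], ![0, 0, 0]] ![![0, 0, 0], ![0, 0, 0], ![0, 0, 0], ![0,
      0, 2]] (by decide) ?_ ?_
    ![![0, 1, 1, 0, 0, 1], ![0, 1, 1, 0, 0, 1], ![0, 0, 0, 0, 0, 0]] (by decide)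
    fun c => ⟨(!![0, 0, 0; 0, -c 0 1 / 2, -c 0 5 / 2; 0, -c 1 5 / 2, -c 1 2 / 2],
      !![0, c 0 2, 0; c 1 1, 0, 0; 0, 0, 0]), ?_⟩
  · intro l
    fin_cases l <;> simp [table]
  · ext u k
    fin_cases k <;> simp [table, netOf, net_apply]
  · exact fun X Y _ hX hY => isDiag_of_injective (by decide) (by decide) X Y hX hY
  · intro x y h
    simp [Fin.forall_fin_succ, mon, Fin.sum_univ_succ, table] at h ⊢
    grind
  · ext u k
    fin_cases k <;> simp [infinitesimalAction_apply, table, netOf, net_apply, QuadraticMap.polar,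
      Matrix.vecHead, Matrix.vecTail] <;> ring

lemma isPositivityWitness_L : IsPositivityWitness (table .L).representative (table .L).torus
    (table .L).functional := by
  refine isPositivityWitness_diagonalHom (r := 4) ![1, 0, 0, 3] ?_
    ![![0, 0, 0, 1, 0, 0], ![0, 0, 0, 0, 1, 0], ![0, 0, 0, 0, 0, 0]] ?_ (by decide)
    ![![2, 0, 0], ![0, 2, 0], ![0, 0, 2], ![0, 0, 0]] ![![0, 0, 0], ![0, 0, 0], ![0, 0, 0], ![0,
      0, 2]] (by decide) ?_ ?_
    ![![1, 0, 0, 1, 1, 0], ![1, 0, 0, 1, 1, 0], ![0, 0, 0, 0, 0, 0]] (by decide)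
    fun c => ⟨(!![0, 0, 0; -c 0 0, -c 0 3, -c 0 4; -c 1 0, -c 1 3, -c 1 4],
      !![0, 0, 0; 0, 0, 0; 0, 0, 0]), ?_⟩
  · intro l
    fin_cases l <;> simp [table]
  · ext u k
    fin_cases k <;> simp [table, netOf, net_apply]
  · exact fun X Y _ hX hY => isDiag_of_injective (by decide) (by decide) X Y hX hY
  · intro x y h
    simp [Fin.forall_fin_succ, mon, Fin.sum_univ_succ, table] at h ⊢
    grind
  · ext u k
    fin_cases k <;> simp [infinitesimalAction_apply, table, netOf, net_apply, QuadraticMap.polar,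
      Matrix.vecHead, Matrix.vecTail] <;> ring

lemma isPositivityWitness_M : IsPositivityWitness (table .M).representative (table .M).torus
    (table .M).functional := by
  refine isPositivityWitness_diagonalHom (r := 4) ![0, 1, 0, 2] ?_
    ![![0, 0, 0, 0, 0, 1], ![0, 1, 0, 0, 0, 0], ![0, 0, 0, 0, 0, 0]] ?_ (by decide)
    ![![2, 0, 0], ![0, 2, 0], ![0, 0, 2], ![0, 0, 0]] ![![0, 0, 0], ![0, 0, 0], ![0, 0, 0], ![0,
      0, 2]] (by decide) ?_ ?_
    ![![0, 1, 0, 1, 0, 1], ![0, 1, 0, 0, 0, 0], ![0, 1, 0, 0, 0, 0]] (by decide)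
    fun c => ⟨(!![0, 0, 0; 0, 0, 0; -c 0 3, -c 0 1, -c 0 5],
      !![0, 0, 0; 0, c 1 1, 0; 0, c 2 1, 0]), ?_⟩
  · intro l
    fin_cases l <;> simp [table]
  · ext u k
    fin_cases k <;> simp [table, netOf, net_apply]
  · exact fun X Y _ hX hY => isDiag_of_injective (by decide) (by decide) X Y hX hY
  · intro x y h
    simp [Fin.forall_fin_succ, mon, Fin.sum_univ_succ, table] at h ⊢
    grind
  · ext u k
    fin_cases k <;> simp [infinitesimalAction_apply, table, netOf, net_apply, QuadraticMap.polar,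
      Matrix.vecHead, Matrix.vecTail] <;> ring

lemma isPositivityWitness_S : IsPositivityWitness (table .S).representative (table .S).torus
    (table .S).functional := by
  refine isPositivityWitness_diagonalHom (r := 4) ![0, 0, 1, 1] ?_
    ![![0, 0, -1, 1, 0, 0], ![0, 0, 0, 0, 0, 0], ![0, 0, 0, 0, 0, 0]] ?_ (by decide)
    ![![1, 0, 0], ![0, 1, 0], ![0, 0, 0], ![0, 0, 0]] ![![0, 0, 0], ![0, 0, 0], ![0, 2, 0], ![0,
      0, 2]] (by decide) ?_ ?_
    ![![1, 1, 1, 1, 1, 1], ![0, 0, 0, 0, 0, 0], ![0, 0, 0, 0, 0, 0]] (by decide)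
    fun c => ⟨(!![-c 0 3, -c 0 1, -c 0 5; -c 0 0, 0, -c 0 4; 0, 0, c 0 2 / 2],
      !![0, 0, 0; 0, 0, 0; 0, 0, 0]), ?_⟩
  · intro l
    fin_cases l <;> simp [table]
  · ext u k
    fin_cases k <;> simp [table, netOf, net_apply] <;> ring
  · exact fun X Y _ hX hY => isDiag_of_injective (by decide) (by decide) X Y hX hY
  · intro x y h
    simp [Fin.forall_fin_succ, mon, Fin.sum_univ_succ, table] at h ⊢
    grind
  · ext u k
    fin_cases k <;> simp [infinitesimalAction_apply, table, netOf, net_apply, QuadraticMap.polar,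
      Matrix.vecHead, Matrix.vecTail] <;> ring

lemma isPositivityWitness_PL : IsPositivityWitness (table .PL).representative (table .PL).torus
    (table .PL).functional := by
  refine isPositivityWitness_diagonalHom (r := 5) ![1, 0, 0, 3, 3] ?_
    ![![0, 0, 0, 1, 0, 0], ![0, 0, 0, 0, 0, 0], ![0, 0, 0, 0, 0, 0]] ?_ (by decide)
    ![![2, 0, 0], ![0, 2, 0], ![0, 0, 2], ![0, 0, 0], ![0, 0, 0]] ![![0, 0, 0], ![0, 0, 0], ![0,
      0, 0], ![0, 2, 0], ![0, 0, 2]] (by decide) ?_ ?_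
    ![![1, 0, 0, 1, 1, 0], ![0, 0, 0, 0, 0, 0], ![0, 0, 0, 0, 0, 0]] (by decide)
    fun c => ⟨(!![-c 0 3, 0, 0; -c 0 0, 0, -c 0 4; 0, 0, 0],
      !![0, 0, 0; 0, 0, 0; 0, 0, 0]), ?_⟩
  · intro l
    fin_cases l <;> simp [table]
  · ext u k
    fin_cases k <;> simp [table, netOf, net_apply]
  · exact fun X Y _ hX hY => isDiag_of_injective (by decide) (by decide) X Y hX hY
  · intro x y h
    simp [Fin.forall_fin_succ, mon, Fin.sum_univ_succ, table] at h ⊢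
    grind
  · ext u k
    fin_cases k <;> simp [infinitesimalAction_apply, table, netOf, net_apply, QuadraticMap.polar,
      Matrix.vecHead, Matrix.vecTail] <;> ring

lemma isPositivityWitness_DL : IsPositivityWitness (table .DL).representative (table .DL).torus
    (table .DL).functional := by
  refine isPositivityWitness_diagonalHom (r := 5) ![1, 0, 0, 3, 3] ?_
    ![![1, 0, 0, 0, 0, 0], ![0, 0, 0, 0, 0, 0], ![0, 0, 0, 0, 0, 0]] ?_ (by decide)
    ![![2, 0, 0], ![0, 2, 0], ![0, 0, 2], ![0, 0, 0], ![0, 0, 0]] ![![0, 0, 0], ![0, 0, 0], ![0,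
      0, 0], ![0, 2, 0], ![0, 0, 2]] (by decide) ?_ ?_
    ![![1, 0, 0, 0, 0, 0], ![0, 0, 0, 0, 0, 0], ![0, 0, 0, 0, 0, 0]] (by decide)
    fun c => ⟨(!![-c 0 0 / 2, 0, 0; 0, 0, 0; 0, 0, 0],
      !![0, 0, 0; 0, 0, 0; 0, 0, 0]), ?_⟩
  · intro l
    fin_cases l <;> simp [table]
  · ext u k
    fin_cases k <;> simp [table, netOf, net_apply]
  · exact fun X Y _ hX hY => isDiag_of_injective (by decide) (by decide) X Y hX hY
  · intro x y h
    simp [Fin.forall_fin_succ, mon, Fin.sum_univ_succ, table] at h ⊢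
    grind
  · ext u k
    fin_cases k <;> simp [infinitesimalAction_apply, table, netOf, net_apply, QuadraticMap.polar,
      Matrix.vecHead, Matrix.vecTail] <;> ring

lemma isPositivityWitness_zero : IsPositivityWitness (table .zero).representative (table
  .zero).torus
    (table .zero).functional := by
  refine isPositivityWitness_diagonalHom (r := 6) ![0, 0, 0, 1, 1, 1] ?_
    ![![0, 0, 0, 0, 0, 0], ![0, 0, 0, 0, 0, 0], ![0, 0, 0, 0, 0, 0]] ?_ (by decide)
    ![![2, 0, 0], ![0, 2, 0], ![0, 0, 2], ![0, 0, 0], ![0, 0, 0], ![0, 0, 0]]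
      ![![0, 0, 0], ![0, 0, 0], ![0, 0, 0], ![2, 0, 0], ![0, 2, 0], ![0, 0, 2]] (by decide) ?_ ?_
    ![![0, 0, 0, 0, 0, 0], ![0, 0, 0, 0, 0, 0], ![0, 0, 0, 0, 0, 0]] (by decide)
    fun c => ⟨(!![0, 0, 0; 0, 0, 0; 0, 0, 0],
      !![0, 0, 0; 0, 0, 0; 0, 0, 0]), ?_⟩
  · intro l
    fin_cases l <;> simp [table]
  · ext u k
    fin_cases k <;> simp [table, netOf, net_apply]
  · exact fun X Y _ hX hY => isDiag_of_injective (by decide) (by decide) X Y hX hY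
  · intro x y h
    simp [Fin.forall_fin_succ, mon, Fin.sum_univ_succ, table] at h ⊢
  · ext u k
    fin_cases k <;> simp [infinitesimalAction_apply, table, netOf, net_apply, QuadraticMap.polar,
      Matrix.vecHead, Matrix.vecTail]

/-! ### Positivity is invariant along orbits -/

lemma IsLaurent.add {r : ℕ} {f g : (Fin r → ℂˣ) → ℂ} (hf : IsLaurent f) (hg : IsLaurent g) :
    IsLaurent fun t => f t + g t := by
  classical
  obtain ⟨c, hc⟩ := hf
  obtain ⟨d, hd⟩ := hg
  refine ⟨c + d, fun t => ?_⟩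
  change f t + g t = _
  rw [Finsupp.sum_add_index' (by simp) (by intros; ring), hc, hd]

lemma IsLaurent.const_mul {r : ℕ} {f : (Fin r → ℂˣ) → ℂ} (hf : IsLaurent f) (a : ℂ) :
    IsLaurent fun t => a * f t := by
  obtain ⟨c, hc⟩ := hf
  refine ⟨a • c, fun t => ?_⟩
  change a * f t = _
  rw [Finsupp.sum_smul_index (by simp), hc, Finsupp.mul_sum]
  simp only [mul_assoc]

lemma IsLaurent.sum {r : ℕ} {ι : Type*} (s : Finset ι) {f : ι → (Fin r → ℂˣ) → ℂ}
    (hf : ∀ i, IsLaurent (f i)) : IsLaurent fun t => ∑ i ∈ s, f i t := by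
  classical
  induction s using Finset.induction_on with
  | empty => simpa using isLaurent_zero
  | insert i s hi ih => simpa only [Finset.sum_insert hi] using (hf i).add ih

lemma isLaurent_conj {r : ℕ} {f : (Fin r → ℂˣ) → Matrix (Fin 3) (Fin 3) ℂ}
    (hf : ∀ i j, IsLaurent fun t => f t i j) (P Q : Matrix (Fin 3) (Fin 3) ℂ) (i j : Fin 3) :
    IsLaurent fun t => (P * f t * Q) i j := by
  simp only [Matrix.mul_apply, Finset.sum_mul]
  refine IsLaurent.sum _ fun k => IsLaurent.sum _ fun l => ?_
  convert (hf l k).const_mul (P i l * Q k j) using 2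
  ring

/-- The conjugate of a parametrized torus. -/
def conjHom {r : ℕ} (p : NetGroup) (ρ : (Fin r → ℂˣ) →* NetGroup) : (Fin r → ℂˣ) →* NetGroup :=
  (MulAut.conj p).toMonoidHom.comp ρ

@[simp] lemma conjHom_apply {r : ℕ} (p : NetGroup) (ρ : (Fin r → ℂˣ) →* NetGroup)
    (t : Fin r → ℂˣ) : conjHom p ρ t = p * ρ t * p⁻¹ := rfl

lemma IsTorusParametrization.conj {r : ℕ} {ρ : (Fin r → ℂˣ) →* NetGroup}
    (h : IsTorusParametrization ρ) (p : NetGroup) : IsTorusParametrization (conjHom p ρ) := by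
  obtain ⟨h₁, h₂, h₃⟩ := h
  refine ⟨fun i j => isLaurent_conj h₁ p.1 (p.1⁻¹ : GL (Fin 3) ℂ) i j,
    fun i j => isLaurent_conj h₂ p.2 (p.2⁻¹ : GL (Fin 3) ℂ) i j, ?_⟩
  have : (conjHom p ρ).ker = ρ.ker := by
    ext t
    simp [MonoidHom.mem_ker, conj_eq_one_iff]
  rwa [this]

lemma range_conjHom {r : ℕ} (p : NetGroup) (ρ : (Fin r → ℂˣ) →* NetGroup) :
    (conjHom p ρ).range = ρ.range.map (MulAut.conj p).toMonoidHom :=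
  MonoidHom.range_comp _ _

lemma IsTorus.conj {T : Subgroup NetGroup} (hT : IsTorus T) (p : NetGroup) :
    IsTorus (T.map (MulAut.conj p).toMonoidHom) := by
  obtain ⟨r, ρ, hρ, rfl⟩ := hT
  exact ⟨r, conjHom p ρ, hρ.conj p, range_conjHom p ρ⟩

lemma action_inv_action (p : NetGroup) (M : Noc) : action p⁻¹ (action p M) = M := by
  rw [← Module.End.mul_apply, ← map_mul]
  simp

lemma conj_le_stabilizer {T : Subgroup NetGroup} {M : Noc} (h : T ≤ stabilizer M) (p : NetGroup) :
    T.map (MulAut.conj p).toMonoidHom ≤ stabilizer (action p M) := by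
  rintro _ ⟨q, hq, rfl⟩
  change action (p * q * p⁻¹) (action p M) = action p M
  have hqM : action q M = M := h hq
  rw [map_mul, map_mul, Module.End.mul_apply, Module.End.mul_apply, action_inv_action, hqM]

lemma map_conj_inv (T : Subgroup NetGroup) (p : NetGroup) :
    (T.map (MulAut.conj p).toMonoidHom).map (MulAut.conj p⁻¹).toMonoidHom = T := by
  rw [Subgroup.map_map]
  convert Subgroup.map_id T
  ext1 q
  simp [mul_assoc]

lemma IsMaximalTorus.conj {T : Subgroup NetGroup} {M : Noc}
    (h : IsMaximalTorus T (stabilizer M)) (p : NetGroup) :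
    IsMaximalTorus (T.map (MulAut.conj p).toMonoidHom) (stabilizer (action p M)) := by
  refine ⟨⟨h.1.1.conj p, conj_le_stabilizer h.1.2 p⟩, fun T' hT' hle => ?_⟩
  have h1 := conj_le_stabilizer hT'.2 p⁻¹
  rw [action_inv_action] at h1
  have h2 := h.2 ⟨hT'.1.conj p⁻¹, h1⟩ (by
    have := Subgroup.map_mono (f := (MulAut.conj p⁻¹).toMonoidHom) hle
    rwa [map_conj_inv] at this)
  have h3 := Subgroup.map_mono (f := (MulAut.conj p).toMonoidHom) h2
  have h4 := map_conj_inv T' p⁻¹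
  rw [inv_inv] at h4
  rwa [h4] at h3

/-- Transport by `p` conjugates the infinitesimal symmetry: the tangent vector of (X, Y) at `M`
becomes that of (gXg⁻¹, hYh⁻¹) at the moved net. -/
lemma action_mem_tangentSpace {M N : Noc} (hN : N ∈ tangentSpace M) (p : NetGroup) :
    action p N ∈ tangentSpace (action p M) := by
  obtain ⟨⟨X, Y⟩, rfl⟩ := hN
  let g : Matrix (Fin 3) (Fin 3) ℂ := p.1
  let g' : Matrix (Fin 3) (Fin 3) ℂ := (p.1⁻¹ : GL (Fin 3) ℂ)
  let h : Matrix (Fin 3) (Fin 3) ℂ := p.2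
  let h' : Matrix (Fin 3) (Fin 3) ℂ := (p.2⁻¹ : GL (Fin 3) ℂ)
  have hg : g' * g = 1 := Units.inv_mul p.1
  have hh : h' * h = 1 := Units.inv_mul p.2
  refine ⟨(g * X * g', h * Y * h'), QuadraticMap.ext fun u => ?_⟩
  rw [infinitesimalAction_apply, action_apply, action_apply, infinitesimalAction_apply]
  simp only [QuadraticMap.polar, action_apply]
  change (h * Y * h').mulVec (h.mulVec (M (g'.mulVec u))) -
    (h.mulVec (M (g'.mulVec (u + (g * X * g').mulVec u))) - h.mulVec (M (g'.mulVec u)) -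
      h.mulVec (M (g'.mulVec ((g * X * g').mulVec u)))) =
    h.mulVec (Y.mulVec (M (g'.mulVec u)) - (M (g'.mulVec u + X.mulVec (g'.mulVec u)) -
      M (g'.mulVec u) - M (X.mulVec (g'.mulVec u))))
  have h1 : (h * Y * h').mulVec (h.mulVec (M (g'.mulVec u))) =
      h.mulVec (Y.mulVec (M (g'.mulVec u))) := by
    rw [Matrix.mulVec_mulVec, Matrix.mulVec_mulVec, mul_assoc, hh, mul_one]
  have h2 : g'.mulVec ((g * X * g').mulVec u) = X.mulVec (g'.mulVec u) := by
    rw [Matrix.mulVec_mulVec, Matrix.mulVec_mulVec, ← mul_assoc, ← mul_assoc, hg, one_mul]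
  rw [h1, Matrix.mulVec_add, h2]
  simp only [Matrix.mulVec_sub]

lemma IsNormalWeight.of_conj {M : Noc} {r : ℕ} {ρ : (Fin r → ℂˣ) →* NetGroup} {m : Fin r → ℤ}
    (p : NetGroup) (h : IsNormalWeight (action p M) (conjHom p ρ) m) : IsNormalWeight M ρ m := by
  obtain ⟨N, hN, hw⟩ := h
  have hpN : action p (action p⁻¹ N) = N := by
    have := action_inv_action p⁻¹ N
    rwa [inv_inv] at this
  refine ⟨action p⁻¹ N, fun h0 => hN ?_, fun t => ?_⟩
  · rw [Submodule.Quotient.mk_eq_zero] at h0 ⊢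
    have := action_mem_tangentSpace h0 p
    rwa [hpN] at this
  · have h1 := hw t
    rw [← Submodule.Quotient.mk_smul, Submodule.Quotient.eq] at h1 ⊢
    have h2 := action_mem_tangentSpace h1 p⁻¹
    rw [action_inv_action, map_sub, map_smul] at h2
    convert h2 using 2
    simp only [← Module.End.mul_apply, ← map_mul]
    simp [mul_assoc]

/-- Conjugating the parametrization leaves the parameter torus and its characters unchanged, so the
same functional serves along the orbit. -/
lemma IsPositive.action {M : Noc} (h : IsPositive M) (p : NetGroup) : IsPositive (action p M) := by
  obtain ⟨r, ρ, φ, h₁, h₂, h₃⟩ := h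
  refine ⟨r, conjHom p ρ, φ, h₁.conj p, ?_, fun m hm => h₃ m (hm.of_conj p)⟩
  rw [range_conjHom]
  exact h₂.conj p

theorem isPositivityWitness_table (o : OrbitName) :
    IsPositivityWitness (table o).representative (table o).torus (table o).functional := by
  cases o
  case C => exact isPositivityWitness_C
  case F => exact isPositivityWitness_F
  case Fdual => exact isPositivityWitness_Fdual
  case G => exact isPositivityWitness_G
  case Gdual => exact isPositivityWitness_Gdual
  case H => exact isPositivityWitness_H
  case I => exact isPositivityWitness_I
  case Idual => exact isPositivityWitness_Idual
  case pencil1111 => exact isPositivityWitness_pencil1111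
  case pencil211 => exact isPositivityWitness_pencil211
  case pencil31 => exact isPositivityWitness_pencil31
  case pencil22 => exact isPositivityWitness_pencil22
  case pencil4 => exact isPositivityWitness_pencil4
  case K => exact isPositivityWitness_K
  case L => exact isPositivityWitness_L
  case M => exact isPositivityWitness_M
  case S => exact isPositivityWitness_S
  case PL => exact isPositivityWitness_PL
  case DL => exact isPositivityWitness_DL
  case zero => exact isPositivityWitness_zero

end NetsOfConics

end

/-- Every unstable orbit of nets of conics is positive; the unstable orbits are exactly those of
the table, and for each of them the functional of the table is a witness of positivity. -/
theorem proposition6p3 :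
    (∀ M : NetsOfConics.Noc, NetsOfConics.IsUnstable M → NetsOfConics.IsPositive M) ∧
    (∀ M : NetsOfConics.Noc, NetsOfConics.IsUnstable M ↔
      ∃ o : NetsOfConics.OrbitName,
        M ∈ NetsOfConics.orbit (NetsOfConics.table o).representative) ∧
    (∀ o : NetsOfConics.OrbitName,
      NetsOfConics.IsPositivityWitness (NetsOfConics.table o).representative
        (NetsOfConics.table o).torus (NetsOfConics.table o).functional) := by
  refine ⟨fun M hM => ?_, NetsOfConics.isUnstable_iff, NetsOfConics.isPositivityWitness_table⟩
  obtain ⟨o, p, rfl⟩ := (NetsOfConics.isUnstable_iff M).1 hM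
  exact NetsOfConics.IsPositive.action
    ⟨_, _, _, NetsOfConics.isPositivityWitness_table o⟩ p
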